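/- Let $\mathsf{k}$ be a field, let $M$ be a finitely generated free abelian group, and put $M_{\mathbb R}=\mathbb R\otimes_{\mathbb Z}M$. Let $C\subseteq M_{\mathbb R}$ be a rational polyhedral cone, that is, the set of all non-negative real linear combinations of a finite set of elements of $M$. Assume that $C$ is full-dimensional (it spans $M_{\mathbb R}$) and pointed (it contains no line). Let $R=\mathsf{k}[C\cap M]=\operatorname{Span}_{\mathsf k}\{x^m\mid m\in M\cap C\}$ be the associated toric algebra, a subalgebra of the Laurent ring $\mathsf{k}[M]$. For $v\in M_{\mathbb R}$ the conic module $A_v$ is the $R$-submodule $\operatorname{Span}_{\mathsf k}\{x^m\mid m\in M\cap(C+v)\}$ of $\mathsf{k}[M]$. The global dimension of a ring is the supremum (possibly infinite) of the projective dimensions of all its left modules and all its right modules. Theorem 6.1. There are only finitely many isomorphism classes of conic $R$-modules. Moreover, if $\mathbb A=A_{v_1}\oplus\cdots\oplus A_{v_s}$ is the direct sum of one representative from each isomorphism class of conic $R$-modules, then the global dimension of $\operatorname{End}_R(\mathbb A)$ equals the Krull dimension of $R$. -/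

import Mathlib

open scoped TensorProduct DirectSum

noncomputable section

namespace Toric

universe u v w

/-- The real vector space `M_ℝ = ℝ ⊗ M` of a lattice `M`. -/
abbrev RealSpace (M : Type v) [AddCommGroup M] : Type v := ℝ ⊗[ℤ] M

/-- The canonical map `M → M_ℝ`, `m ↦ 1 ⊗ m`. -/
def latticeMap (M : Type v) [AddCommGroup M] : M →+ RealSpace M :=
  (TensorProduct.mk ℤ ℝ M 1).toAddMonoidHom

variable {M : Type v} [AddCommGroup M]

/-- A cone is rational polyhedral if it consists of the non-negative real combinations of a finite
set of lattice elements. -/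
def IsRationalPolyhedral (C : PointedCone ℝ (RealSpace M)) : Prop :=
  ∃ s : Finset M, C = PointedCone.hull ℝ (latticeMap M '' (s : Set M))

/-- A cone is full-dimensional if it spans the ambient space. -/
def IsFullDimensional (C : PointedCone ℝ (RealSpace M)) : Prop :=
  Submodule.span ℝ (C : Set (RealSpace M)) = ⊤

/-- A cone is pointed (strongly convex) if it contains no line. (Mathlib's `PointedCone` only
requires that the cone contains the origin.) -/
def IsStronglyConvex (C : PointedCone ℝ (RealSpace M)) : Prop :=
  (C : ConvexCone ℝ (RealSpace M)).Salient

variable (k : Type u) [Field k]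

/-- The toric algebra `k[C ∩ M]`: the subalgebra of the Laurent ring `k[M]` of all elements whose
monomials `x ^ m` satisfy `m ∈ C`. -/
def toricAlgebra (C : PointedCone ℝ (RealSpace M)) : Subalgebra k (AddMonoidAlgebra k M) where
  carrier := {f | ∀ m : M, f.coeff m ≠ 0 → latticeMap M m ∈ C}
  mul_mem' := by
    classical
    intro f g hf hg m hm
    obtain ⟨a, ha, b, hb, rfl⟩ := Finset.mem_add.1
      (AddMonoidAlgebra.support_coeff_mul_subset f g (Finsupp.mem_support_iff.2 hm))
    rw [map_add]
    exact C.add_mem (hf a (Finsupp.mem_support_iff.1 ha)) (hg b (Finsupp.mem_support_iff.1 hb))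
  add_mem' := by
    intro f g hf hg m hm
    by_cases h : f.coeff m = 0
    · refine hg m fun h' => hm ?_
      simp [h, h']
    · exact hf m h
  algebraMap_mem' := by
    classical
    intro r m hm
    have : m = 0 := by
      by_contra h
      apply hm
      simp [AddMonoidAlgebra.coe_algebraMap, AddMonoidAlgebra.coeff_single, Ne.symm h]
    rw [this, map_zero]
    exact C.zero_mem

/-- The conic module `A_v`: the `k[C ∩ M]`-submodule of the Laurent ring `k[M]` of all elements
whose monomials `x ^ m` satisfy `m ∈ C + v`, that is `m - v ∈ C`. -/
def conicModule (C : PointedCone ℝ (RealSpace M)) (v : RealSpace M) :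
    Submodule (toricAlgebra k C) (AddMonoidAlgebra k M) where
  carrier := {f | ∀ m : M, f.coeff m ≠ 0 → latticeMap M m - v ∈ C}
  zero_mem' := by
    intro m hm
    exact absurd (by simp) hm
  add_mem' := by
    intro f g hf hg m hm
    by_cases h : f.coeff m = 0
    · refine hg m fun h' => hm ?_
      simp [h, h']
    · exact hf m h
  smul_mem' := by
    classical
    intro r f hf m hm
    have hm' : ((r : AddMonoidAlgebra k M) * f).coeff m ≠ 0 := hm
    obtain ⟨a, ha, b, hb, rfl⟩ := Finset.mem_add.1
      (AddMonoidAlgebra.support_coeff_mul_subset _ _ (Finsupp.mem_support_iff.2 hm'))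
    rw [map_add, add_sub_assoc]
    exact C.add_mem (r.2 a (Finsupp.mem_support_iff.1 ha)) (hf b (Finsupp.mem_support_iff.1 hb))

/-- The direct sum `⨁ i, A_{v i}` of a family of conic modules. -/
def ConicSum (C : PointedCone ℝ (RealSpace M)) {ι : Type w} (v : ι → RealSpace M) :
    Type (max u v w) :=
  ⨁ i : ι, conicModule k C (v i)

instance (C : PointedCone ℝ (RealSpace M)) {ι : Type w} (v : ι → RealSpace M) :
    AddCommGroup (ConicSum k C v) :=
  @DirectSum.instAddCommGroup ι (fun i => conicModule k C (v i))
    (fun i => Submodule.addCommGroup (conicModule k C (v i)))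

instance (C : PointedCone ℝ (RealSpace M)) {ι : Type w} (v : ι → RealSpace M) :
    Module (toricAlgebra k C) (ConicSum k C v) :=
  (inferInstance : Module (toricAlgebra k C) (⨁ i : ι, conicModule k C (v i)))

/-- The global dimension of a (not necessarily commutative) ring: the supremum of the projective
dimensions of all left modules and all right modules. Right modules are modules over the opposite
ring; the zero module has projective dimension `⊥`. -/
def globalDimension (Λ : Type u) [Ring Λ] : WithBot ℕ∞ :=
  max (⨆ X : ModuleCat.{u} Λ, CategoryTheory.projectiveDimension X)
    (⨆ X : ModuleCat.{u} Λᵐᵒᵖ, CategoryTheory.projectiveDimension X)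

end Toric

end

/-! Let `n` be the rank of `M`. Each facet of the cone is given by a primitive integral form `l j`,
and `x ^ m` lies in `A_v` exactly when `l j m ≥ ⌈l j v⌉` for all `j`. So `A_v` depends only on its
vector of round-ups, its position. A homomorphism `A_x → A_y` is multiplication by a Laurent
polynomial whose exponents `m` satisfy `pos y ≤ m + pos x`; in particular `A_x ≅ A_y` exactly when
the positions differ by a lattice translation. Every point has bounded distance from the lattice, so
there are finitely many classes, and the endomorphism ring `Λ` has a basis of monomials indexed by
the comparable pairs of positions modulo translation.

Upper bound. The hyperplanes `l j = t` with `t` an integer cut the space into faces, and rounding up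
is a monotone equivariant map from faces to positions. The faces over an interval `[p, q]` are those
meeting the convex region `p j - 1 < l j ≤ q j`, and the faces meeting a non-empty convex set have
an acyclic order complex: cut along a wall, glue by Mayer–Vietoris, and induct on the number of
faces (`IsGluable.image_convex`). For a module `X`, the chains of faces modulo translation index a
complex of projectives `Λ e ⊗ e' X`, where `e` and `e'` are the idempotents at the two ends of the
chain. Equivariant contractions of the interval complexes contract it over `k`, so it resolves `X`
(`MonomialSystem.hasProjectiveDimensionLT`). Dimension grows strictly along a chain of faces, so a
chain has at most `n + 1` faces and the resolution has length at most `n`. The opposite ring has the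
same form with the order reversed, which settles the modules on the other side.

Lower bound. Suitable monomial multiples of the elements `x ^ b i - 1`, for a basis `b` of `M`, lie
in `R`; they form a regular sequence on `k[M]` with non-zero quotient. Column vectors over that
quotient form a `Λ`-module, and each element of the sequence raises by one a degree in which `Ext`
does not vanish (`nontrivial_ext_succ_of_regular`). So some module has projective dimension at least
`n`. Finally `R` has Krull dimension `n`: at most, by transcendence degree; at least, by contracting
a chain of primes of `k[M]`. -/

set_option linter.unusedSectionVars false

/-! ### Augmented chains of lists and acyclic order complexes. -/

noncomputable section

namespace OrderChain

variable {k : Type*} [Field k] {α : Type*}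

/-- The linear map prefixing every list with `a`. -/
def consL (k : Type*) [Field k] {α : Type*} (a : α) : (List α →₀ k) →ₗ[k] (List α →₀ k) :=
  Finsupp.lmapDomain k k (List.cons a)

@[simp] lemma consL_single (a : α) (s : List α) (c : k) :
    consL k a (Finsupp.single s c) = Finsupp.single (a :: s) c := by
  simp [consL, Finsupp.mapDomain_single]

/-- The augmented simplicial boundary of a list, the alternating sum of its faces. -/
def bd (k : Type*) [Field k] {α : Type*} : List α → (List α →₀ k)
  | [] => 0
  | a :: s => Finsupp.single s 1 - consL k a (bd k s)

/-- The augmented simplicial boundary operator. -/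
def bdry (k : Type*) [Field k] (α : Type*) : (List α →₀ k) →ₗ[k] (List α →₀ k) :=
  Finsupp.linearCombination k (bd k)

@[simp] lemma bdry_single (s : List α) (c : k) :
    bdry k α (Finsupp.single s c) = c • bd k s := by
  simp [bdry]

/-- Coning with apex `a` contracts the complex of all lists. The empty list sits in the augmentation
degree, so no correction term appears. -/
lemma bdry_consL (a : α) (z : List α →₀ k) :
    bdry k α (consL k a z) = z - consL k a (bdry k α z) := by
  induction z using Finsupp.induction_linear with
  | zero => simp
  | add f g hf hg => rw [map_add, map_add, hf, hg, map_add, map_add]; abel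
  | single s c => simp [bd, smul_sub]

lemma bdry_bd (s : List α) : bdry k α (bd k s) = 0 := by
  induction s with
  | nil => simp [bd]
  | cons a s ih => rw [bd, map_sub, bdry_consL, ih]; simp

lemma bdry_bdry (z : List α →₀ k) : bdry k α (bdry k α z) = 0 := by
  induction z using Finsupp.induction_linear with
  | zero => simp
  | add f g hf hg => rw [map_add, map_add, hf, hg, add_zero]
  | single s c => simp [bdry_bd]

/-- The linear map appending `a` to every list. -/
def snocL (k : Type*) [Field k] {α : Type*} (a : α) : (List α →₀ k) →ₗ[k] (List α →₀ k) :=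
  Finsupp.lmapDomain k k (fun l => l ++ [a])

@[simp] lemma snocL_single (a : α) (s : List α) (c : k) :
    snocL k a (Finsupp.single s c) = Finsupp.single (s ++ [a]) c := by
  simp [snocL, Finsupp.mapDomain_single]

lemma snocL_consL (a b : α) (z : List α →₀ k) :
    snocL k b (consL k a z) = consL k a (snocL k b z) := by
  induction z using Finsupp.induction_linear with
  | zero => simp
  | add f g hf hg => simp only [map_add, hf, hg]
  | single s c => simp

lemma bd_append_singleton (s : List α) (b : α) :
    bd k (s ++ [b]) = snocL k b (bd k s) + Finsupp.single s ((-1) ^ s.length) := by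
  induction s with
  | nil => simp [bd]
  | cons a s ih =>
    rw [List.cons_append, bd, ih, bd]
    simp only [map_add, map_sub, snocL_single, snocL_consL, consL_single, List.length_cons,
      pow_succ, mul_neg, mul_one, Finsupp.single_neg]
    abel

variable (r : α → α → Prop)

/-- The lists in `Q` that are chains for the transitive relation `r`. -/
def chains (Q : Set α) : Set (List α) := {l | l.Pairwise r ∧ ∀ x ∈ l, x ∈ Q}

variable {r}

lemma chains_mono {Q Q' : Set α} (h : Q ⊆ Q') : chains r Q ⊆ chains r Q' :=
  fun _ hl => ⟨hl.1, fun x hx => h (hl.2 x hx)⟩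

lemma chains_inter (Q Q' : Set α) : chains r (Q ∩ Q') = chains r Q ∩ chains r Q' := by
  ext l
  simp only [chains, Set.mem_inter_iff, Set.mem_ofPred_eq]
  grind

variable (k) in
/-- The chains with coefficients in `k` supported on a set of lists. -/
abbrev Ch (S : Set (List α)) : Submodule k (List α →₀ k) := Finsupp.supported k k S

lemma consL_mem {S S' : Set (List α)} {a : α} (h : ∀ s ∈ S, a :: s ∈ S') {z : List α →₀ k}
    (hz : z ∈ Ch k S) : consL k a z ∈ Ch k S' := by
  classical
  rw [Finsupp.mem_supported] at hz ⊢
  intro l hl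
  obtain ⟨s, hs, rfl⟩ := Finset.mem_image.1 (Finsupp.mapDomain_support hl)
  exact h s (hz hs)

/-- The faces occurring in the boundary of a list are sublists with one element less. -/
lemma bd_mem_sublist (s : List α) : bd k s ∈ Ch k {l | l.Sublist s ∧ l.length + 1 = s.length} := by
  induction s with
  | nil => simp [bd]
  | cons a s ih =>
    rw [bd]
    refine Submodule.sub_mem _ (Finsupp.single_mem_supported _ _ ?_) (consL_mem ?_ ih)
    · simp
    · rintro l ⟨h1, h2⟩
      exact ⟨h1.cons_cons a, by simp [h2]⟩

lemma linearMap_mem {W : Type*} [AddCommMonoid W] [Module k W] {S : Set (List α)}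
    {f : (List α →₀ k) →ₗ[k] W} {N : Submodule k W} (h : ∀ s ∈ S, f (Finsupp.single s 1) ∈ N)
    {z : List α →₀ k} (hz : z ∈ Ch k S) : f z ∈ N := by
  rw [Ch, Finsupp.supported_eq_span_single] at hz
  refine (Submodule.span_le (p := N.comap f)).2 ?_ hz
  rintro _ ⟨s, hs, rfl⟩
  exact h s hs

lemma linearMap_congr {W : Type*} [AddCommMonoid W] [Module k W] {S : Set (List α)}
    {f g : (List α →₀ k) →ₗ[k] W} (h : ∀ s ∈ S, f (Finsupp.single s 1) = g (Finsupp.single s 1))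
    {z : List α →₀ k} (hz : z ∈ Ch k S) : f z = g z := by
  rw [Ch, Finsupp.supported_eq_span_single] at hz
  refine (Submodule.span_le (p := LinearMap.eqLocus f g)).2 ?_ hz
  rintro _ ⟨s, hs, rfl⟩
  exact h s hs

lemma bdry_mem {Q : Set α} {z : List α →₀ k} (hz : z ∈ Ch k (chains r Q)) :
    bdry k α z ∈ Ch k (chains r Q) := by
  refine linearMap_mem (fun s hs => ?_) hz
  rw [bdry_single, one_smul]
  refine Finsupp.supported_mono ?_ (bd_mem_sublist s)
  exact fun l hl => ⟨hs.1.sublist hl.1, fun x hx => hs.2 x (hl.1.subset hx)⟩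

variable (k r) in
/-- The augmented order complex of `Q` is acyclic. -/
def Acyclic (Q : Set α) : Prop :=
  ∀ z ∈ Ch k (chains r Q), bdry k α z = 0 → ∃ w ∈ Ch k (chains r Q), bdry k α w = z

/-- The order complex of a set with a least element is acyclic. -/
lemma acyclic_of_min (hr : Std.Irrefl r) (htr : IsTrans α r) {Q : Set α} {x : α} (hx : x ∈ Q)
    (h : ∀ y ∈ Q, y ≠ x → r x y) : Acyclic k r Q := by
  classical
  -- The cone contraction: prefix the apex `x` unless it already occurs. In a chain of `Q` it can
  -- only occur as the first entry.
  let g : (List α →₀ k) →ₗ[k] (List α →₀ k) :=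
    Finsupp.linearCombination k fun s => if x ∈ s then 0 else Finsupp.single (x :: s) 1
  have hmem : ∀ z ∈ Ch k (chains r Q), g z ∈ Ch k (chains r Q) := by
    intro z hz
    refine linearMap_mem (fun s hs => ?_) hz
    simp only [g, Finsupp.linearCombination_single, one_smul]
    split_ifs with hxs
    · simp
    · refine Finsupp.single_mem_supported _ _ ⟨List.pairwise_cons.2 ⟨fun y hy => ?_, hs.1⟩, ?_⟩
      · exact h y (hs.2 y hy) (by rintro rfl; exact hxs hy)
      · simpa [hx] using hs.2
  have hfree : ∀ s : List α, x ∉ s → ∀ z ∈ Ch k {l | l.Sublist s ∧ l.length + 1 = s.length},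
      g z = consL k x z := by
    intro s hxs z hz
    refine linearMap_congr (fun l hl => ?_) hz
    simp only [g, Finsupp.linearCombination_single, one_smul, consL_single]
    rw [if_neg fun h => hxs (hl.1.subset h)]
  have hcontr : ∀ z ∈ Ch k (chains r Q), bdry k α (g z) + g (bdry k α z) = z := by
    intro z hz
    refine linearMap_congr (f := bdry k α ∘ₗ g + g ∘ₗ bdry k α) (g := LinearMap.id)
      (fun s hs => ?_) hz
    simp only [LinearMap.add_apply, LinearMap.comp_apply, bdry_single, one_smul, LinearMap.id_apply]
    by_cases hxs : x ∈ s
    · cases s with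
      | nil => simp at hxs
      | cons a t =>
        have hp := List.pairwise_cons.1 hs.1
        have hax : a = x := by
          by_contra hne
          have h1 : x ∈ t := by simpa [Ne.symm hne] using hxs
          exact hr.irrefl a (htr.trans _ _ _ (hp.1 x h1) (h a (hs.2 a (by simp)) hne))
        subst hax
        have hat : a ∉ t := fun h' => hr.irrefl a (hp.1 a h')
        have h0 : ∀ z : List α →₀ k, g (consL k a z) = 0 := by
          intro z
          induction z using Finsupp.induction_linear with
          | zero => simp
          | add f g hf hg => rw [map_add, map_add, hf, hg, add_zero]
          | single s c => simp [g]
        rw [bd, map_sub, h0]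
        simp [g, hat]
    · rw [hfree s hxs _ (bd_mem_sublist s)]
      simp [g, hxs, bd]
  intro z hz hdz
  refine ⟨g z, hmem z hz, ?_⟩
  simpa [hdz] using hcontr z hz

/-- The order complex of a set with a greatest element is acyclic. -/
lemma acyclic_of_max (hr : Std.Irrefl r) (htr : IsTrans α r) {Q : Set α} {x : α} (hx : x ∈ Q)
    (h : ∀ y ∈ Q, y ≠ x → r y x) : Acyclic k r Q := by
  classical
  -- The apex now goes at the end; the factor `(-1) ^ s.length` cancels the sign with which
  -- `bd_append_singleton` deletes it.
  let g : (List α →₀ k) →ₗ[k] (List α →₀ k) :=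
    Finsupp.linearCombination k fun s =>
      if x ∈ s then 0 else Finsupp.single (s ++ [x]) ((-1) ^ s.length)
  have hmem : ∀ z ∈ Ch k (chains r Q), g z ∈ Ch k (chains r Q) := by
    intro z hz
    refine linearMap_mem (fun s hs => ?_) hz
    simp only [g, Finsupp.linearCombination_single, one_smul]
    split_ifs with hxs
    · simp
    · refine Finsupp.single_mem_supported _ _ ⟨List.pairwise_append.2 ⟨hs.1, by simp, ?_⟩, ?_⟩
      · simp only [List.mem_singleton, forall_eq]
        exact fun y hy => h y (hs.2 y hy) (by rintro rfl; exact hxs hy)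
      · simp only [List.mem_append, List.mem_singleton]
        rintro y (hy | rfl)
        exacts [hs.2 y hy, hx]
  have hfree : ∀ s : List α, x ∉ s → ∀ z ∈ Ch k {l | l.Sublist s ∧ l.length + 1 = s.length},
      g z = (-((-1) ^ s.length : k) • snocL k x) z := by
    intro s hxs z hz
    refine linearMap_congr (fun l hl => ?_) hz
    simp only [g, Finsupp.linearCombination_single, one_smul, LinearMap.smul_apply, snocL_single]
    rw [if_neg fun h => hxs (hl.1.subset h), ← hl.2, pow_succ]
    simp
  have hcontr : ∀ z ∈ Ch k (chains r Q), bdry k α (g z) + g (bdry k α z) = z := by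
    intro z hz
    refine linearMap_congr (f := bdry k α ∘ₗ g + g ∘ₗ bdry k α) (g := LinearMap.id)
      (fun s hs => ?_) hz
    simp only [LinearMap.add_apply, LinearMap.comp_apply, bdry_single, one_smul, LinearMap.id_apply]
    by_cases hxs : x ∈ s
    · obtain ⟨t, a, rfl⟩ : ∃ t a, s = t ++ [a] :=
        ⟨s.dropLast, s.getLast (List.ne_nil_of_mem hxs), (List.dropLast_append_getLast _).symm⟩
      have hp := List.pairwise_append.1 hs.1
      have hax : a = x := by
        by_contra hne
        have h1 : x ∈ t := by simpa [Ne.symm hne] using hxs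
        exact hr.irrefl a (htr.trans _ _ _ (h a (hs.2 a (by simp)) hne) (hp.2.2 x h1 a (by simp)))
      subst hax
      have hat : a ∉ t := fun h' => hr.irrefl a (hp.2.2 a h' a (by simp))
      have h0 : ∀ z : List α →₀ k, g (snocL k a z) = 0 := by
        intro z
        induction z using Finsupp.induction_linear with
        | zero => simp
        | add f g hf hg => rw [map_add, map_add, hf, hg, add_zero]
        | single s c => simp [g]
      rw [bd_append_singleton, map_add, h0]
      simp [g, hat, ← pow_add, ← two_mul]
    · rw [hfree s hxs _ (bd_mem_sublist s)]
      simp [g, hxs, bd_append_singleton, ← pow_add, ← two_mul]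
  intro z hz hdz
  refine ⟨g z, hmem z hz, ?_⟩
  simpa [hdz] using hcontr z hz

/-- Mayer–Vietoris for two sets with no relation between the differences. -/
lemma Acyclic.union {Q₁ Q₂ : Set α} (h₁ : Acyclic k r Q₁) (h₂ : Acyclic k r Q₂)
    (h₁₂ : Acyclic k r (Q₁ ∩ Q₂))
    (h : ∀ x ∈ Q₁, x ∉ Q₂ → ∀ y ∈ Q₂, y ∉ Q₁ → ¬ r x y ∧ ¬ r y x) : Acyclic k r (Q₁ ∪ Q₂) := by
  -- A chain contained in neither set would relate an element of one difference to an element of the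
  -- other.
  have hch : chains r (Q₁ ∪ Q₂) = chains r Q₁ ∪ chains r Q₂ := by
    apply Set.Subset.antisymm
    · intro l hl
      by_contra hcon
      simp only [Set.mem_union, not_or] at hcon
      have h1 : ∃ y ∈ l, y ∉ Q₁ := by
        by_contra! hc
        exact hcon.1 ⟨hl.1, hc⟩
      have h2 : ∃ x ∈ l, x ∉ Q₂ := by
        by_contra! hc
        exact hcon.2 ⟨hl.1, hc⟩
      obtain ⟨y, hy, hy1⟩ := h1
      obtain ⟨x, hx, hx2⟩ := h2
      have hx1 : x ∈ Q₁ := (hl.2 x hx).resolve_right hx2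
      have hy2 : y ∈ Q₂ := (hl.2 y hy).resolve_left hy1
      have hsymm : ∀ l : List α, l.Pairwise r → ∀ x ∈ l, ∀ y ∈ l, x ≠ y → r x y ∨ r y x := by
        intro l hl
        induction l with
        | nil => simp
        | cons a l ih =>
          have := List.pairwise_cons.1 hl
          grind
      have hxy : x ≠ y := by rintro rfl; exact hy1 hx1
      have := h x hx1 hx2 y hy2 hy1
      exact (hsymm l hl.1 x hx y hy hxy).elim this.1 this.2
    · exact Set.union_subset (chains_mono Set.subset_union_left)
        (chains_mono Set.subset_union_right)
  intro z hz hdz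
  rw [hch, Ch, Finsupp.supported_union] at hz
  obtain ⟨z₁, hz₁, z₂, hz₂, rfl⟩ := Submodule.mem_sup.1 hz
  rw [map_add] at hdz
  have hd12 : bdry k α z₁ = - bdry k α z₂ := eq_neg_of_add_eq_zero_left hdz
  -- Up to sign, the two pieces have the same boundary, a cycle on the intersection. A filling `y`
  -- of it turns `z₁ - y` and `z₂ + y` into cycles.
  have hmem : bdry k α z₁ ∈ Ch k (chains r (Q₁ ∩ Q₂)) := by
    rw [chains_inter, Ch, Finsupp.supported_inter]
    refine ⟨bdry_mem hz₁, ?_⟩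
    rw [hd12]
    exact Submodule.neg_mem _ (bdry_mem hz₂)
  obtain ⟨y, hy, hdy⟩ := h₁₂ _ hmem (bdry_bdry _)
  have hy' := hy
  rw [chains_inter, Ch, Finsupp.supported_inter] at hy'
  obtain ⟨w₁, hw₁, e₁⟩ := h₁ (z₁ - y) (Submodule.sub_mem _ hz₁ hy'.1) (by simp [hdy])
  obtain ⟨w₂, hw₂, e₂⟩ := h₂ (z₂ + y) (Submodule.add_mem _ hz₂ hy'.2) (by simp [hdy, hd12])
  refine ⟨w₁ + w₂, Submodule.add_mem _ ?_ ?_, by rw [map_add, e₁, e₂]; abel⟩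
  · exact Finsupp.supported_mono (chains_mono Set.subset_union_left) hw₁
  · exact Finsupp.supported_mono (chains_mono Set.subset_union_right) hw₂

/-- In an acyclic set, cycles of a given degree bound chains of the next degree. -/
lemma Acyclic.exists_homogeneous {Q : Set α} (h : Acyclic k r Q) {d : ℕ} {z : List α →₀ k}
    (hz : z ∈ Ch k (chains r Q)) (hd : z ∈ Ch k {l | l.length = d}) (hz0 : bdry k α z = 0) :
    ∃ w ∈ Ch k (chains r Q), w ∈ Ch k {l | l.length = d + 1} ∧ bdry k α w = z := by
  classical
  obtain ⟨w, hw, rfl⟩ := h z hz hz0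
  -- Projection to lists of length `e`. A face loses exactly one entry, so the boundary intertwines
  -- `p (d + 1)` with `p d`, and any filling can be made homogeneous.
  let p : ℕ → (List α →₀ k) →ₗ[k] (List α →₀ k) := fun e =>
    Finsupp.linearCombination k fun s => if s.length = e then Finsupp.single s 1 else 0
  have hp : ∀ w, bdry k α (p (d + 1) w) = p d (bdry k α w) := by
    intro w
    have : bdry k α ∘ₗ p (d + 1) = p d ∘ₗ bdry k α := by
      ext1 s
      ext1
      simp only [p, LinearMap.comp_apply, Finsupp.lsingle_apply, bdry_single, one_smul,
        Finsupp.linearCombination_single]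
      by_cases hs : s.length = d + 1
      · rw [if_pos hs, bdry_single, one_smul]
        symm
        refine linearMap_congr (f := p d) (g := LinearMap.id) (fun l hl => ?_) (bd_mem_sublist s)
        have := hl.2
        simp [p, show l.length = d by lia]
      · rw [if_neg hs, map_zero]
        symm
        refine linearMap_congr (f := p d) (g := 0) (fun l hl => ?_) (bd_mem_sublist s)
        have := hl.2
        simp [p, show l.length ≠ d by lia]
    exact LinearMap.congr_fun this w
  refine ⟨p (d + 1) w, linearMap_mem (fun s hs => ?_) hw, ?_, ?_⟩
  · simp only [p, Finsupp.linearCombination_single, one_smul]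
    split_ifs
    exacts [Finsupp.single_mem_supported _ _ hs, Submodule.zero_mem _]
  · refine linearMap_mem (S := Set.univ) (fun s _ => ?_) (by simp)
    simp only [p, Finsupp.linearCombination_single, one_smul]
    split_ifs with hs
    exacts [Finsupp.single_mem_supported _ _ hs, Submodule.zero_mem _]
  · rw [hp]
    refine linearMap_congr (f := p d) (g := LinearMap.id) (fun s hs => ?_) hd
    simp [p, show s.length = d from hs]

end OrderChain

end

/-! ### Gluable properties of finite subsets of a partial order. -/

noncomputable section

namespace OrderChain

section Gluing

variable {α : Type*} [PartialOrder α]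

/-- A property of subsets of a partial order is *gluable* if it holds for sets with a least element
and can be glued along unrelated differences. -/
structure IsGluable (P : Set α → Prop) : Prop where
  of_least : ∀ (Q : Set α) (x : α), x ∈ Q → (∀ y ∈ Q, x ≤ y) → P Q
  union : ∀ Q₁ Q₂ : Set α, P Q₁ → P Q₂ → P (Q₁ ∩ Q₂) →
    (∀ x ∈ Q₁, x ∉ Q₂ → ∀ y ∈ Q₂, y ∉ Q₁ → ¬ x ≤ y ∧ ¬ y ≤ x) → P (Q₁ ∪ Q₂)

variable {P : Set α → Prop}

/-- A gluable property passes from an upper subset to a finite set if the fibres have it. -/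
lemma IsGluable.of_upper (hP : IsGluable P) {Q U : Set α} (hQ : Q.Finite) (hUQ : U ⊆ Q)
    (hup : ∀ x ∈ U, ∀ y ∈ Q, x ≤ y → y ∈ U) (hU : P U)
    (hfib : ∀ x ∈ Q, x ∉ U → P (U ∩ Set.Ioi x)) : P Q := by
  induction hn : Q.ncard using Nat.strong_induction_on generalizing Q U with
  | _ n ih =>
  subst hn
  by_cases hne : (Q \ U).Nonempty
  swap
  · have : Q = U := Set.Subset.antisymm
      (Set.sdiff_eq_empty.1 (Set.not_nonempty_iff_eq_empty.1 hne)) hUQ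
    rwa [this]
  -- As `U` is closed upwards, `x` is minimal in all of `Q`. Then `Q` is the union of `Q \ {x}` and
  -- the elements above `x`, which have a least element; they meet in `Q ∩ Ioi x`. Both `Q \ {x}`
  -- and this intersection are smaller than `Q` and inherit the fibre condition.
  obtain ⟨x, hxm⟩ := (hQ.subset Set.sdiff_subset).exists_minimal hne
  have hxQ : x ∈ Q := hxm.prop.1
  have hxU : x ∉ U := hxm.prop.2
  have hmin : ∀ y ∈ Q, y ≤ x → y = x := by
    intro y hy hyx
    by_cases hyU : y ∈ U
    · exact absurd (hup y hyU x hxQ hyx) hxU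
    · exact le_antisymm hyx (hxm.le_of_le ⟨hy, hyU⟩ hyx)
  have hcup : Q = (Q \ {x}) ∪ (Q ∩ Set.Ici x) := by
    ext y
    by_cases hyx : y = x
    · subst hyx; simp [hxQ]
    · simp only [Set.mem_union, Set.mem_sdiff, Set.mem_singleton_iff, Set.mem_inter_iff]
      tauto
  have hcap : (Q \ {x}) ∩ (Q ∩ Set.Ici x) = Q ∩ Set.Ioi x := by
    ext y
    simp only [Set.mem_sdiff, Set.mem_singleton_iff, Set.mem_inter_iff, Set.mem_Ici, Set.mem_Ioi]
    constructor
    · rintro ⟨⟨h1, h2⟩, _, h3⟩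
      exact ⟨h1, lt_of_le_of_ne h3 (Ne.symm h2)⟩
    · rintro ⟨h1, h2⟩
      exact ⟨⟨h1, h2.ne'⟩, h1, h2.le⟩
  rw [hcup]
  refine hP.union _ _ ?_ ?_ ?_ ?_
  · refine ih _ (Set.ncard_sdiff_singleton_lt_of_mem hxQ hQ) (hQ.subset Set.sdiff_subset)
      (U := U) ?_ ?_ hU ?_ rfl
    · exact fun y hy => ⟨hUQ hy, by rintro rfl; exact hxU hy⟩
    · exact fun y hy z hz => hup y hy z hz.1
    · exact fun y hy => hfib y hy.1
  · exact hP.of_least _ x ⟨hxQ, le_refl x⟩ fun y hy => hy.2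
  · rw [hcap]
    refine ih _ ?_ (hQ.subset Set.inter_subset_left) (U := U ∩ Set.Ioi x) ?_ ?_ ?_ ?_ rfl
    · refine Set.ncard_lt_ncard ?_ hQ
      exact ⟨Set.inter_subset_left, fun h => lt_irrefl x (h hxQ).2⟩
    · exact Set.inter_subset_inter_left _ hUQ
    · exact fun y hy z hz hyz => ⟨hup y hy.1 z hz.1 hyz, hz.2⟩
    · exact hfib x hxQ hxU
    · intro y hy hyU
      have : U ∩ Set.Ioi x ∩ Set.Ioi y = U ∩ Set.Ioi y := by
        ext z
        simp only [Set.mem_inter_iff, Set.mem_Ioi]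
        exact ⟨fun h => ⟨h.1.1, h.2⟩, fun h => ⟨⟨h.1, lt_trans hy.2 h.2⟩, h.2⟩⟩
      rw [this]
      exact hfib y hy.1 fun h => hyU ⟨h, hy.2⟩
  · intro y hy hy' z hz hz'
    have hzx : z = x := by
      by_contra h
      exact hz' ⟨hz.1, h⟩
    subst hzx
    have hzy : ¬ z ≤ y := fun h => hy' ⟨hy.1, h⟩
    exact ⟨fun h => hzy (hmin y hy.1 h).ge, hzy⟩

lemma isGluable_acyclic_lt (k : Type*) [Field k] :
    IsGluable (fun Q : Set α => Acyclic k (· < ·) Q) where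
  of_least _ _ hx h := acyclic_of_min inferInstance inferInstance hx
    fun y hy hyx => lt_of_le_of_ne (h y hy) (Ne.symm hyx)
  union _ _ h₁ h₂ h₁₂ h := h₁.union h₂ h₁₂ fun x hx hx' y hy hy' =>
    ⟨fun hlt => (h x hx hx' y hy hy').1 hlt.le, fun hlt => (h x hx hx' y hy hy').2 hlt.le⟩

/-- Left and right modules need chains in opposite directions. In a decreasing chain the least
element comes last, hence `acyclic_of_max`. -/
lemma isGluable_acyclic_gt (k : Type*) [Field k] :
    IsGluable (fun Q : Set α => Acyclic k (· > ·) Q) where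
  of_least _ _ hx h := acyclic_of_max inferInstance inferInstance hx
    fun y hy hyx => lt_of_le_of_ne (h y hy) (Ne.symm hyx)
  union _ _ h₁ h₂ h₁₂ h := h₁.union h₂ h₁₂ fun x hx hx' y hy hy' =>
    ⟨fun hlt => (h x hx hx' y hy hy').2 hlt.le, fun hlt => (h x hx hx' y hy hy').1 hlt.le⟩

end Gluing

/-! ### Faces of an integral arrangement that meet a convex set. -/

section Arrangement

variable {α : Type*} [PartialOrder α] {V : Type*} [AddCommGroup V] [Module ℝ V]
  {J : Type*} {l : J → V →ₗ[ℝ] ℝ} {φ : V → α}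

/-- `φ` sends a point to the face of the arrangement of the hyperplanes `l j = t`, `t ∈ ℤ`, that
contains it, and faces are ordered by inclusion of their closures. -/
def IsFaceMap (l : J → V →ₗ[ℝ] ℝ) (φ : V → α) : Prop :=
  ∀ v w, φ v ≤ φ w ↔ ∀ j, ⌊l j w⌋ ≤ ⌊l j v⌋ ∧ ⌈l j v⌉ ≤ ⌈l j w⌉

/-- The part of the arrangement seen by one hyperplane: `h` is a defining affine form. -/
structure IsWall (φ : V → α) (h : V →ᵃ[ℝ] ℝ) : Prop where
  pos_of_le : ∀ v w, φ v ≤ φ w → 0 < h v → 0 < h w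
  neg_of_le : ∀ v w, φ v ≤ φ w → h v < 0 → h w < 0

lemma IsWall.neg {h : V →ᵃ[ℝ] ℝ} (hh : IsWall φ h) : IsWall φ (-h) where
  pos_of_le v w hvw hv := by
    have := hh.neg_of_le v w hvw (by simpa using hv)
    simpa using this
  neg_of_le v w hvw hv := by
    have := hh.pos_of_le v w hvw (by simpa using hv)
    simpa using this

lemma IsFaceMap.isWall (hφ : IsFaceMap l φ) (j : J) (t : ℤ) :
    IsWall φ ((l j).toAffineMap - AffineMap.const ℝ V (t : ℝ)) where
  pos_of_le v w hvw hv := by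
    have := (hφ v w).1 hvw j
    simp only [AffineMap.coe_sub, Pi.sub_apply, LinearMap.coe_toAffineMap, AffineMap.const_apply,
      sub_pos] at hv ⊢
    have h1 : t + 1 ≤ ⌈l j v⌉ := by
      rw [Int.add_one_le_iff, Int.lt_ceil]; exact hv
    exact Int.lt_ceil.1 (by lia)
  neg_of_le v w hvw hv := by
    have := (hφ v w).1 hvw j
    simp only [AffineMap.coe_sub, Pi.sub_apply, LinearMap.coe_toAffineMap, AffineMap.const_apply,
      sub_neg] at hv ⊢
    have h1 : ⌊l j v⌋ < t := by
      rw [Int.floor_lt]; exact hv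
    exact Int.floor_lt.1 (by lia)

/-- Bounds between integers on round-downs and round-ups are strict bounds on the forms, so an open
star is an intersection of open half-spaces. -/
lemma IsFaceMap.convex_star (hφ : IsFaceMap l φ) (u : V) : Convex ℝ {v | φ u ≤ φ v} := by
  have : {v | φ u ≤ φ v} =
      ⋂ j, ((l j) ⁻¹' Set.Iio ((⌊l j u⌋ : ℝ) + 1) ∩ (l j) ⁻¹' Set.Ioi ((⌈l j u⌉ : ℝ) - 1)) := by
    ext v
    simp only [Set.mem_ofPred_eq, hφ u v, Set.mem_iInter, Set.mem_inter_iff, Set.mem_preimage,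
      Set.mem_Iio, Set.mem_Ioi]
    refine forall_congr' fun j => and_congr ?_ ?_
    · rw [← Int.lt_add_one_iff, Int.floor_lt]; push_cast; rfl
    · rw [← Int.sub_one_lt_iff, Int.lt_ceil]; push_cast; rfl
  rw [this]
  exact convex_iInter fun j => ((convex_Iio _).linear_preimage _).inter
    ((convex_Ioi _).linear_preimage _)

/-- Points close to `u` on a segment starting at `u` lie in the open star of the face of `u`. -/
lemma IsFaceMap.eventually_star [Finite J] (hφ : IsFaceMap l φ) (u w : V) :
    ∀ᶠ t : ℝ in nhdsWithin 0 (Set.Ioi 0), φ u ≤ φ (AffineMap.lineMap u w t) := by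
  refine nhdsWithin_le_nhds ?_
  simp only [hφ u]
  refine Filter.eventually_all.2 fun j => ?_
  have hc : Filter.Tendsto (fun t : ℝ => l j (AffineMap.lineMap u w t)) (nhds 0)
      (nhds (l j u)) := by
    have : (fun t : ℝ => l j (AffineMap.lineMap u w t)) = fun t => t * (l j w - l j u) + l j u := by
      ext t
      simp [AffineMap.lineMap_apply]
    rw [this]
    have h2 : Continuous fun t : ℝ => t * (l j w - l j u) + l j u := by fun_prop
    simpa using h2.tendsto 0
  have h1 : ∀ᶠ x in nhds (l j u), x < (⌊l j u⌋ : ℝ) + 1 := Iio_mem_nhds (Int.lt_floor_add_one _)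
  have h2 : ∀ᶠ x in nhds (l j u), (⌈l j u⌉ : ℝ) - 1 < x := Ioi_mem_nhds (by
    linarith [Int.ceil_lt_add_one (l j u)])
  filter_upwards [hc.eventually h1, hc.eventually h2] with t ht1 ht2
  constructor
  · rw [← Int.lt_add_one_iff, Int.floor_lt]; push_cast; exact ht1
  · rw [← Int.sub_one_lt_iff, Int.lt_ceil]; push_cast; exact ht2

variable {P : Set α → Prop}

/-- A real number's comparisons with all integers determine its round-down and round-up, so points
of distinct faces compare differently with some wall. -/
lemma IsFaceMap.exists_wall (hφ : IsFaceMap l φ) {v w : V} (hvw : φ v ≠ φ w) :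
    ∃ h : V →ᵃ[ℝ] ℝ, IsWall φ h ∧ ((0 < h v ∧ h w ≤ 0) ∨ (h v ≤ 0 ∧ 0 < h w)) := by
  by_contra! hcon
  apply hvw
  have key : ∀ j, ⌊l j v⌋ = ⌊l j w⌋ ∧ ⌈l j v⌉ = ⌈l j w⌉ := by
    intro j
    have hA : ∀ t : ℤ, (t : ℝ) < l j v ↔ (t : ℝ) < l j w := by
      intro t
      have := hcon _ (hφ.isWall j t)
      simp only [AffineMap.coe_sub, Pi.sub_apply, LinearMap.coe_toAffineMap, AffineMap.const_apply,
        sub_pos, sub_nonpos] at this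
      exact ⟨this.1, fun h => by by_contra hh; exact absurd (this.2 (not_lt.1 hh)) (not_le.2 h)⟩
    have hB : ∀ t : ℤ, l j v < t ↔ l j w < t := by
      intro t
      have := hcon _ (hφ.isWall j t).neg
      simp only [AffineMap.coe_sub, Pi.sub_apply,
        LinearMap.coe_toAffineMap, AffineMap.const_apply, neg_sub,
        sub_pos, sub_nonpos] at this
      exact ⟨this.1, fun h => by by_contra hh; exact absurd (this.2 (not_lt.1 hh)) (not_le.2 h)⟩
    constructor
    · apply le_antisymm
      · by_contra! h
        exact absurd (Int.floor_le (l j v)) (not_le.2 ((hB _).2 (Int.floor_lt.1 h)))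
      · by_contra! h
        exact absurd (Int.floor_le (l j w)) (not_le.2 ((hB _).1 (Int.floor_lt.1 h)))
    · apply le_antisymm
      · by_contra! h
        exact absurd (Int.le_ceil (l j w)) (not_le.2 ((hA _).1 (Int.lt_ceil.1 h)))
      · by_contra! h
        exact absurd (Int.le_ceil (l j v)) (not_le.2 ((hA _).2 (Int.lt_ceil.1 h)))
  apply le_antisymm
  · exact (hφ _ _).2 fun j => ⟨(key j).1.ge, (key j).2.le⟩
  · exact (hφ _ _).2 fun j => ⟨(key j).1.le, (key j).2.ge⟩

/-- A gluable property holds for the set of faces meeting a convex set. -/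
theorem IsGluable.image_convex [Finite J] (hP : IsGluable P) (hφ : IsFaceMap l φ) {K : Set V}
    (hK : Convex ℝ K) (hne : K.Nonempty) (hfin : (φ '' K).Finite) : P (φ '' K) := by
  induction hn : (φ '' K).ncard using Nat.strong_induction_on generalizing K with
  | _ n ih =>
  subst hn
  -- The induction is on the number of faces met: it applies to any non-empty convex subset that
  -- misses one of them.
  have step : ∀ K' : Set V, Convex ℝ K' → K'.Nonempty → K' ⊆ K →
      (∃ x ∈ K, ∀ y ∈ K', φ y ≠ φ x) → P (φ '' K') := by
    rintro K' hK' hne' hsub ⟨x, hx, hxK'⟩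
    refine ih _ (Set.ncard_lt_ncard ⟨Set.image_mono hsub, fun h => ?_⟩ hfin) hK' hne'
      (hfin.subset (Set.image_mono hsub)) rfl
    obtain ⟨y, hy, hyx⟩ := h ⟨x, hx, rfl⟩
    exact hxK' y hy hyx
  have convPos : ∀ h : V →ᵃ[ℝ] ℝ, Convex ℝ {v | v ∈ K ∧ 0 < h v} := fun h =>
    hK.inter ((convex_Ioi (0 : ℝ)).affine_preimage h)
  -- Here `K` touches the wall from one side. The faces off the wall form an upper set `U`; the part
  -- of `U` above a face in the wall consists of the faces meeting `K`, the open half-space and an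
  -- open star, again a convex set. So `IsGluable.of_upper` applies.
  have caseA : ∀ h : V →ᵃ[ℝ] ℝ, IsWall φ h → (∀ v ∈ K, 0 ≤ h v) → (∃ v ∈ K, 0 < h v) →
      (∃ v ∈ K, h v = 0) → P (φ '' K) := by
    rintro h hh hnn ⟨w, hw, hw0⟩ ⟨u, hu, hu0⟩
    have hdis : ∀ y, 0 < h y → φ y ≠ φ u := fun y hy he => by
      have := hh.pos_of_le y u he.le hy
      exact this.ne' hu0
    refine hP.of_upper hfin (U := φ '' {v | v ∈ K ∧ 0 < h v}) (Set.image_mono fun v hv => hv.1)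
      ?_ ?_ ?_
    · rintro _ ⟨v, hv, rfl⟩ _ ⟨v', hv', rfl⟩ hle
      exact ⟨v', ⟨hv', hh.pos_of_le _ _ hle hv.2⟩, rfl⟩
    · exact step _ (convPos h) ⟨w, hw, hw0⟩ (fun v hv => hv.1)
        ⟨u, hu, fun y hy => hdis y hy.2⟩
    · rintro _ ⟨x, hx, rfl⟩ hxU
      have hx0 : ¬ 0 < h x := fun hpos => hxU ⟨x, ⟨hx, hpos⟩, rfl⟩
      have heq : φ '' {v | v ∈ K ∧ 0 < h v} ∩ Set.Ioi (φ x) =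
          φ '' ({v | v ∈ K ∧ 0 < h v} ∩ {v | φ x ≤ φ v}) := by
        ext y
        constructor
        · rintro ⟨⟨v, hv, rfl⟩, hxv⟩
          exact ⟨v, ⟨hv, le_of_lt hxv⟩, rfl⟩
        · rintro ⟨v, ⟨hv, hxv⟩, rfl⟩
          refine ⟨⟨v, hv, rfl⟩, lt_of_le_of_ne hxv fun he => hx0 ?_⟩
          exact hh.pos_of_le v x he.ge hv.2
      rw [heq]
      refine step _ ((convPos h).inter (hφ.convex_star x)) ?_ (fun v hv => hv.1.1)
        ⟨u, hu, fun y hy => hdis y hy.1.2⟩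
      -- The fibre is non-empty: a small move from `x` towards `w` stays in the star and leaves the
      -- wall.
      have hev := (hφ.eventually_star x w).and
        (Ioo_mem_nhdsGT (zero_lt_one : (0 : ℝ) < 1))
      obtain ⟨t, ht, ht0, ht1⟩ := hev.exists
      refine ⟨_, ⟨hK.lineMap_mem hx hw ⟨ht0.le, ht1.le⟩, ?_⟩, ht⟩
      have h0 : h x = 0 := le_antisymm (not_lt.1 hx0) (hnn x hx)
      rw [AffineMap.apply_lineMap, AffineMap.lineMap_apply, h0]
      simpa using mul_pos ht0 hw0
  -- Here the wall crosses `K`. The two closed halves share exactly the faces in the wall, and faces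
  -- strictly on opposite sides are unrelated.
  have caseB : ∀ h : V →ᵃ[ℝ] ℝ, IsWall φ h → (∃ v ∈ K, 0 < h v) → (∃ v ∈ K, h v < 0) →
      P (φ '' K) := by
    rintro h hh ⟨v, hv, hv0⟩ ⟨w, hw, hw0⟩
    have hz : ∃ u ∈ K, h u = 0 := by
      have hd : 0 < h v - h w := by linarith
      refine ⟨AffineMap.lineMap v w (h v / (h v - h w)), hK.lineMap_mem hv hw
        ⟨by positivity, (div_le_one hd).2 (by linarith)⟩, ?_⟩
      rw [AffineMap.apply_lineMap, AffineMap.lineMap_apply]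
      simp only [vsub_eq_sub, smul_eq_mul, vadd_eq_add]
      field_simp
      ring
    obtain ⟨u, hu, hu0⟩ := hz
    have hpn : ∀ x y, 0 ≤ h x → h y < 0 → φ x ≠ φ y := fun x y hx hy he =>
      absurd (hh.neg_of_le y x he.ge hy) (not_lt.2 hx)
    have hnp : ∀ x y, h x ≤ 0 → 0 < h y → φ x ≠ φ y := fun x y hx hy he =>
      absurd (hh.pos_of_le y x he.ge hy) (not_lt.2 hx)
    have hcup : φ '' K = φ '' {v | v ∈ K ∧ 0 ≤ h v} ∪ φ '' {v | v ∈ K ∧ h v ≤ 0} := by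
      rw [← Set.image_union]
      congr 1
      ext x
      simp only [Set.mem_union, Set.mem_ofPred_eq, ← and_or_left]
      exact ⟨fun hx => ⟨hx, le_total 0 (h x)⟩, fun hx => hx.1⟩
    have hcap : φ '' {v | v ∈ K ∧ 0 ≤ h v} ∩ φ '' {v | v ∈ K ∧ h v ≤ 0} =
        φ '' {v | v ∈ K ∧ h v = 0} := by
      ext y
      constructor
      · rintro ⟨⟨a, ha, rfl⟩, ⟨b, hb, hba⟩⟩
        refine ⟨a, ⟨ha.1, le_antisymm ?_ ha.2⟩, rfl⟩
        by_contra! hpos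
        exact hnp b a hb.2 hpos hba
      · rintro ⟨a, ha, rfl⟩
        exact ⟨⟨a, ⟨ha.1, ha.2.ge⟩, rfl⟩, ⟨a, ⟨ha.1, ha.2.le⟩, rfl⟩⟩
    have cGe : Convex ℝ {v | v ∈ K ∧ 0 ≤ h v} :=
      hK.inter ((convex_Ici (0 : ℝ)).affine_preimage h)
    have cLe : Convex ℝ {v | v ∈ K ∧ h v ≤ 0} :=
      hK.inter ((convex_Iic (0 : ℝ)).affine_preimage h)
    have cEq : Convex ℝ {v | v ∈ K ∧ h v = 0} :=
      hK.inter ((convex_singleton (0 : ℝ)).affine_preimage h)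
    rw [hcup]
    refine hP.union _ _ ?_ ?_ ?_ ?_
    · exact step _ cGe ⟨u, hu, hu0.ge⟩ (fun x hx => hx.1) ⟨w, hw, fun y hy => hpn y w hy.2 hw0⟩
    · exact step _ cLe ⟨u, hu, hu0.le⟩ (fun x hx => hx.1) ⟨v, hv, fun y hy => hnp y v hy.2 hv0⟩
    · rw [hcap]
      exact step _ cEq ⟨u, hu, hu0⟩ (fun x hx => hx.1)
        ⟨w, hw, fun y hy => hpn y w hy.2.ge hw0⟩
    · rintro _ ⟨a, ha, rfl⟩ ha' _ ⟨b, hb, rfl⟩ hb'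
      have ha0 : 0 < h a := by
        by_contra! hc
        exact ha' ⟨a, ⟨ha.1, hc⟩, rfl⟩
      have hb0 : h b < 0 := by
        by_contra! hc
        exact hb' ⟨b, ⟨hb.1, hc⟩, rfl⟩
      exact ⟨fun hle => lt_asymm (hh.pos_of_le _ _ hle ha0) hb0,
        fun hle => lt_asymm (hh.neg_of_le _ _ hle hb0) ha0⟩
  have caseAB : ∀ h : V →ᵃ[ℝ] ℝ, IsWall φ h → (∃ v ∈ K, 0 < h v) → (∃ v ∈ K, h v ≤ 0) →
      P (φ '' K) := by
    rintro h hh hp ⟨w, hw, hw0⟩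
    by_cases hn : ∃ v ∈ K, h v < 0
    · exact caseB h hh hp hn
    · push Not at hn
      exact caseA h hh hn hp ⟨w, hw, le_antisymm hw0 (hn w hw)⟩
  obtain ⟨v, hv⟩ := hne
  by_cases hs : ∀ w ∈ K, φ w = φ v
  · refine hP.of_least _ (φ v) ⟨v, hv, rfl⟩ ?_
    rintro _ ⟨w, hw, rfl⟩
    exact (hs w hw).ge
  · push Not at hs
    obtain ⟨w, hw, hne⟩ := hs
    obtain ⟨h, hh, ⟨h1, h2⟩ | ⟨h1, h2⟩⟩ := hφ.exists_wall hne
    · exact caseAB h hh ⟨w, hw, h1⟩ ⟨v, hv, h2⟩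
    · exact caseAB h hh ⟨v, hv, h2⟩ ⟨w, hw, h1⟩

end Arrangement

end OrderChain

end

/-! ### Acyclic carriers: contracting homotopies over intervals. -/

noncomputable section

namespace OrderChain

section Homotopy

variable {k : Type*} [Field k] {F P : Type*} [PartialOrder F] {c : F → P}

/-- The value of `c` at the first element of a list, with a default value for the empty list. -/
def hd (c : F → P) (o : P) : List F → P
  | [] => o
  | a :: _ => c a

/-- The value of `c` at the last element of a list, with a default value for the empty list. -/
def tl (c : F → P) (o : P) (s : List F) : P := hd c o s.reverse

lemma hd_spec (c : F → P) (o : P) {s : List F} (hs : s ≠ []) (hp : s.Pairwise (· < ·)) :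
    ∃ a ∈ s, hd c o s = c a ∧ ∀ x ∈ s, a ≤ x := by
  cases s with
  | nil => exact absurd rfl hs
  | cons a s =>
    refine ⟨a, by simp, rfl, ?_⟩
    rintro x (_ | ⟨_, hx⟩)
    exacts [le_refl _, ((List.pairwise_cons.1 hp).1 x hx).le]

lemma tl_spec (c : F → P) (o : P) {s : List F} (hs : s ≠ []) (hp : s.Pairwise (· < ·)) :
    ∃ a ∈ s, tl c o s = c a ∧ ∀ x ∈ s, x ≤ a := by
  obtain ⟨t, a, rfl⟩ : ∃ t a, s = t ++ [a] :=
    ⟨s.dropLast, s.getLast hs, (List.dropLast_append_getLast _).symm⟩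
  refine ⟨a, by simp, by simp [tl, hd], ?_⟩
  intro x hx
  simp only [List.mem_append, List.mem_singleton] at hx
  rcases hx with hx | rfl
  · exact ((List.pairwise_append.1 hp).2.2 x hx a (by simp)).le
  · exact le_refl _

/-- Acyclic carriers: the augmented complex of chains in `{x | c x ≤ q}` has a contracting homotopy
that moves a chain only to chains starting above it. -/
theorem exists_homotopy [PartialOrder P] (hc : Monotone c) (q : P) {N : ℕ}
    (hN : ∀ s : List F, s.Pairwise (· < ·) → s.length ≤ N)
    (hac : ∀ p ≤ q, Acyclic k (· < ·) {x | p ≤ c x ∧ c x ≤ q}) :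
    ∃ W : (List F →₀ k) →ₗ[k] (List F →₀ k), ∀ s ∈ chains (· < ·) {x | c x ≤ q},
      W (Finsupp.single s 1) ∈ Ch k (chains (· < ·) {x | hd c q s ≤ c x ∧ c x ≤ q}) ∧
      W (Finsupp.single s 1) ∈ Ch k {l | l.length = s.length + 1} ∧
      bdry k F (W (Finsupp.single s 1)) + W (bd k s) = Finsupp.single s 1 := by
  classical
  -- The homotopy is built by induction on the length of chains; the bound `N` makes finitely many
  -- stages suffice.
  suffices h : ∀ d : ℕ, ∃ W : (List F →₀ k) →ₗ[k] (List F →₀ k),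
      ∀ s ∈ chains (· < ·) {x | c x ≤ q}, s.length < d →
      W (Finsupp.single s 1) ∈ Ch k (chains (· < ·) {x | hd c q s ≤ c x ∧ c x ≤ q}) ∧
      W (Finsupp.single s 1) ∈ Ch k {l | l.length = s.length + 1} ∧
      bdry k F (W (Finsupp.single s 1)) + W (bd k s) = Finsupp.single s 1 by
    obtain ⟨W, hW⟩ := h (N + 1)
    exact ⟨W, fun s hs => hW s hs (Nat.lt_succ_of_le (hN s hs.1))⟩
  intro d
  induction d with
  | zero => exact ⟨0, fun s _ hs => absurd hs (Nat.not_lt_zero _)⟩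
  | succ d ih =>
    obtain ⟨W, hW⟩ := ih
    -- Carriers are nested: a face starts no lower than its chain. The default value `q` makes this
    -- hold for the empty list too, whose carrier is the fibre over `q`.
    have hhd : ∀ s ∈ chains (· < ·) {x | c x ≤ q}, ∀ l : List F, l.Sublist s →
        hd c q s ≤ hd c q l := by
      intro s hs l hl
      by_cases hs0 : s = []
      · subst hs0
        rw [List.sublist_nil.1 hl]
      obtain ⟨a, has, hca, ha⟩ := hd_spec c q hs0 hs.1
      rw [hca]
      by_cases hl0 : l = []
      · subst hl0
        exact hs.2 a has
      obtain ⟨b, hb, hcb, -⟩ := hd_spec c q hl0 (hs.1.sublist hl)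
      rw [hcb]
      exact hc (ha b (hl.subset hb))
    have hbd : ∀ s ∈ chains (· < ·) {x | c x ≤ q},
        bd k s ∈ Ch k {l | l ∈ chains (· < ·) {x | c x ≤ q} ∧ l.Sublist s ∧
          l.length + 1 = s.length} := by
      intro s hs
      refine Finsupp.supported_mono ?_ (bd_mem_sublist s)
      exact fun l hl => ⟨⟨hs.1.sublist hl.1, fun x hx => hs.2 x (hl.1.subset hx)⟩, hl⟩
    have key : ∀ s : List F, ∃ w : List F →₀ k, s ∈ chains (· < ·) {x | c x ≤ q} → s.length = d →
        w ∈ Ch k (chains (· < ·) {x | hd c q s ≤ c x ∧ c x ≤ q}) ∧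
        w ∈ Ch k {l | l.length = s.length + 1} ∧
        bdry k F w = Finsupp.single s 1 - W (bd k s) := by
      intro s
      by_cases hs : s ∈ chains (· < ·) {x | c x ≤ q} ∧ s.length = d
      swap
      · exact ⟨0, fun h1 h2 => absurd ⟨h1, h2⟩ hs⟩
      obtain ⟨hs, hsd⟩ := hs
      have hle : hd c q s ≤ q := by
        by_cases hs0 : s = []
        · subst hs0; exact le_refl q
        · obtain ⟨a, ha, hca, -⟩ := hd_spec c q hs0 hs.1
          rw [hca]; exact hs.2 a ha
      -- The element `s - W (∂ s)` is a cycle carried by the interval from `hd c q s` to `q`. That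
      -- interval is acyclic, and a filling serves as the value of the homotopy at `s`.
      have hz1 : Finsupp.single s 1 - W (bd k s) ∈
          Ch k (chains (· < ·) {x | hd c q s ≤ c x ∧ c x ≤ q}) := by
        refine Submodule.sub_mem _ (Finsupp.single_mem_supported _ _ ⟨hs.1, fun x hx => ?_⟩) ?_
        · refine ⟨?_, hs.2 x hx⟩
          obtain ⟨a, ha, hca, hax⟩ := hd_spec c q (List.ne_nil_of_mem hx) hs.1
          rw [hca]; exact hc (hax x hx)
        · refine linearMap_mem (fun l hl => ?_) (hbd s hs)
          refine Finsupp.supported_mono (chains_mono ?_) (hW l hl.1 (by have := hl.2.2; lia)).1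
          exact fun x hx => ⟨(hhd s hs l hl.2.1).trans hx.1, hx.2⟩
      have hz2 : Finsupp.single s 1 - W (bd k s) ∈ Ch k {l | l.length = d} := by
        refine Submodule.sub_mem _ (Finsupp.single_mem_supported _ _ hsd) ?_
        refine linearMap_mem (fun l hl => ?_) (hbd s hs)
        have := (hW l hl.1 (by have := hl.2.2; lia)).2.1
        rwa [hl.2.2, hsd] at this
      have hz3 : bdry k F (Finsupp.single s 1 - W (bd k s)) = 0 := by
        have : (bdry k F ∘ₗ W + W ∘ₗ bdry k F) (bd k s) =
            (LinearMap.id : (List F →₀ k) →ₗ[k] _) (bd k s) := by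
          refine linearMap_congr (fun l hl => ?_) (hbd s hs)
          simpa using (hW l hl.1 (by have := hl.2.2; lia)).2.2
        simp only [LinearMap.add_apply, LinearMap.comp_apply, bdry_bd, map_zero, add_zero,
          LinearMap.id_apply] at this
        rw [map_sub, bdry_single, one_smul, this, sub_self]
      obtain ⟨w, h1, h2, h3⟩ := (hac _ hle).exists_homogeneous hz1 hz2 hz3
      exact ⟨w, fun _ _ => ⟨h1, by rwa [hsd], h3⟩⟩
    choose w hw using key
    let W' : (List F →₀ k) →ₗ[k] (List F →₀ k) :=
      Finsupp.linearCombination k fun s => if s.length < d then W (Finsupp.single s 1) else w s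
    have hW'lt : ∀ s : List F, s.length < d → W' (Finsupp.single s 1) = W (Finsupp.single s 1) := by
      intro s hs
      simp [W', hs]
    refine ⟨W', fun s hs hsd => ?_⟩
    have hbdW : W' (bd k s) = W (bd k s) :=
      linearMap_congr (fun l hl => hW'lt l (by have := hl.2; lia)) (bd_mem_sublist s)
    rw [hbdW]
    by_cases hlt : s.length < d
    · rw [hW'lt s hlt]
      exact hW s hs hlt
    · have hd' : s.length = d := by lia
      have : W' (Finsupp.single s 1) = w s := by simp [W', hlt]
      rw [this]
      obtain ⟨h1, h2, h3⟩ := hw s hs hd'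
      exact ⟨h1, h2, by rw [h3]; abel⟩

end Homotopy

end OrderChain

/-! ### Projective dimension from a finite resolution. -/

section Resolution

open CategoryTheory

universe u

/-- A module with a projective resolution vanishing in degrees `≥ n` has projective dimension
`< n`. -/
theorem hasProjectiveDimensionLT_of_resolution {A : Type u} [Ring A] (n : ℕ)
    (X : Type u) [AddCommGroup X] [Module A X] (T : ℕ → Type u) [∀ i, AddCommGroup (T i)]
    [∀ i, Module A (T i)] (d : ∀ i, T (i + 1) →ₗ[A] T i) (e : T 0 →ₗ[A] X)
    (hT : ∀ i, Module.Projective A (T i)) (he : Function.Surjective e)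
    (h0 : Function.Exact (d 0) e) (h : ∀ i, Function.Exact (d (i + 1)) (d i))
    (hn : Subsingleton (T n)) : HasProjectiveDimensionLT (ModuleCat.of A X) n := by
  induction n generalizing X T with
  | zero =>
    have : Subsingleton X := he.subsingleton
    exact (ModuleCat.isZero_of_subsingleton _).hasProjectiveDimensionLT_zero
  | succ n ih =>
    have hker : HasProjectiveDimensionLT (ModuleCat.of A (LinearMap.ker e)) n := by
      refine ih (LinearMap.ker e) (fun i => T (i + 1)) (fun i => d (i + 1))
        ((d 0).codRestrict (LinearMap.ker e) fun x => h0.apply_apply_eq_zero x)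
        (fun i => hT (i + 1)) ?_ ?_ (fun i => h (i + 1)) hn
      · rintro ⟨y, hy⟩
        obtain ⟨x, rfl⟩ := (h0 y).1 hy
        exact ⟨x, rfl⟩
      · intro x
        rw [← h 0 x]
        exact ⟨fun hx => congrArg Subtype.val hx, fun hx => Subtype.ext hx⟩
    have hS := LinearMap.shortExact_shortComplexKer he
    refine hS.hasProjectiveDimensionLT_X₃ n hker ?_
    have : Projective (ModuleCat.of A (T 0)) :=
      (IsProjective.iff_projective (R := A) (P := T 0)).1 (hT 0)
    exact CategoryTheory.hasProjectiveDimensionLT_of_ge (ModuleCat.of A (T 0)) 1 (n + 1) (by lia)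

end Resolution

end

/-! ### Translation of chains and equivariant homotopies. -/

noncomputable section

namespace OrderChain

section Translation

variable {k : Type*} [Field k] {M : Type*} [AddCommGroup M] {F P : Type*}
  [AddAction M F] [AddAction M P] {c : F → P}

/-- Translation of chains. -/
def tr (k : Type*) [Field k] {M : Type*} [AddCommGroup M] {F : Type*} [AddAction M F] (m : M) :
    (List F →₀ k) →ₗ[k] (List F →₀ k) :=
  Finsupp.lmapDomain k k (List.map (m +ᵥ ·))

@[simp] lemma tr_single (m : M) (s : List F) (a : k) :
    tr k m (Finsupp.single s a) = Finsupp.single (s.map (m +ᵥ ·)) a := by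
  simp [tr, Finsupp.mapDomain_single]

lemma map_vadd_map_vadd (m m' : M) (s : List F) :
    (s.map (m' +ᵥ ·)).map (m +ᵥ ·) = s.map ((m + m') +ᵥ ·) := by
  simp [List.map_map, Function.comp_def, add_vadd]

lemma tr_tr (m m' : M) (z : List F →₀ k) : tr k m (tr k m' z) = tr k (m + m') z := by
  induction z using Finsupp.induction_linear with
  | zero => simp
  | add f g hf hg => simp only [map_add, hf, hg]
  | single s a => simp only [tr_single, map_vadd_map_vadd]

lemma tr_consL (m : M) (a : F) (z : List F →₀ k) :
    tr k m (consL k a z) = consL k (m +ᵥ a) (tr k m z) := by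
  induction z using Finsupp.induction_linear with
  | zero => simp
  | add f g hf hg => simp only [map_add, hf, hg]
  | single s a => simp

lemma tr_bd (m : M) (s : List F) : tr k m (bd k s) = bd k (s.map (m +ᵥ ·)) := by
  induction s with
  | nil => simp [bd]
  | cons a s ih => rw [bd, map_sub, tr_single, tr_consL, ih, List.map_cons, bd]

lemma tr_bdry (m : M) (z : List F →₀ k) : tr k m (bdry k F z) = bdry k F (tr k m z) := by
  induction z using Finsupp.induction_linear with
  | zero => simp
  | add f g hf hg => simp only [map_add, hf, hg]
  | single s a => simp [tr_bd]

lemma tr_mem {S S' : Set (List F)} {m : M} (h : ∀ s ∈ S, s.map (m +ᵥ ·) ∈ S') {z : List F →₀ k}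
    (hz : z ∈ Ch k S) : tr k m z ∈ Ch k S' :=
  linearMap_mem (fun s hs => by
    rw [tr_single]; exact Finsupp.single_mem_supported _ _ (h s hs)) hz

lemma hd_map (hc : ∀ (m : M) (x : F), c (m +ᵥ x) = m +ᵥ c x) (m : M) (o o' : P) {s : List F}
    (hs : s ≠ []) : hd c o (s.map (m +ᵥ ·)) = m +ᵥ hd c o' s := by
  cases s with
  | nil => exact absurd rfl hs
  | cons a s => exact hc m a

lemma tl_map (hc : ∀ (m : M) (x : F), c (m +ᵥ x) = m +ᵥ c x) (m : M) (o o' : P) {s : List F}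
    (hs : s ≠ []) : tl c o (s.map (m +ᵥ ·)) = m +ᵥ tl c o' s := by
  rw [tl, ← List.map_reverse]
  exact hd_map hc m o o' (by simpa using hs)

variable [PartialOrder F] [PartialOrder P]

/-- The contracting homotopies of `exists_homotopy` can be chosen equivariantly. -/
theorem exists_equivariant_homotopy (hc : Monotone c)
    (hcv : ∀ (m : M) (x : F), c (m +ᵥ x) = m +ᵥ c x)
    (hF : ∀ (m : M) (x y : F), x < y → m +ᵥ x < m +ᵥ y)
    (hP : ∀ (m : M) (x y : P), x ≤ y → m +ᵥ x ≤ m +ᵥ y)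
    (shift : P → M) (hshift : ∀ (m : M) (q : P), shift (m +ᵥ q) = m + shift q) {N : ℕ}
    (hN : ∀ s : List F, s.Pairwise (· < ·) → s.length ≤ N)
    (hac : ∀ p q : P, p ≤ q → Acyclic k (· < ·) {x | p ≤ c x ∧ c x ≤ q}) :
    ∃ W : P → (List F →₀ k) →ₗ[k] (List F →₀ k),
      (∀ (m : M) (q : P) (z : List F →₀ k), W (m +ᵥ q) (tr k m z) = tr k m (W q z)) ∧
      ∀ q, ∀ s ∈ chains (· < ·) {x | c x ≤ q},
      W q (Finsupp.single s 1) ∈ Ch k (chains (· < ·) {x | hd c q s ≤ c x ∧ c x ≤ q}) ∧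
      W q (Finsupp.single s 1) ∈ Ch k {l | l.length = s.length + 1} ∧
      bdry k F (W q (Finsupp.single s 1)) + W q (bd k s) = Finsupp.single s 1 := by
  choose W' hW' using fun q : P => exists_homotopy (k := k) hc q hN fun p hp => hac p q hp
  -- The translate `-shift q +ᵥ q` depends only on the orbit of `q`; transporting one choice per
  -- orbit gives equivariance.
  let W : P → (List F →₀ k) →ₗ[k] (List F →₀ k) := fun q =>
    tr k (shift q) ∘ₗ W' (-shift q +ᵥ q) ∘ₗ tr k (-shift q)
  refine ⟨W, fun m q z => ?_, fun q s hs => ?_⟩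
  · have hq : -(m + shift q) +ᵥ (m +ᵥ q) = -shift q +ᵥ q := by
      rw [← add_vadd]; congr 1; abel
    simp only [W, LinearMap.comp_apply, hshift, tr_tr, hq]
    congr 4
    abel
  · have hmap : ∀ (Q Q' : Set F) (m : M) (_ : ∀ x ∈ Q, m +ᵥ x ∈ Q'),
        ∀ l ∈ chains (· < ·) Q, l.map (m +ᵥ ·) ∈ chains (· < ·) Q' := by
      intro Q Q' m h l hl
      refine ⟨List.pairwise_map.2 (hl.1.imp fun hxy => hF m _ _ hxy), ?_⟩
      simp only [List.mem_map, forall_exists_index, and_imp, forall_apply_eq_imp_iff₂]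
      exact fun x hx => h x (hl.2 x hx)
    have hs' : s.map (-shift q +ᵥ ·) ∈ chains (· < ·) {x | c x ≤ -shift q +ᵥ q} := by
      refine hmap _ _ _ (fun x hx => ?_) s hs
      simp only [Set.mem_ofPred_eq, hcv]
      exact hP _ _ _ hx
    obtain ⟨h1, h2, h3⟩ := hW' _ _ hs'
    have hWs : W q (Finsupp.single s 1) =
        tr k (shift q) (W' (-shift q +ᵥ q) (Finsupp.single (s.map (-shift q +ᵥ ·)) 1)) := by
      simp [W]
    have hhd : -shift q +ᵥ hd c q s = hd c (-shift q +ᵥ q) (s.map (-shift q +ᵥ ·)) := by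
      by_cases hs0 : s = []
      · subst hs0; rfl
      · exact (hd_map hcv _ _ _ hs0).symm
    have hback : ∀ x y : P, -shift q +ᵥ x ≤ y → x ≤ shift q +ᵥ y := by
      intro x y h
      have := hP (shift q) _ _ h
      rwa [vadd_neg_vadd] at this
    have hback' : ∀ x y : P, x ≤ -shift q +ᵥ y → shift q +ᵥ x ≤ y := by
      intro x y h
      have := hP (shift q) _ _ h
      rwa [vadd_neg_vadd] at this
    rw [hWs]
    refine ⟨tr_mem (hmap _ _ _ fun x hx => ?_) h1, tr_mem (fun l hl => ?_) h2, ?_⟩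
    · simp only [Set.mem_ofPred_eq, ← hhd, hcv] at hx ⊢
      exact ⟨hback _ _ hx.1, hback' _ _ hx.2⟩
    · simpa using hl
    · have := congrArg (tr k (shift q)) h3
      rw [map_add, tr_bdry, tr_single, map_vadd_map_vadd] at this
      simpa [W, tr_bd] using this

end Translation

/-! ### Monomial systems and the maps of the chain complex. -/

/-- A ring with a system of monomials: elements `E p q` for `p ≤ q` in a partial order on which a
group acts freely with finitely many orbits, such that for each `p` the elements `E p q` form a
basis of the left ideal generated by the idempotent `E p p`. -/
structure MonomialSystem (k Λ M P : Type*) [Field k] [Ring Λ] [Algebra k Λ] [AddCommGroup M]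
    [PartialOrder P] [AddAction M P] where
  /-- the monomials -/
  E : P → P → Λ
  comp : ∀ {p q r : P}, p ≤ q → q ≤ r → E q r * E p q = E p r
  vadd : ∀ (m : M) {p q : P}, p ≤ q → E (m +ᵥ p) (m +ᵥ q) = E p q
  vadd_le : ∀ (m : M) (x y : P), x ≤ y → m +ᵥ x ≤ m +ᵥ y
  /-- the coordinates with respect to the monomials -/
  coord : P → Λ →ₗ[k] (P →₀ k)
  coord_E : ∀ {p q : P}, p ≤ q → coord p (E p q) = Finsupp.single q 1
  mul_E_mem : ∀ (p : P) (a : Λ), a * E p p ∈ Submodule.span k {x | ∃ q, p ≤ q ∧ x = E p q}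
  /-- a section of the action -/
  shift : P → M
  shift_vadd : ∀ (m : M) (q : P), shift (m +ᵥ q) = m + shift q
  /-- representatives of the orbits -/
  base : Finset P
  mem_base : ∀ p, p ∈ base ↔ shift p = 0
  sum_base : ∑ b ∈ base, E b b = 1
  orth : ∀ b ∈ base, ∀ b' ∈ base, b ≠ b' → E b b * E b' b' = 0

namespace MonomialSystem

variable {k Λ M P F : Type*} [Field k] [Ring Λ] [Algebra k Λ] [AddCommGroup M]
  [PartialOrder P] [AddAction M P] (S : MonomialSystem k Λ M P) (c : F → P) (o : P)
  [AddAction M F] {X : Type*} [AddCommGroup X] [Module Λ X] [Module k X] [IsScalarTower k Λ X]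

/-- The action of a ring element as a `k`-linear map. -/
abbrev act (a : Λ) : X →ₗ[k] X := Algebra.lsmul k k X a

/-- Translate a list so that its first element lies over a representative. -/
def norm (s : List F) : List F := s.map (-S.shift (hd c o s) +ᵥ ·)

/-- The monomial attached to a chain, from `p` through the chain to `q`. -/
def θ (q p : P) (s : List F) : X →ₗ[k] (List F →₀ Λ ⊗[k] X) :=
  open Classical in
  -- The empty chain is the augmentation degree and carries no term. Otherwise a path from `p` to
  -- `q` through the chain splits at its ends: `E (tl s) q` is the ring factor and `E p (hd s)` acts
  -- on `X`. Translation invariance of monomials allows the index to be normalized.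
  if s = [] then 0 else
    (Finsupp.lsingle (S.norm c o s)) ∘ₗ
      (TensorProduct.mk k Λ X (S.E (tl c o s) q)) ∘ₗ act (S.E p (hd c o s))

/-- The linear extension of `θ`. -/
def Θ (q p : P) : (List F →₀ k) →ₗ[k] X →ₗ[k] (List F →₀ Λ ⊗[k] X) :=
  Finsupp.linearCombination k (S.θ c o q p)

/-- The part of the differential that starts at the list `s`, for a chain of faces of `s`. -/
def dPart (s : List F) (u : List F →₀ k) : Λ ⊗[k] X →ₗ[Λ] (List F →₀ Λ ⊗[k] X) :=
  open Classical in
  u.sum fun t a => if t = [] then 0 else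
    (Finsupp.lsingle (S.norm c o t)) ∘ₗ TensorProduct.AlgebraTensorModule.map
      (LinearMap.toSpanSingleton Λ Λ (S.E (tl c o t) (tl c o s)))
      (a • act (S.E (hd c o s) (hd c o t)))

/-- The differential. -/
def dif (X : Type*) [AddCommGroup X] [Module Λ X] [Module k X] [IsScalarTower k Λ X] :
    (List F →₀ Λ ⊗[k] X) →ₗ[Λ] (List F →₀ Λ ⊗[k] X) :=
  Finsupp.lsum ℕ fun s => S.dPart c o s (bd k s)

/-- The augmentation. -/
def aug (k : Type*) {Λ F : Type*} [Field k] [Ring Λ] [Algebra k Λ]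
    (X : Type*) [AddCommGroup X] [Module Λ X] [Module k X] [IsScalarTower k Λ X] :
    (List F →₀ Λ ⊗[k] X) →ₗ[Λ] X :=
  Finsupp.lsum ℕ fun s => if s.length = 1 then
    TensorProduct.AlgebraTensorModule.lift
      ((LinearMap.toSpanSingleton Λ (X →ₗ[k] X) LinearMap.id)) else 0

/-- The projection onto the span of the normalized chains with `i + 1` elements. -/
def proj [LT F] (X : Type*) [AddCommGroup X] [Module Λ X] [Module k X] [IsScalarTower k Λ X]
    (i : ℕ) : (List F →₀ Λ ⊗[k] X) →ₗ[Λ] (List F →₀ Λ ⊗[k] X) :=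
  open Classical in
  -- The idempotents at the two ends cut the summand `Λ e ⊗ e' X` out of the free module `Λ ⊗ X`.
  Finsupp.lsum ℕ fun s =>
    if s.Pairwise (· < ·) ∧ s.length = i + 1 ∧ S.shift (hd c o s) = 0 then
      (Finsupp.lsingle s) ∘ₗ TensorProduct.AlgebraTensorModule.map
        (LinearMap.toSpanSingleton Λ Λ (S.E (tl c o s) (tl c o s)))
        (act (S.E (hd c o s) (hd c o s)))
    else 0

/-- The contracting homotopy induced by homotopies `W q` of the complexes of chains below `q`. -/
def homot (W : P → (List F →₀ k) →ₗ[k] (List F →₀ k))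
    (X : Type*) [AddCommGroup X] [Module Λ X] [Module k X] [IsScalarTower k Λ X] :
    (List F →₀ Λ ⊗[k] X) →ₗ[k] (List F →₀ Λ ⊗[k] X) :=
  -- Expanding the ring factor in monomials `E (tl s) q` reveals the endpoint `q`, hence which `W q`
  -- to apply. The result is only `k`-linear, because left multiplication moves `q`.
  Finsupp.lsum k fun s => TensorProduct.lift
    ((Finsupp.linearCombination k fun q => S.Θ c o q (hd c o s) (W q (Finsupp.single s 1))) ∘ₗ
      S.coord (tl c o s))

/-- The contracting homotopy in lowest degree. -/
def homotAug (W : P → (List F →₀ k) →ₗ[k] (List F →₀ k))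
    (X : Type*) [AddCommGroup X] [Module Λ X] [Module k X] [IsScalarTower k Λ X] :
    X →ₗ[k] (List F →₀ Λ ⊗[k] X) :=
  ∑ b ∈ S.base, S.Θ c o b b (W b (Finsupp.single [] 1)) ∘ₗ act (S.E b b)

end MonomialSystem

end OrderChain

end

/-! ### Computation with the elements `θ` that span the complex. -/

noncomputable section

namespace OrderChain

section Bounds

variable {F P : Type*} [PartialOrder F] [PartialOrder P] {c : F → P} (o : P)

lemma le_hd {s : List F} (hs : s ≠ []) {p q : P}
    (h : s ∈ chains (· < ·) {x | p ≤ c x ∧ c x ≤ q}) : p ≤ hd c o s := by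
  obtain ⟨a, ha, hca, -⟩ := hd_spec c o hs h.1
  rw [hca]
  exact (h.2 a ha).1

lemma tl_le {s : List F} (hs : s ≠ []) {p q : P}
    (h : s ∈ chains (· < ·) {x | p ≤ c x ∧ c x ≤ q}) : tl c o s ≤ q := by
  obtain ⟨a, ha, hca, -⟩ := tl_spec c o hs h.1
  rw [hca]
  exact (h.2 a ha).2

lemma mem_chains_hd_tl (hc : Monotone c) {s : List F} (h : s.Pairwise (· < ·)) :
    s ∈ chains (· < ·) {x | hd c o s ≤ c x ∧ c x ≤ tl c o s} := by
  refine ⟨h, fun x hx => ?_⟩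
  have hs := List.ne_nil_of_mem hx
  obtain ⟨a, ha, hca, hax⟩ := hd_spec c o hs h
  obtain ⟨b, hb, hcb, hbx⟩ := tl_spec c o hs h
  simp only [Set.mem_ofPred_eq, hca, hcb]
  exact ⟨hc (hax x hx), hc (hbx x hx)⟩

end Bounds

lemma coeff_nil_eq_zero {k : Type*} [Field k] {α : Type*} {d : ℕ} {z : List α →₀ k}
    (hz : z ∈ Ch k {l | l.length = d + 1}) : z [] = 0 := by
  by_contra h
  have := hz (Finsupp.mem_support_iff.2 h)
  simp at this

namespace MonomialSystem

variable {k Λ M P F : Type*} [Field k] [Ring Λ] [Algebra k Λ] [AddCommGroup M]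
  [PartialOrder P] [AddAction M P] (S : MonomialSystem k Λ M P) {c : F → P} (o : P)
  [AddAction M F] {X : Type*} [AddCommGroup X] [Module Λ X] [Module k X] [IsScalarTower k Λ X]

lemma smul_smul_E {p q r : P} (hpq : p ≤ q) (hqr : q ≤ r) (x : X) :
    S.E q r • S.E p q • x = S.E p r • x := by
  rw [smul_smul, S.comp hpq hqr]

lemma norm_map (hcv : ∀ (m : M) (x : F), c (m +ᵥ x) = m +ᵥ c x) (m : M) (s : List F) :
    S.norm c o (s.map (m +ᵥ ·)) = S.norm c o s := by
  by_cases hs : s = []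
  · subst hs; simp [norm]
  rw [norm, norm, hd_map hcv m o o hs, map_vadd_map_vadd, S.shift_vadd]
  congr 2
  ext x
  congr 1
  abel

lemma shift_hd_norm (hcv : ∀ (m : M) (x : F), c (m +ᵥ x) = m +ᵥ c x) {s : List F} (hs : s ≠ []) :
    S.shift (hd c o (S.norm c o s)) = 0 := by
  rw [norm, hd_map hcv _ o o hs, S.shift_vadd, neg_add_cancel]

lemma norm_eq_self {s : List F} (h : S.shift (hd c o s) = 0) : S.norm c o s = s := by
  simp [norm, h]

lemma θ_nil (q p : P) : (S.θ c o q p [] : X →ₗ[k] _) = 0 := by simp [θ]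

lemma θ_apply (q p : P) {s : List F} (hs : s ≠ []) (x : X) : S.θ (k := k) c o q p s x =
    Finsupp.single (S.norm c o s) (S.E (tl c o s) q ⊗ₜ[k] (S.E p (hd c o s) • x)) := by
  simp [θ, hs]

lemma Θ_single (q p : P) (s : List F) :
    S.Θ c o q p (Finsupp.single s 1) = (S.θ c o q p s : X →ₗ[k] _) := by
  simp [Θ]

variable [PartialOrder F]

/-- `Θ` is invariant under translation. -/
lemma Θ_tr (hcv : ∀ (m : M) (x : F), c (m +ᵥ x) = m +ᵥ c x) (m : M) {q p : P}
    {z : List F →₀ k} (hz : z ∈ Ch k (chains (· < ·) {x | p ≤ c x ∧ c x ≤ q})) :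
    S.Θ c o (m +ᵥ q) (m +ᵥ p) (tr k m z) = (S.Θ c o q p z : X →ₗ[k] _) := by
  refine linearMap_congr (f := S.Θ c o (m +ᵥ q) (m +ᵥ p) ∘ₗ tr k m)
    (g := (S.Θ c o q p : _ →ₗ[k] X →ₗ[k] _)) (fun s hs => ?_) hz
  rw [LinearMap.comp_apply, tr_single, Θ_single, Θ_single]
  by_cases hs0 : s = []
  · subst hs0; simp [θ_nil]
  ext x
  rw [θ_apply _ _ _ _ (by simpa using hs0), θ_apply _ _ _ _ hs0, S.norm_map o hcv,
    hd_map hcv m o o hs0, tl_map hcv m o o hs0, S.vadd _ (tl_le o hs0 hs), S.vadd _ (le_hd o hs0 hs)]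

lemma Θ_smul_E (q : P) {p p' : P} (hp : p ≤ p')
    {z : List F →₀ k} (hz : z ∈ Ch k (chains (· < ·) {x | p' ≤ c x ∧ c x ≤ q})) (x : X) :
    S.Θ c o q p' z (S.E p p' • x) = S.Θ c o q p z x := by
  refine linearMap_congr (f := (S.Θ c o q p').flip (S.E p p' • x))
    (g := (S.Θ c o q p).flip x) (fun s hs => ?_) hz
  rw [LinearMap.flip_apply, LinearMap.flip_apply, Θ_single, Θ_single]
  by_cases hs0 : s = []
  · subst hs0; simp [θ_nil]
  rw [θ_apply _ _ _ _ hs0, θ_apply _ _ _ _ hs0, S.smul_smul_E hp (le_hd o hs0 hs)]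

open Classical in
/-- The contribution of the face `t` to the differential of `a ⊗ x` at the list `s`. -/
def faceTerm (k : Type*) {Λ M P F : Type*} [Field k] [Ring Λ] [Algebra k Λ] [AddCommGroup M]
    [PartialOrder P] [AddAction M P] (S : MonomialSystem k Λ M P) (c : F → P) (o : P)
    [AddAction M F] {X : Type*} [AddCommGroup X] [Module Λ X] [Module k X] [IsScalarTower k Λ X]
    (s : List F) (a : Λ) (x : X) (t : List F) : List F →₀ Λ ⊗[k] X :=
  if t = [] then 0 else Finsupp.single (S.norm c o t)
    ((a * S.E (tl c o t) (tl c o s)) ⊗ₜ[k] (S.E (hd c o s) (hd c o t) • x))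

lemma dPart_tmul (s : List F) (u : List F →₀ k) (a : Λ) (x : X) :
    S.dPart c o s u (a ⊗ₜ[k] x) = Finsupp.linearCombination k (S.faceTerm k c o s a x) u := by
  rw [dPart, Finsupp.linearCombination_apply, Finsupp.sum, LinearMap.sum_apply, Finsupp.sum]
  refine Finset.sum_congr rfl fun t _ => ?_
  unfold faceTerm
  split_ifs with ht
  · simp
  · simp

/-- The ends of a face move inwards, and the monomials `E (hd s) (hd t)` and `E (tl t) (tl s)` in
the differential are exactly what composes with those of `s` to give those of `t`. -/
lemma faceTerm_norm (hc : Monotone c) (hcv : ∀ (m : M) (x : F), c (m +ᵥ x) = m +ᵥ c x)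
    {q p : P} {s : List F} (hs0 : s ≠ []) (hs : s ∈ chains (· < ·) {x | p ≤ c x ∧ c x ≤ q})
    (x : X) {t : List F} (ht : t.Sublist s) :
    S.faceTerm k c o (S.norm c o s) (S.E (tl c o s) q) (S.E p (hd c o s) • x)
      (t.map (-S.shift (hd c o s) +ᵥ ·)) = S.θ c o q p t x := by
  by_cases ht0 : t = []
  · subst ht0; simp [θ_nil, faceTerm]
  rw [faceTerm, if_neg (by simpa using ht0), θ_apply _ _ _ _ ht0, S.norm_map o hcv,
    tl_map hcv _ o o ht0, hd_map hcv _ o o ht0]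
  have e1 : tl c o (S.norm c o s) = -S.shift (hd c o s) +ᵥ tl c o s := tl_map hcv _ o o hs0
  have e2 : hd c o (S.norm c o s) = -S.shift (hd c o s) +ᵥ hd c o s := hd_map hcv _ o o hs0
  rw [e1, e2]
  obtain ⟨a, ha, hca, hax⟩ := hd_spec c o hs0 hs.1
  obtain ⟨b, hb, hcb, hbx⟩ := tl_spec c o hs0 hs.1
  obtain ⟨a', ha', hca', -⟩ := hd_spec c o ht0 (hs.1.sublist ht)
  obtain ⟨b', hb', hcb', -⟩ := tl_spec c o ht0 (hs.1.sublist ht)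
  have h1 : hd c o s ≤ hd c o t := by rw [hca, hca']; exact hc (hax _ (ht.subset ha'))
  have h2 : tl c o t ≤ tl c o s := by rw [hcb, hcb']; exact hc (hbx _ (ht.subset hb'))
  rw [S.vadd _ h1, S.vadd _ h2, S.comp h2 (tl_le o hs0 hs), S.smul_smul_E (le_hd o hs0 hs) h1]

/-- The differential corresponds to the boundary of chains. -/
lemma dif_θ (hc : Monotone c) (hcv : ∀ (m : M) (x : F), c (m +ᵥ x) = m +ᵥ c x)
    {q p : P} {s : List F} (hs : s ∈ chains (· < ·) {x | p ≤ c x ∧ c x ≤ q}) (x : X) :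
    S.dif c o X (S.θ c o q p s x) = S.Θ c o q p (bd k s) x := by
  by_cases hs0 : s = []
  · subst hs0; simp [θ_nil, bd]
  have hbd : bd k (S.norm c o s) =
      Finsupp.mapDomain (List.map (-S.shift (hd c o s) +ᵥ ·)) (bd k s) := (tr_bd _ _).symm
  rw [θ_apply _ _ _ _ hs0, dif, Finsupp.lsum_single, dPart_tmul, hbd,
    Finsupp.linearCombination_mapDomain]
  refine linearMap_congr (f := Finsupp.linearCombination k _)
    (g := (S.Θ c o q p).flip x) (fun t ht => ?_) (bd_mem_sublist s)
  rw [Finsupp.linearCombination_single, one_smul, LinearMap.flip_apply, Θ_single]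
  exact S.faceTerm_norm o hc hcv hs0 hs x ht.1

lemma dif_Θ (hc : Monotone c) (hcv : ∀ (m : M) (x : F), c (m +ᵥ x) = m +ᵥ c x)
    {q p : P} {z : List F →₀ k} (hz : z ∈ Ch k (chains (· < ·) {x | p ≤ c x ∧ c x ≤ q})) (x : X) :
    S.dif c o X (S.Θ c o q p z x) = S.Θ c o q p (bdry k F z) x := by
  refine linearMap_congr (f := (S.dif c o X).restrictScalars k ∘ₗ (S.Θ c o q p).flip x)
    (g := (S.Θ c o q p).flip x ∘ₗ bdry k F) (fun s hs => ?_) hz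
  simp only [LinearMap.comp_apply, LinearMap.flip_apply, Θ_single, bdry_single, one_smul,
    LinearMap.restrictScalars_apply]
  exact S.dif_θ o hc hcv hs x

lemma aug_single_tmul (s : List F) (a : Λ) (x : X) :
    aug k X (Finsupp.single s (a ⊗ₜ[k] x)) = if s.length = 1 then a • x else 0 := by
  rw [aug, Finsupp.lsum_single]
  split_ifs <;> simp

/-- Only one-element lists have the empty list as a face; for those, the two monomials through the
single vertex compose to `E p q`. -/
lemma aug_Θ {q p : P} {z : List F →₀ k}
    (hz : z ∈ Ch k (chains (· < ·) {x | p ≤ c x ∧ c x ≤ q})) (x : X) :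
    aug k X (S.Θ c o q p z x) = (bdry k F z []) • S.E p q • x := by
  refine linearMap_congr (f := (aug k X).restrictScalars k ∘ₗ (S.Θ c o q p).flip x)
    (g := LinearMap.toSpanSingleton k X (S.E p q • x) ∘ₗ Finsupp.lapply [] ∘ₗ bdry k F)
    (fun s hs => ?_) hz
  simp only [LinearMap.comp_apply, LinearMap.flip_apply, Θ_single, bdry_single, one_smul,
    LinearMap.restrictScalars_apply, Finsupp.lapply_apply, LinearMap.toSpanSingleton_apply]
  match s, hs with
  | [], _ => simp [θ_nil, bd]
  | [a], hs =>
    rw [θ_apply _ _ _ _ (by simp), aug_single_tmul, if_pos (by simp [norm])]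
    change S.E (c a) q • S.E p (c a) • x = _
    have := hs.2 a (by simp)
    rw [S.smul_smul_E this.1 this.2]
    simp [bd]
  | a :: b :: t, hs =>
    rw [θ_apply _ _ _ _ (by simp), aug_single_tmul, if_neg (by simp [norm]),
      coeff_nil_eq_zero (d := t.length), zero_smul]
    refine Finsupp.supported_mono ?_ (bd_mem_sublist _)
    exact fun l hl => by have := hl.2; simp at this ⊢; lia

/-- Equivariance of `W` undoes the normalization of `s`. Since `W q` yields only chains starting at
or above `hd c o s`, the monomial `E p (hd s)` is absorbed. -/
lemma homot_θ (hcv : ∀ (m : M) (x : F), c (m +ᵥ x) = m +ᵥ c x)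
    {W : P → (List F →₀ k) →ₗ[k] (List F →₀ k)}
    (hWv : ∀ (m : M) (q : P) (z : List F →₀ k), W (m +ᵥ q) (tr k m z) = tr k m (W q z))
    (hW : ∀ q, ∀ s ∈ chains (· < ·) {x | c x ≤ q},
      W q (Finsupp.single s 1) ∈ Ch k (chains (· < ·) {x | hd c q s ≤ c x ∧ c x ≤ q}))
    {q p : P} {s : List F} (hs0 : s ≠ []) (hs : s ∈ chains (· < ·) {x | p ≤ c x ∧ c x ≤ q})
    (x : X) : S.homot c o W X (S.θ c o q p s x) = S.Θ c o q p (W q (Finsupp.single s 1)) x := by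
  have hWs := hW q s ⟨hs.1, fun x hx => (hs.2 x hx).2⟩
  have hhd : hd c q s = hd c o s := by
    cases s with
    | nil => exact absurd rfl hs0
    | cons a s => rfl
  rw [hhd] at hWs
  set m := -S.shift (hd c o s) with hm
  have htl : tl c o (S.norm c o s) = m +ᵥ tl c o s := tl_map hcv _ _ _ hs0
  have hhd' : hd c o (S.norm c o s) = m +ᵥ hd c o s := hd_map hcv _ _ _ hs0
  rw [θ_apply _ _ _ _ hs0, homot, Finsupp.lsum_single, TensorProduct.lift.tmul,
    LinearMap.comp_apply, htl, ← S.vadd m (tl_le o hs0 hs),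
    S.coord_E (S.vadd_le m _ _ (tl_le o hs0 hs)), Finsupp.linearCombination_single, one_smul, hhd']
  have : Finsupp.single (S.norm c o s) (1 : k) = tr k m (Finsupp.single s 1) := by
    rw [tr_single, norm]
  rw [this, hWv, S.Θ_tr o hcv m hWs, S.Θ_smul_E o q (le_hd o hs0 hs) hWs]

section Proj

variable (c)

lemma proj_single_tmul (i : ℕ) {s : List F}
    (h : s.Pairwise (· < ·) ∧ s.length = i + 1 ∧ S.shift (hd c o s) = 0) (a : Λ) (x : X) :
    S.proj c o X i (Finsupp.single s (a ⊗ₜ[k] x)) = Finsupp.single s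
      ((a * S.E (tl c o s) (tl c o s)) ⊗ₜ[k] (S.E (hd c o s) (hd c o s) • x)) := by
  rw [proj, Finsupp.lsum_single, if_pos h]
  simp

lemma proj_single_eq_zero (i : ℕ) {s : List F}
    (h : ¬ (s.Pairwise (· < ·) ∧ s.length = i + 1 ∧ S.shift (hd c o s) = 0)) (t : Λ ⊗[k] X) :
    S.proj c o X i (Finsupp.single s t) = 0 := by
  rw [proj, Finsupp.lsum_single, if_neg h, LinearMap.zero_apply]

lemma proj_proj (i : ℕ) (z : List F →₀ Λ ⊗[k] X) :
    S.proj c o X i (S.proj c o X i z) = S.proj c o X i z := by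
  induction z using Finsupp.induction_linear with
  | zero => simp
  | add f g hf hg => simp only [map_add, hf, hg]
  | single s t =>
    by_cases h : s.Pairwise (· < ·) ∧ s.length = i + 1 ∧ S.shift (hd c o s) = 0
    · induction t using TensorProduct.induction_on with
      | zero => simp
      | add f g hf hg => simp only [Finsupp.single_add, map_add, hf, hg]
      | tmul a x =>
        rw [S.proj_single_tmul c o i h, S.proj_single_tmul c o i h, mul_assoc,
          S.comp le_rfl le_rfl, S.smul_smul_E le_rfl le_rfl]
    · rw [S.proj_single_eq_zero c o i h, map_zero]

variable {c}

/-- The chain `θ` is fixed by the projection of its degree. -/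
lemma proj_θ (hcv : ∀ (m : M) (x : F), c (m +ᵥ x) = m +ᵥ c x)
    (hF : ∀ (m : M) (x y : F), x < y → m +ᵥ x < m +ᵥ y) (i : ℕ)
    {q p : P} {s : List F} (hl : s.length = i + 1)
    (hs : s ∈ chains (· < ·) {x | p ≤ c x ∧ c x ≤ q}) (x : X) :
    S.proj c o X i (S.θ (k := k) c o q p s x) = S.θ c o q p s x := by
  have hs0 : s ≠ [] := by rintro rfl; simp at hl
  rw [θ_apply _ _ _ _ hs0, proj_single_tmul]
  · rw [norm, tl_map hcv _ o o hs0, hd_map hcv _ o o hs0, S.vadd _ le_rfl, S.vadd _ le_rfl,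
      S.comp le_rfl (tl_le o hs0 hs), S.smul_smul_E (le_hd o hs0 hs) le_rfl]
  · refine ⟨?_, ?_, ?_⟩
    · exact List.pairwise_map.2 (hs.1.imp fun hxy => hF _ _ _ hxy)
    · simpa [norm] using hl
    · exact S.shift_hd_norm o hcv hs0

/-- The image of the projection is spanned by the `θ`. -/
lemma proj_induction (hc : Monotone c) (i : ℕ) {N : Submodule k (List F →₀ Λ ⊗[k] X)}
    (h : ∀ (q p : P) (s : List F) (x : X), s.length = i + 1 →
      s ∈ chains (· < ·) {x | p ≤ c x ∧ c x ≤ q} → S.θ c o q p s x ∈ N)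
    (z : List F →₀ Λ ⊗[k] X) : S.proj c o X i z ∈ N := by
  induction z using Finsupp.induction_linear with
  | zero => simp
  | add f g hf hg => rw [map_add]; exact N.add_mem hf hg
  | single s t =>
    by_cases hs : s.Pairwise (· < ·) ∧ s.length = i + 1 ∧ S.shift (hd c o s) = 0
    swap
    · rw [S.proj_single_eq_zero c o i hs]; exact N.zero_mem
    induction t using TensorProduct.induction_on with
    | zero => simp
    | add f g hf hg => rw [Finsupp.single_add, map_add]; exact N.add_mem hf hg
    | tmul a x =>
      rw [S.proj_single_tmul c o i hs]
      have hs0 : s ≠ [] := by rintro rfl; simp at hs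
      let f : Λ →ₗ[k] (List F →₀ Λ ⊗[k] X) := (Finsupp.lsingle s) ∘ₗ
        (TensorProduct.mk k Λ X).flip (S.E (hd c o s) (hd c o s) • x)
      -- The left ideal generated by `E (tl s) (tl s)` is spanned by the monomials `E (tl s) q`, and
      -- for these the element is a `θ`.
      have : Submodule.span k {x | ∃ q, tl c o s ≤ q ∧ x = S.E (tl c o s) q} ≤ N.comap f := by
        refine Submodule.span_le.2 ?_
        rintro _ ⟨q, hq, rfl⟩
        have := h q (hd c o s) s x hs.2.1 ?_
        · rw [θ_apply _ _ _ _ hs0, S.norm_eq_self o hs.2.2] at this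
          exact this
        · have := mem_chains_hd_tl o hc hs.1
          exact ⟨this.1, fun y hy => ⟨(this.2 y hy).1, (this.2 y hy).2.trans hq⟩⟩
      exact this (S.mul_E_mem (tl c o s) a)

lemma proj_Θ_of_length (hcv : ∀ (m : M) (x : F), c (m +ᵥ x) = m +ᵥ c x)
    (hF : ∀ (m : M) (x y : F), x < y → m +ᵥ x < m +ᵥ y) (i : ℕ) {q p : P} {z : List F →₀ k}
    (hz : z ∈ Ch k (chains (· < ·) {x | p ≤ c x ∧ c x ≤ q}))
    (hl : z ∈ Ch k {l | l.length = i + 1}) (x : X) :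
    S.proj c o X i (S.Θ c o q p z x) = S.Θ c o q p z x := by
  have hz' : z ∈ Ch k (chains (· < ·) {x | p ≤ c x ∧ c x ≤ q} ∩ {l | l.length = i + 1}) := by
    rw [Ch, Finsupp.supported_inter]
    exact ⟨hz, hl⟩
  refine linearMap_congr (f := (S.proj c o X i).restrictScalars k ∘ₗ (S.Θ c o q p).flip x)
    (g := (S.Θ c o q p).flip x) (fun s hs => ?_) hz'
  simp only [LinearMap.comp_apply, LinearMap.flip_apply, Θ_single, LinearMap.restrictScalars_apply]
  exact S.proj_θ o hcv hF i hs.2 hs.1 x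

end Proj

end MonomialSystem

end OrderChain

end

/-! ### The resolution and the upper bound on projective dimension. -/

noncomputable section

namespace OrderChain

namespace MonomialSystem

open CategoryTheory

universe u

variable {k M P : Type*} {Λ : Type u} {F : Type} [Field k] [Ring Λ] [Algebra k Λ] [AddCommGroup M]
  [PartialOrder P] [AddAction M P] {c : F → P}
  [AddAction M F] [PartialOrder F]

section

variable {X : Type u} [AddCommGroup X] [Module Λ X] [Module k X] [IsScalarTower k Λ X]
  (o : P) {W : P → (List F →₀ k) →ₗ[k] (List F →₀ k)}

/-- Of the orthogonal idempotents `E b b`, only the one for the orbit of `q` does not kill `E p q`.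
-/
lemma homotAug_E (S : MonomialSystem k Λ M P)
    (hcv : ∀ (m : M) (x : F), c (m +ᵥ x) = m +ᵥ c x)
    (hWv : ∀ (m : M) (q : P) (z : List F →₀ k), W (m +ᵥ q) (tr k m z) = tr k m (W q z))
    (hW : ∀ q, ∀ s ∈ chains (· < ·) {x | c x ≤ q},
      W q (Finsupp.single s 1) ∈ Ch k (chains (· < ·) {x | hd c q s ≤ c x ∧ c x ≤ q}))
    {p q : P} (hpq : p ≤ q) (x : X) :
    S.homotAug c o W X (S.E p q • x) = S.Θ c o q p (W q (Finsupp.single [] 1)) x := by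
  set m := -S.shift q with hm
  have hb : m +ᵥ q ∈ S.base := by rw [S.mem_base, S.shift_vadd]; simp [hm]
  have hnil : ∀ q : P, W q (Finsupp.single [] 1) ∈
      Ch k (chains (· < ·) {x | q ≤ c x ∧ c x ≤ q}) :=
    fun q => hW q [] ⟨List.Pairwise.nil, by simp⟩
  have hEq : S.E p q = S.E (m +ᵥ q) (m +ᵥ q) * S.E p q := by
    rw [S.vadd m le_rfl, S.comp hpq le_rfl]
  rw [homotAug, LinearMap.sum_apply, Finset.sum_eq_single_of_mem _ hb]
  · simp only [LinearMap.comp_apply, Algebra.lsmul_apply, act]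
    rw [smul_smul, ← hEq, ← S.vadd m hpq, S.Θ_smul_E o _ (S.vadd_le m _ _ hpq) (hnil _)]
    have h1 : W (m +ᵥ q) (Finsupp.single [] 1) = tr k m (W q (Finsupp.single [] 1)) := by
      rw [← hWv]; simp
    rw [h1, S.Θ_tr o hcv m]
    refine Finsupp.supported_mono (chains_mono ?_) (hnil q)
    exact fun y hy => ⟨hpq.trans hy.1, hy.2⟩
  · intro b hbb hne
    have : S.E b b • S.E p q • x = 0 := by
      rw [hEq, smul_smul, ← mul_assoc, S.orth b hbb _ hb hne, zero_mul, zero_smul]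
    simp [this]

end

/-- A ring with a system of monomials indexed by a partial order `P` has global dimension at most
the length of the chains of a partial order `F` over `P` with acyclic intervals. -/
theorem hasProjectiveDimensionLT (S : MonomialSystem k Λ M P) (hc : Monotone c)
    (hcv : ∀ (m : M) (x : F), c (m +ᵥ x) = m +ᵥ c x)
    (hF : ∀ (m : M) (x y : F), x < y → m +ᵥ x < m +ᵥ y) {n : ℕ}
    (hn : ∀ s : List F, s.Pairwise (· < ·) → s.length ≤ n)
    (hac : ∀ p q : P, p ≤ q → Acyclic k (· < ·) {x | p ≤ c x ∧ c x ≤ q})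
    (X : ModuleCat.{u} Λ) : HasProjectiveDimensionLT X n := by
  rcases isEmpty_or_nonempty P with hP | ⟨⟨o⟩⟩
  -- Without positions the sum of idempotents giving `1` is empty, so the ring is zero.
  · have h1 : (0 : Λ) = 1 := by
      rw [← S.sum_base, Finset.sum_eq_zero]
      exact fun b => isEmptyElim b
    have : Subsingleton X := ⟨fun x y => by rw [← one_smul Λ x, ← one_smul Λ y, ← h1]; simp⟩
    have := (ModuleCat.isZero_of_subsingleton X).hasProjectiveDimensionLT_zero
    exact hasProjectiveDimensionLT_of_ge X 0 n (by lia)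
  let : Module k X := Module.compHom X (algebraMap k Λ)
  have : IsScalarTower k Λ X := IsScalarTower.of_algebraMap_smul fun _ _ => rfl
  obtain ⟨W, hWv, hW⟩ := exists_equivariant_homotopy (k := k) hc hcv hF S.vadd_le S.shift
    S.shift_vadd hn hac
  have hW1 := fun q s hs => (hW q s hs).1
  let 𝔽 := List F →₀ Λ ⊗[k] X
  let T : ℕ → Submodule Λ 𝔽 := fun i => LinearMap.range (S.proj c o X i)
  have hpT : ∀ i, ∀ z ∈ T i, S.proj c o X i z = z := by
    rintro i _ ⟨z, rfl⟩
    exact S.proj_proj c o i z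
  have hTp : ∀ i, Module.Projective Λ (T i) := fun i =>
    Module.Projective.of_split (M := 𝔽) (T i).subtype (S.proj c o X i).rangeRestrict (by
      refine LinearMap.ext fun z => Subtype.ext ?_
      exact hpT i z z.2)
  -- elements of `T i` are determined by the `θ`
  have ind : ∀ i (N : Submodule k 𝔽), (∀ (q p : P) (s : List F) (x : X), s.length = i + 1 →
      s ∈ chains (· < ·) {x | p ≤ c x ∧ c x ≤ q} → S.θ c o q p s x ∈ N) → ∀ z ∈ T i, z ∈ N := by
    intro i N h z hz
    rw [← hpT i z hz]
    exact S.proj_induction o hc i h z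
  have hΘT : ∀ i (q p : P) (z : List F →₀ k) (x : X),
      z ∈ Ch k (chains (· < ·) {x | p ≤ c x ∧ c x ≤ q}) → z ∈ Ch k {l | l.length = i + 1} →
      S.Θ c o q p z x ∈ T i := by
    intro i q p z x hz hl
    rw [← S.proj_Θ_of_length o hcv hF i hz hl]
    exact ⟨_, rfl⟩
  have hsub : ∀ {s : List F} {p q : P}, s ∈ chains (· < ·) {x | p ≤ c x ∧ c x ≤ q} →
      bd k s ∈ Ch k (chains (· < ·) {x | p ≤ c x ∧ c x ≤ q}) := by
    intro s p q hs
    have := bdry_mem (k := k) (Finsupp.single_mem_supported k (1 : k) hs)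
    simpa using this
  have hlen : ∀ {s : List F} {i : ℕ}, s.length = i + 1 → bd k s ∈ Ch k {l | l.length = i} := by
    intro s i hs
    exact Finsupp.supported_mono (fun l hl => by have := hl.2; simp only [Set.mem_ofPred_eq]; lia)
      (bd_mem_sublist s)
  have hdT : ∀ i, ∀ z ∈ T (i + 1), S.dif c o X z ∈ T i := by
    intro i z hz
    refine ind (i + 1) (((T i).restrictScalars k).comap ((S.dif c o X).restrictScalars k)) ?_ z hz
    intro q p s x hl hs
    change S.dif c o X (S.θ c o q p s x) ∈ T i
    rw [S.dif_θ o hc hcv hs]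
    exact hΘT i q p _ x (hsub hs) (hlen hl)
  have hWmem : ∀ {s : List F} {p q : P}, p ≤ q → s ∈ chains (· < ·) {x | p ≤ c x ∧ c x ≤ q} →
      W q (Finsupp.single s 1) ∈ Ch k (chains (· < ·) {x | p ≤ c x ∧ c x ≤ q}) := by
    intro s p q hpq hs
    refine Finsupp.supported_mono (chains_mono ?_) (hW1 q s ⟨hs.1, fun x hx => (hs.2 x hx).2⟩)
    refine fun y hy => ⟨le_trans ?_ hy.1, hy.2⟩
    by_cases hs0 : s = []
    · subst hs0; exact hpq
    · exact le_hd q hs0 hs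
  have hle : ∀ {s : List F} {i : ℕ} {p q : P}, s.length = i + 1 →
      s ∈ chains (· < ·) {x | p ≤ c x ∧ c x ≤ q} → p ≤ q := by
    intro s i p q hl hs
    cases s with
    | nil => simp at hl
    | cons a s => exact (hs.2 a (by simp)).1.trans (hs.2 a (by simp)).2
  have hsT : ∀ i, ∀ z ∈ T i, S.homot c o W X z ∈ T (i + 1) := by
    intro i z hz
    refine ind i (((T (i + 1)).restrictScalars k).comap (S.homot c o W X)) ?_ z hz
    intro q p s x hl hs
    change S.homot c o W X (S.θ c o q p s x) ∈ T (i + 1)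
    rw [S.homot_θ o hcv hWv hW1 (by rintro rfl; simp at hl) hs]
    refine hΘT _ q p _ x (hWmem (hle hl hs) hs) ?_
    have := (hW q s ⟨hs.1, fun x hx => (hs.2 x hx).2⟩).2.1
    rwa [hl] at this
  have hdd : ∀ i, ∀ z ∈ T (i + 1), S.dif c o X (S.dif c o X z) = 0 := by
    intro i z hz
    refine ind (i + 1) (LinearMap.ker ((S.dif c o X ∘ₗ S.dif c o X).restrictScalars k)) ?_ z hz
    intro q p s x hl hs
    rw [LinearMap.mem_ker]
    change S.dif c o X (S.dif c o X (S.θ c o q p s x)) = 0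
    rw [S.dif_θ o hc hcv hs, S.dif_Θ o hc hcv (hsub hs), bdry_bd, map_zero, LinearMap.zero_apply]
  have haug : ∀ z ∈ T 1, aug k X (S.dif c o X z) = 0 := by
    intro z hz
    refine ind 1 (LinearMap.ker ((aug k X ∘ₗ S.dif c o X).restrictScalars k)) ?_ z hz
    intro q p s x hl hs
    rw [LinearMap.mem_ker]
    change aug k X (S.dif c o X (S.θ c o q p s x)) = 0
    rw [S.dif_θ o hc hcv hs, S.aug_Θ o (hsub hs), bdry_bd, Finsupp.zero_apply, zero_smul]
  -- the homotopy identities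
  have hhom : ∀ i, ∀ z ∈ T (i + 1),
      S.dif c o X (S.homot c o W X z) + S.homot c o W X (S.dif c o X z) = z := by
    intro i z hz
    refine ind (i + 1) (LinearMap.eqLocus ((S.dif c o X).restrictScalars k ∘ₗ S.homot c o W X +
      S.homot c o W X ∘ₗ (S.dif c o X).restrictScalars k) LinearMap.id) ?_ z hz
    intro q p s x hl hs
    change S.dif c o X (S.homot c o W X (S.θ c o q p s x)) +
      S.homot c o W X (S.dif c o X (S.θ c o q p s x)) = S.θ c o q p s x
    have hs0 : s ≠ [] := by rintro rfl; simp at hl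
    have hbdm : bd k s ∈ Ch k (chains (· < ·) {x | p ≤ c x ∧ c x ≤ q} ∩ {l | l.length = i + 1}) := by
      rw [Ch, Finsupp.supported_inter]
      exact ⟨hsub hs, hlen hl⟩
    have h2 : S.homot c o W X (S.Θ c o q p (bd k s) x) = S.Θ c o q p (W q (bd k s)) x := by
      refine linearMap_congr (f := S.homot c o W X ∘ₗ (S.Θ c o q p).flip x)
        (g := (S.Θ c o q p).flip x ∘ₗ W q) (fun t ht => ?_) hbdm
      simp only [LinearMap.comp_apply, LinearMap.flip_apply, Θ_single]
      have ht2 : t.length = i + 1 := ht.2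
      exact S.homot_θ o hcv hWv hW1 (by rintro rfl; simp at ht2) ht.1 x
    rw [S.homot_θ o hcv hWv hW1 hs0 hs, S.dif_Θ o hc hcv (hWmem (hle hl hs) hs), S.dif_θ o hc hcv hs,
      h2, ← LinearMap.add_apply, ← map_add,
      (hW q s ⟨hs.1, fun x hx => (hs.2 x hx).2⟩).2.2, Θ_single]
  have hhom0 : ∀ z ∈ T 0,
      S.dif c o X (S.homot c o W X z) + S.homotAug c o W X (aug k X z) = z := by
    intro z hz
    refine ind 0 (LinearMap.eqLocus ((S.dif c o X).restrictScalars k ∘ₗ S.homot c o W X +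
      S.homotAug c o W X ∘ₗ (aug k X).restrictScalars k) LinearMap.id) ?_ z hz
    intro q p s x hl hs
    change S.dif c o X (S.homot c o W X (S.θ c o q p s x)) +
      S.homotAug c o W X (aug k X (S.θ c o q p s x)) = S.θ c o q p s x
    have hs0 : s ≠ [] := by rintro rfl; simp at hl
    have hbd : bd k s = Finsupp.single [] 1 := by
      obtain ⟨a, rfl⟩ := List.length_eq_one_iff.1 hl
      simp [bd]
    have haugθ : aug k X (S.θ c o q p s x) = S.E p q • x := by
      have := S.aug_Θ o (Finsupp.single_mem_supported k (1 : k) hs) x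
      simpa [Θ_single, hbd] using this
    have hWs := (hW q s ⟨hs.1, fun x hx => (hs.2 x hx).2⟩).2.2
    rw [S.homot_θ o hcv hWv hW1 hs0 hs, S.dif_Θ o hc hcv (hWmem (hle hl hs) hs), haugθ,
      S.homotAug_E o hcv hWv hW1 (hle hl hs), ← LinearMap.add_apply, ← map_add, ← hbd, hWs,
      Θ_single]
  have hnilmem : ∀ q : P, W q (Finsupp.single [] 1) ∈
      Ch k (chains (· < ·) {x | q ≤ c x ∧ c x ≤ q}) :=
    fun q => hW1 q [] ⟨List.Pairwise.nil, by simp⟩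
  have hsA : ∀ x : X, S.homotAug c o W X x ∈ T 0 := by
    intro x
    rw [homotAug, LinearMap.sum_apply]
    refine Submodule.sum_mem _ fun b _ => ?_
    exact hΘT 0 b b _ _ (hnilmem b) (by simpa using (hW b [] ⟨List.Pairwise.nil, by simp⟩).2.1)
  have haugs : ∀ x : X, aug k X (S.homotAug c o W X x) = x := by
    intro x
    rw [homotAug, LinearMap.sum_apply, map_sum]
    have : ∀ b ∈ S.base, aug k X ((S.Θ c o b b (W b (Finsupp.single [] 1)) ∘ₗ act (S.E b b)) x) =
        S.E b b • x := by
      intro b _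
      have h3 := (hW b [] ⟨List.Pairwise.nil, by simp⟩).2.2
      simp only [bd, map_zero, add_zero] at h3
      rw [LinearMap.comp_apply, S.aug_Θ o (hnilmem b), h3]
      simp only [Finsupp.single_eq_same, one_smul, act, Algebra.lsmul_apply]
      rw [S.smul_smul_E le_rfl le_rfl]
    rw [Finset.sum_congr rfl this, ← Finset.sum_smul, S.sum_base, one_smul]
  -- Degree `n` is spanned by chains with `n + 1` entries, and there are none.
  have hsubs : Subsingleton (T n) := by
    have : T n = ⊥ := by
      refine (Submodule.eq_bot_iff _).2 fun z hz => ?_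
      refine ind n ⊥ ?_ z hz
      intro q p s x hl hs
      have := hn s hs.1
      lia
    rw [this]
    infer_instance
  let _ : ∀ i, AddCommGroup (T i) := fun i => Module.addCommMonoidToAddCommGroup Λ
  refine hasProjectiveDimensionLT_of_resolution n X (fun i => T i)
    (fun i => (S.dif c o X).restrict (hdT i)) ((aug k X).domRestrict (T 0)) hTp ?_ ?_ ?_ hsubs
  · exact fun x => ⟨⟨_, hsA x⟩, haugs x⟩
  · intro z
    constructor
    · intro hz
      have := hhom0 z z.2
      have hz' : aug k X (z : List F →₀ Λ ⊗[k] X) = 0 := hz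
      rw [hz', map_zero, add_zero] at this
      exact ⟨⟨_, hsT 0 z z.2⟩, Subtype.ext this⟩
    · rintro ⟨y, rfl⟩
      exact haug y y.2
  · intro i z
    constructor
    · intro hz
      have h0 : S.dif c o X z = 0 := congrArg Subtype.val hz
      have := hhom i z z.2
      rw [h0, map_zero, add_zero] at this
      exact ⟨⟨_, hsT (i + 1) z z.2⟩, Subtype.ext this⟩
    · rintro ⟨y, rfl⟩
      exact Subtype.ext (hdd (i + 1) y y.2)

end MonomialSystem

end OrderChain

end

/-! ### Integral facet forms of a rational cone. -/

noncomputable section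

namespace Toric

universe v

variable {M : Type v} [AddCommGroup M]

/-- The real extension of an integral linear form. -/
def realExt (f : Module.Dual ℤ M) : RealSpace M →ₗ[ℝ] ℝ :=
  Module.Dual.baseChange ℝ f

@[simp] lemma realExt_latticeMap (f : Module.Dual ℤ M) (m : M) :
    realExt f (latticeMap M m) = f m := by
  simp [realExt, latticeMap]

lemma realExt_sub_smul (f h : Module.Dual ℤ M) (a b : ℤ) (x : RealSpace M) :
    realExt (a • f - b • h) x = a * realExt f x - b * realExt h x := by
  simp [realExt]

lemma realExt_smul (f : Module.Dual ℤ M) (a : ℤ) (x : RealSpace M) :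
    realExt (a • f) x = a * realExt f x := by
  simp [realExt]

lemma realExt_eq_zero {f : Module.Dual ℤ M} (h : ∀ x, realExt f x = 0) : f = 0 := by
  ext m
  have := h (latticeMap M m)
  rw [realExt_latticeMap] at this
  exact_mod_cast this

variable [Module.Free ℤ M] [Module.Finite ℤ M]

/-- A finitely generated rational cone is cut out by finitely many integral linear forms. -/
theorem exists_forms_of_hull (s : Finset M) :
    ∃ L : Finset (Module.Dual ℤ M), ∀ x : RealSpace M,
      x ∈ PointedCone.hull ℝ (latticeMap M '' (s : Set M)) ↔ ∀ f ∈ L, 0 ≤ realExt f x := by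
  classical
  induction s using Finset.induction_on with
  | empty =>
    let b := Module.Free.chooseBasis ℤ M
    refine ⟨Finset.univ.image (fun i => b.coord i) ∪ Finset.univ.image (fun i => -b.coord i),
      fun x => ?_⟩
    have hb : ∀ i, realExt (b.coord i) x = (b.baseChange ℝ).coord i x := by
      intro i
      induction x using TensorProduct.induction_on with
      | zero => simp
      | add x y hx hy => rw [map_add, map_add, hx, hy]
      | tmul a m => simp [realExt, mul_comm]
    have hneg : ∀ f : Module.Dual ℤ M, realExt (-f) x = -realExt f x := by
      intro f
      simpa using realExt_smul f (-1) x
    simp only [Finset.coe_empty, Set.image_empty, PointedCone.hull, Submodule.span_empty,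
      Submodule.mem_bot]
    constructor
    · rintro rfl; simp
    · intro h
      refine (b.baseChange ℝ).ext_elem fun i => ?_
      have h1 := h (b.coord i) (by simp)
      have h2 := h (-b.coord i) (by simp)
      rw [hneg] at h2
      rw [hb] at h1 h2
      simp only [Module.Basis.coord_apply] at h1 h2
      simp only [map_zero, Finsupp.coe_zero, Pi.zero_apply]
      linarith
  | insert g s hg ih =>
    obtain ⟨L, hL⟩ := ih
    -- Fourier–Motzkin elimination of the coefficient `a` of `g`: forms negative on `g` bound `a`
    -- below, forms positive on `g` bound it above. The new forms say that every lower bound,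
    -- including `0`, is at most every upper bound.
    let pos := L.filter fun f => 0 < f g
    let neg := L.filter fun f => f g < 0
    refine ⟨L.filter (fun f => 0 ≤ f g) ∪ (pos ×ˢ neg).image
      (fun p => p.1 g • p.2 - p.2 g • p.1), fun x => ?_⟩
    have hx : x ∈ PointedCone.hull ℝ (latticeMap M '' (insert g s : Finset M)) ↔
        ∃ a : ℝ, 0 ≤ a ∧ ∀ f ∈ L, a * f g ≤ realExt f x := by
      rw [Finset.coe_insert, Set.image_insert_eq, PointedCone.hull, Submodule.mem_span_insert]
      constructor
      · rintro ⟨a, z, hz, rfl⟩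
        refine ⟨a, a.2, fun f hf => ?_⟩
        have := (hL z).1 hz f hf
        have e : realExt f (a • latticeMap M g) = a * f g := by
          change realExt f ((a : ℝ) • latticeMap M g) = _
          rw [map_smul, realExt_latticeMap, smul_eq_mul]
        rw [map_add, e]
        linarith
      · rintro ⟨a, ha, h⟩
        refine ⟨⟨a, ha⟩, x - a • latticeMap M g, (hL _).2 fun f hf => ?_, ?_⟩
        · have := h f hf
          simp only [map_sub, map_smul, realExt_latticeMap, smul_eq_mul]
          linarith
        · change x = a • latticeMap M g + _
          abel
    rw [hx]
    constructor
    · rintro ⟨a, ha, h⟩ f hf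
      rcases Finset.mem_union.1 hf with hf | hf
      · obtain ⟨hf, hfg⟩ := Finset.mem_filter.1 hf
        have : (0 : ℝ) ≤ f g := by exact_mod_cast hfg
        exact (mul_nonneg ha this).trans (h f hf)
      · obtain ⟨⟨p, q⟩, hpq, rfl⟩ := Finset.mem_image.1 hf
        obtain ⟨hp, hq⟩ := Finset.mem_product.1 hpq
        obtain ⟨hp, hpg⟩ := Finset.mem_filter.1 hp
        obtain ⟨hq, hqg⟩ := Finset.mem_filter.1 hq
        rw [realExt_sub_smul]
        have h1 : (0 : ℝ) < p g := by exact_mod_cast hpg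
        have h2 : (q g : ℝ) < 0 := by exact_mod_cast hqg
        have := mul_le_mul_of_nonneg_left (h q hq) h1.le
        have := mul_le_mul_of_nonpos_left (h p hp) h2.le
        simp only at *
        nlinarith
    · intro h
      -- The set of lower bounds for `a`; its maximum is the coefficient to use.
      let A : Finset ℝ := insert 0 (neg.image fun f => realExt f x / f g)
      have hA : A.Nonempty := Finset.insert_nonempty _ _
      have ha0 : 0 ≤ A.max' hA := A.le_max' _ (Finset.mem_insert_self _ _)
      refine ⟨A.max' hA, ha0, fun f hf => ?_⟩
      rcases lt_trichotomy (f g) 0 with hfg | hfg | hfg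
      · have h2 : (f g : ℝ) < 0 := by exact_mod_cast hfg
        have := A.le_max' (realExt f x / f g) (Finset.mem_insert_of_mem
          (Finset.mem_image_of_mem _ (Finset.mem_filter.2 ⟨hf, hfg⟩)))
        rwa [div_le_iff_of_neg h2] at this
      · have := h f (Finset.mem_union_left _ (Finset.mem_filter.2 ⟨hf, hfg.ge⟩))
        simpa [hfg] using this
      · have h1 : (0 : ℝ) < f g := by exact_mod_cast hfg
        rcases Finset.mem_insert.1 (A.max'_mem hA) with h0 | h0
        · rw [h0, zero_mul]
          exact h f (Finset.mem_union_left _ (Finset.mem_filter.2 ⟨hf, hfg.le⟩))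
        · obtain ⟨q, hq, hqa⟩ := Finset.mem_image.1 h0
          have := h (f g • q - q g • f) (Finset.mem_union_right _ (Finset.mem_image.2
            ⟨(f, q), Finset.mem_product.2 ⟨Finset.mem_filter.2 ⟨hf, hfg⟩, hq⟩, rfl⟩))
          rw [realExt_sub_smul] at this
          have h2 : (q g : ℝ) < 0 := by exact_mod_cast (Finset.mem_filter.1 hq).2
          rw [← hqa, div_mul_eq_mul_div, div_le_iff_of_neg h2]
          linarith

/-- A non-zero integral form is a positive multiple of a primitive one. -/
lemma exists_primitive {f : Module.Dual ℤ M} (hf : f ≠ 0) :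
    ∃ (d : ℤ) (f' : Module.Dual ℤ M), 0 < d ∧ f = d • f' ∧ ∃ m, f' m = 1 := by
  obtain ⟨d, hd⟩ : (LinearMap.range f).IsPrincipal := inferInstance
  wlog hd0 : 0 ≤ d generalizing d
  · refine this (-d) ?_ (by lia)
    rw [hd, ← Set.neg_singleton, Submodule.span_neg]
  have hdvd : ∀ m, d ∣ f m := by
    intro m
    have : f m ∈ Submodule.span ℤ {d} := hd ▸ LinearMap.mem_range_self f m
    exact Ideal.mem_span_singleton.1 this
  have hdpos : 0 < d := by
    refine lt_of_le_of_ne hd0 fun h => hf ?_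
    ext m
    have := hdvd m
    rw [← h] at this
    simpa using this
  refine ⟨d, { toFun := fun m => f m / d, map_add' := fun m m' => ?_, map_smul' := fun a m => ?_ },
    hdpos, ?_, ?_⟩
  · rw [map_add, Int.add_ediv_of_dvd_left (hdvd m)]
  · simp only [map_smul, smul_eq_mul, RingHom.id_apply]
    exact Int.mul_ediv_assoc _ (hdvd m)
  · ext m
    simp [Int.mul_ediv_cancel' (hdvd m)]
  · have : d ∈ LinearMap.range f := hd ▸ Submodule.mem_span_singleton_self d
    obtain ⟨m, hm⟩ := this
    exact ⟨m, by simp [hm, Int.ediv_self hdpos.ne']⟩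

/-- Large multiples of a real point are approximated by lattice points. -/
lemma exists_lattice_approx (M : Type v) [AddCommGroup M] [Module.Free ℤ M] [Module.Finite ℤ M] :
    ∃ B : Module.Dual ℤ M → ℝ, ∀ (x : RealSpace M) (n : ℕ), ∃ m : M, ∀ f : Module.Dual ℤ M,
      |(f m : ℝ) - n * realExt f x| ≤ B f := by
  let b := Module.Free.chooseBasis ℤ M
  refine ⟨fun f => ∑ i, |(f (b i) : ℝ)|, fun x n => ?_⟩
  let y := (b.baseChange ℝ).repr x
  have hx : x = ∑ i, y i • latticeMap M (b i) := by
    conv_lhs => rw [← (b.baseChange ℝ).sum_repr x]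
    simp [y, latticeMap]
  refine ⟨∑ i, ⌊n * y i⌋ • b i, fun f => ?_⟩
  have : (f (∑ i, ⌊n * y i⌋ • b i) : ℝ) - n * realExt f x =
      ∑ i, -Int.fract (n * y i) * f (b i) := by
    conv_lhs => rw [hx]
    simp only [map_sum, map_smul, smul_eq_mul, realExt_latticeMap, Int.cast_sum, Int.cast_mul,
      Finset.mul_sum, ← Finset.sum_sub_distrib, Int.fract]
    exact Finset.sum_congr rfl fun i _ => by ring
  rw [this]
  refine (Finset.abs_sum_le_sum_abs _ _).trans (Finset.sum_le_sum fun i _ => ?_)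
  rw [abs_mul, abs_neg, abs_of_nonneg (Int.fract_nonneg _)]
  exact mul_le_of_le_one_left (abs_nonneg _) (Int.fract_lt_one _).le

/-- The primitive integral forms that define the facets of a full-dimensional pointed cone. -/
structure IsFacetSystem {J : Type*} (C : PointedCone ℝ (RealSpace M))
    (l : J → Module.Dual ℤ M) : Prop where
  mem_iff : ∀ x, x ∈ C ↔ ∀ j, 0 ≤ realExt (l j) x
  exists_eq_one : ∀ j, ∃ m, l j m = 1
  exists_interior : ∃ m, ∀ j, 0 < l j m
  exists_facet : ∀ j, ∃ m, l j m = 0 ∧ ∀ i, i ≠ j → 0 < l i m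
  eq_zero : ∀ x, (∀ j, realExt (l j) x = 0) → x = 0

/-- Among the finite sets of primitive forms that cut out the cone, one of least size contains no
superfluous form. Full dimension makes every form positive on the sum of the generators; pointedness
makes the forms jointly injective. -/
theorem exists_isFacetSystem {C : PointedCone ℝ (RealSpace M)} (hrat : IsRationalPolyhedral C)
    (hfull : IsFullDimensional C) (hpointed : IsStronglyConvex C) :
    ∃ (N : ℕ) (l : Fin N → Module.Dual ℤ M), IsFacetSystem C l := by
  classical
  obtain ⟨s, rfl⟩ := hrat
  set C := PointedCone.hull ℝ (latticeMap M '' (s : Set M)) with hC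
  have hex : ∃ n : ℕ, ∃ L : Finset (Module.Dual ℤ M), L.card = n ∧
      (∀ x, x ∈ C ↔ ∀ f ∈ L, 0 ≤ realExt f x) ∧ ∀ f ∈ L, ∃ m, f m = 1 := by
    obtain ⟨L, hL⟩ := exists_forms_of_hull s
    choose! d f' hd hf hm using fun f (hf : f ≠ (0 : Module.Dual ℤ M)) => exists_primitive hf
    refine ⟨_, (L.erase 0).image f', rfl, fun x => ?_, ?_⟩
    · rw [hL]
      simp only [Finset.forall_mem_image, Finset.mem_erase, and_imp]
      refine forall_congr' fun f => ?_
      by_cases h : f = 0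
      · simp [h, realExt]
      · have h1 : realExt f x = d f * realExt (f' f) x := by
          rw [← realExt_smul, ← hf f h]
        have h2 : (0 : ℝ) < d f := by exact_mod_cast hd f h
        simp [h, h1, mul_nonneg_iff_of_pos_left h2]
    · simp only [Finset.forall_mem_image, Finset.mem_erase, and_imp]
      exact fun f hf _ => hm f hf
  obtain ⟨L, hLn, hL, hL1⟩ := Nat.find_spec hex
  have hirr : ∀ f ∈ L, ∃ x, (∀ h ∈ L, h ≠ f → 0 ≤ realExt h x) ∧ realExt f x < 0 := by
    intro f hf
    by_contra! hcon
    refine Nat.find_min hex (m := (L.erase f).card) ?_ ⟨L.erase f, rfl, fun x => ?_, fun h hh =>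
      hL1 h (Finset.mem_of_mem_erase hh)⟩
    · rw [← hLn]; exact Finset.card_erase_lt_of_mem hf
    · rw [hL]
      refine ⟨fun h g hg => h g (Finset.mem_of_mem_erase hg), fun h g hg => ?_⟩
      have h' : ∀ h' ∈ L, h' ≠ f → 0 ≤ realExt h' x := fun h' hh' hne =>
        h h' (Finset.mem_erase.2 ⟨hne, hh'⟩)
      by_cases hgf : g = f
      · subst hgf; exact hcon x h'
      · exact h' g hg hgf
  have hgen : ∀ g ∈ s, ∀ f ∈ L, 0 ≤ f g := by
    intro g hg f hf
    have : latticeMap M g ∈ C := Submodule.subset_span ⟨g, hg, rfl⟩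
    have := (hL _).1 this f hf
    rw [realExt_latticeMap] at this
    exact_mod_cast this
  have hint : ∀ f ∈ L, 0 < f (∑ g ∈ s, g) := by
    intro f hf
    rw [map_sum]
    refine lt_of_le_of_ne (Finset.sum_nonneg fun g hg => hgen g hg f hf) fun h0 => ?_
    have h0 := (Finset.sum_eq_zero_iff_of_nonneg fun g hg => hgen g hg f hf).1 h0.symm
    have hle : (C : Set (RealSpace M)) ⊆ LinearMap.ker (realExt f) := by
      have : C ≤ (LinearMap.ker (realExt f)).restrictScalars _ := by
        refine Submodule.span_le.2 ?_
        rintro _ ⟨g, hg, rfl⟩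
        simp [h0 g hg]
      exact this
    have htop : LinearMap.ker (realExt f) = ⊤ := by
      rw [eq_top_iff, ← hfull]
      exact Submodule.span_le.2 hle
    have hf0 : f = 0 := realExt_eq_zero fun x => by
      have : x ∈ LinearMap.ker (realExt f) := htop ▸ Submodule.mem_top
      simpa using this
    obtain ⟨m, hm⟩ := hL1 f hf
    simp [hf0] at hm
  have hfac : ∀ f ∈ L, ∃ m, f m = 0 ∧ ∀ h ∈ L, h ≠ f → 0 < h m := by
    intro f hf
    obtain ⟨x, hx, hfx⟩ := hirr f hf
    obtain ⟨B, hB⟩ := exists_lattice_approx M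
    set e := ∑ g ∈ s, g
    have hev : ∀ᶠ n : ℕ in Filter.atTop, ∀ h ∈ L,
        0 < (n * (-realExt f x) - B f) * h e - f e * B h := by
      rw [Filter.eventually_all_finset]
      intro h hh
      have h1 : (0 : ℝ) < h e := by exact_mod_cast hint h hh
      have h2 : 0 < -realExt f x * h e := mul_pos (by linarith) h1
      obtain ⟨n₀, hn₀⟩ := exists_nat_gt ((B f * h e + f e * B h) / (-realExt f x * h e))
      filter_upwards [Filter.eventually_ge_atTop n₀] with n hn
      rw [div_lt_iff₀ h2] at hn₀
      have : (n₀ : ℝ) ≤ n := by exact_mod_cast hn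
      nlinarith
    obtain ⟨n, hn⟩ := hev.exists
    obtain ⟨m, hm⟩ := hB x n
    -- Here `m` approximates a large multiple of a point `x` that violates only `f`, and `e` is
    -- interior. The combination is killed by `f`. Every other form is positive on it, because `-f
    -- m` grows linearly in `n` while `h m` is at least the constant `-B h`.
    refine ⟨(-f m) • e + f e • m, by simp; ring, fun h hh hne => ?_⟩
    have h1 := hm f
    have h2 := hm h
    have h3 := hn h hh
    have h4 := hx h hh hne
    rw [abs_le] at h1 h2
    have h5 : (0 : ℝ) < h e := by exact_mod_cast hint h hh
    have h6 : (0 : ℝ) < f e := by exact_mod_cast hint f hf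
    have h7 : (0 : ℝ) ≤ n * realExt h x := by positivity
    have : (0 : ℝ) < -f m * h e + f e * h m := by
      have a1 : (n * (-realExt f x) - B f) * h e ≤ -f m * h e :=
        mul_le_mul_of_nonneg_right (by linarith) h5.le
      have a2 : f e * (-B h) ≤ f e * h m := mul_le_mul_of_nonneg_left (by linarith) h6.le
      linarith
    simp only [map_add, map_smul, smul_eq_mul]
    exact_mod_cast this
  refine ⟨L.card, fun j => (L.equivFin.symm j).1, ⟨fun x => ?_, fun j => hL1 _ (L.equivFin.symm j).2,
    ⟨_, fun j => hint _ (L.equivFin.symm j).2⟩, fun j => ?_, fun x hx => ?_⟩⟩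
  · rw [hL]
    refine ⟨fun h j => h _ (L.equivFin.symm j).2, fun h f hf => ?_⟩
    simpa using h (L.equivFin ⟨f, hf⟩)
  · obtain ⟨m, hm, hm'⟩ := hfac _ (L.equivFin.symm j).2
    refine ⟨m, hm, fun i hij => hm' _ (L.equivFin.symm i).2 fun h => hij ?_⟩
    exact L.equivFin.symm.injective (Subtype.ext h)
  · have h0 : ∀ f ∈ L, realExt f x = 0 := fun f hf => by simpa using hx (L.equivFin ⟨f, hf⟩)
    by_contra hne
    refine hpointed x ((hL x).2 fun f hf => (h0 f hf).ge) hne ((hL _).2 fun f hf => ?_)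
    rw [map_neg, h0 f hf, neg_zero]

end Toric

end

/-! ### Positions, faces and the length of chains of faces. -/

noncomputable section

namespace Toric

open OrderChain

universe u v

variable {M : Type v} [AddCommGroup M] {J : Type} (l : J → Module.Dual ℤ M)

/-- The vector of the round-ups of the forms `l j`. -/
def ceilVec (x : RealSpace M) : J → ℤ := fun j => ⌈realExt (l j) x⌉

/-- The vector of the round-downs and round-ups of the forms `l j`. It determines the face of the
arrangement of the hyperplanes `l j = t`, `t ∈ ℤ`. -/
def faceVec (x : RealSpace M) : J → ℤᵒᵈ × ℤ := fun j =>
  (OrderDual.toDual ⌊realExt (l j) x⌋, ⌈realExt (l j) x⌉)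

lemma ceilVec_add (x : RealSpace M) (m : M) (j : J) :
    ceilVec l (x + latticeMap M m) j = ceilVec l x j + l j m := by
  simp [ceilVec]

/-- The vectors of round-ups, ordered componentwise. They index the conic modules. -/
abbrev Position : Type := Set.range (ceilVec l)

/-- The faces of the arrangement of the hyperplanes `l j = t`, `t ∈ ℤ`, ordered by inclusion of
closures. -/
abbrev Face : Type := Set.range (faceVec l)

instance : AddAction M (Position l) where
  vadd m c := ⟨fun j => c.1 j + l j m, by
    obtain ⟨_, x, rfl⟩ := c
    exact ⟨x + latticeMap M m, funext fun j => ceilVec_add l x m j⟩⟩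
  zero_vadd c := by
    refine Subtype.ext (funext fun j => ?_)
    change c.1 j + l j 0 = _
    simp
  add_vadd m m' c := by
    refine Subtype.ext (funext fun j => ?_)
    change c.1 j + l j (m + m') = c.1 j + l j m' + l j m
    rw [map_add]; ring

instance : AddAction M (Face l) where
  vadd m c := ⟨fun j => (OrderDual.toDual (OrderDual.ofDual (c.1 j).1 + l j m), (c.1 j).2 + l j m),
    by
    obtain ⟨_, x, rfl⟩ := c
    exact ⟨x + latticeMap M m, funext fun j => by simp [faceVec]⟩⟩
  zero_vadd c := by
    refine Subtype.ext (funext fun j => ?_)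
    change (OrderDual.toDual (OrderDual.ofDual (c.1 j).1 + l j 0), (c.1 j).2 + l j 0) = _
    simp
  add_vadd m m' c := by
    refine Subtype.ext (funext fun j => ?_)
    change (OrderDual.toDual (OrderDual.ofDual (c.1 j).1 + l j (m + m')),
      (c.1 j).2 + l j (m + m')) = (OrderDual.toDual (OrderDual.ofDual (c.1 j).1 + l j m' + l j m),
      (c.1 j).2 + l j m' + l j m)
    rw [map_add (l j) m m', add_comm (l j m) (l j m'), add_assoc, add_assoc]

/-- The position of a point. -/
def pos (x : RealSpace M) : Position l := ⟨ceilVec l x, x, rfl⟩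

/-- The face of a point. -/
def face (x : RealSpace M) : Face l := ⟨faceVec l x, x, rfl⟩

variable {l}

@[simp] lemma vadd_position_apply (m : M) (c : Position l) (j : J) :
    (m +ᵥ c).1 j = c.1 j + l j m := rfl

lemma pos_add (x : RealSpace M) (m : M) : pos l (x + latticeMap M m) = m +ᵥ pos l x :=
  Subtype.ext (funext fun j => ceilVec_add l x m j)

lemma vadd_position_le_iff (m : M) (p q : Position l) : m +ᵥ p ≤ m +ᵥ q ↔ p ≤ q := by
  change (∀ j, p.1 j + l j m ≤ q.1 j + l j m) ↔ ∀ j, p.1 j ≤ q.1 j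
  simp

lemma vadd_face_le_iff (m : M) (p q : Face l) : m +ᵥ p ≤ m +ᵥ q ↔ p ≤ q := by
  change (∀ j, (OrderDual.ofDual (q.1 j).1 + l j m ≤ OrderDual.ofDual (p.1 j).1 + l j m ∧
    (p.1 j).2 + l j m ≤ (q.1 j).2 + l j m)) ↔
    ∀ j, (OrderDual.ofDual (q.1 j).1 ≤ OrderDual.ofDual (p.1 j).1 ∧ (p.1 j).2 ≤ (q.1 j).2)
  simp

lemma isFaceMap_face : IsFaceMap (fun j => realExt (l j)) (face l) := fun _ _ => Iff.rfl

/-- The round-ups on the relative interior of a face. -/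
def Face.ceil (F : Face l) : Position l := ⟨fun j => (F.1 j).2, by
  obtain ⟨_, x, rfl⟩ := F
  exact ⟨x, rfl⟩⟩

lemma Face.ceil_mono : Monotone (Face.ceil : Face l → Position l) := fun _ _ h j => (h j).2

lemma Face.ceil_vadd (m : M) (F : Face l) : (m +ᵥ F).ceil = m +ᵥ F.ceil := rfl

lemma vadd_face_lt (m : M) {F G : Face l} (h : F < G) : m +ᵥ F < m +ᵥ G :=
  lt_of_le_not_ge ((vadd_face_le_iff m F G).2 h.le) fun h' =>
    h.not_ge ((vadd_face_le_iff m G F).1 h')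

/-- The direction of the affine span of a face. -/
def Face.direction (F : Face l) : Submodule ℝ (RealSpace M) :=
  ⨅ j : {j : J // OrderDual.ofDual (F.1 j).1 = (F.1 j).2}, LinearMap.ker (realExt (l j))

lemma Face.mem_direction {F : Face l} {x : RealSpace M} : x ∈ F.direction ↔
    ∀ j, OrderDual.ofDual (F.1 j).1 = (F.1 j).2 → realExt (l j) x = 0 := by
  simp [direction, Submodule.mem_iInf]

/-- A form integral on the larger face is integral on the smaller one, with the same value. If the
directions agreed, every form integral at `x` would take the same value at `y`, and the faces would
coincide. -/
lemma Face.direction_lt {F G : Face l} (h : F < G) : F.direction < G.direction := by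
  obtain ⟨hle, hnle⟩ := h
  obtain ⟨_, x, rfl⟩ := F
  obtain ⟨_, y, rfl⟩ := G
  have hle' : ∀ j, ⌊realExt (l j) y⌋ ≤ ⌊realExt (l j) x⌋ ∧
    ⌈realExt (l j) x⌉ ≤ ⌈realExt (l j) y⌉ := hle
  have hfc : ∀ t : ℝ, ⌊t⌋ ≤ ⌈t⌉ := fun t => Int.floor_le_ceil t
  have hcf : ∀ t : ℝ, ⌈t⌉ ≤ ⌊t⌋ + 1 := fun t => Int.ceil_le_floor_add_one t
  have hint : ∀ t : ℝ, ⌊t⌋ = ⌈t⌉ → t = ⌊t⌋ := fun t ht =>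
    le_antisymm (ht ▸ Int.le_ceil t) (Int.floor_le t)
  have hsame : ∀ j, ⌊realExt (l j) y⌋ = ⌈realExt (l j) y⌉ →
      ⌊realExt (l j) x⌋ = ⌈realExt (l j) x⌉ ∧ ⌊realExt (l j) x⌋ = ⌊realExt (l j) y⌋ := by
    intro j hj
    have := hle' j
    have := hfc (realExt (l j) x)
    lia
  refine ⟨fun z hz => mem_direction.2 fun j hj => mem_direction.1 hz j (hsame j hj).1,
    fun hback => hnle ?_⟩
  have hmem : y - x ∈ direction (⟨faceVec l x, x, rfl⟩ : Face l) := by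
    refine hback (mem_direction.2 fun j hj => ?_)
    have h1 := hsame j hj
    rw [map_sub, hint _ hj, hint _ h1.1, h1.2, sub_self]
  intro j
  change ⌊realExt (l j) x⌋ ≤ ⌊realExt (l j) y⌋ ∧ ⌈realExt (l j) y⌉ ≤ ⌈realExt (l j) x⌉
  by_cases hj : ⌊realExt (l j) x⌋ = ⌈realExt (l j) x⌉
  · have := mem_direction.1 hmem j hj
    rw [map_sub, sub_eq_zero] at this
    rw [this]
    exact ⟨le_rfl, le_rfl⟩
  · have := hle' j
    have := hfc (realExt (l j) x)
    have := hcf (realExt (l j) y)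
    lia

variable [Module.Free ℤ M] [Module.Finite ℤ M]

/-- Directions grow strictly in dimension along the chain, through values between `0` and the rank.
-/
lemma Face.length_le_of_pairwise {s : List (Face l)} (hs : s.Pairwise (· < ·)) :
    s.length ≤ Module.finrank ℤ M + 1 := by
  have hV : Module.finrank ℝ (RealSpace M) = Module.finrank ℤ M := Module.finrank_baseChange
  rw [← hV]
  suffices ∀ d ≤ Module.finrank ℝ (RealSpace M) + 1,
      (∀ F ∈ s, d ≤ Module.finrank ℝ F.direction) →
      s.length + d ≤ Module.finrank ℝ (RealSpace M) + 1 by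
    simpa using this 0 (by lia) (by simp)
  induction hs with
  | nil => intro d hd _; simpa using hd
  | @cons F s hF _ ih =>
    intro d _ h
    have h1 := h F (by simp)
    have h2 := Submodule.finrank_le F.direction
    have := ih (d + 1) (by lia) fun G hG => by
      have := Submodule.finrank_lt_finrank_of_lt (direction_lt (hF G hG))
      lia
    simp only [List.length_cons]
    lia

/-- These are the faces meeting the convex set `p j - 1 < l j ≤ q j`, which contains every point of
position `p`. Their round-downs and round-ups lie in a finite box. -/
lemma IsGluable.interval [Finite J] {P : Set (Face l) → Prop} (hP : IsGluable P) {p q : Position l}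
    (hpq : p ≤ q) : P {F | p ≤ F.ceil ∧ F.ceil ≤ q} := by
  let K : Set (RealSpace M) := {x | ∀ j, (p.1 j : ℝ) - 1 < realExt (l j) x ∧
    realExt (l j) x ≤ q.1 j}
  have hK : ∀ x, x ∈ K ↔ p ≤ (face l x).ceil ∧ (face l x).ceil ≤ q := by
    intro x
    change (∀ j, _ ∧ _) ↔ (∀ j, p.1 j ≤ ⌈realExt (l j) x⌉) ∧ ∀ j, ⌈realExt (l j) x⌉ ≤ q.1 j
    rw [← forall_and]
    refine forall_congr' fun j => and_congr ?_ Int.ceil_le.symm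
    rw [← Int.sub_one_lt_iff, Int.lt_ceil]
    push_cast
    rfl
  have himg : face l '' K = {F | p ≤ F.ceil ∧ F.ceil ≤ q} := by
    ext F
    constructor
    · rintro ⟨x, hx, rfl⟩
      exact (hK x).1 hx
    · obtain ⟨_, x, rfl⟩ := F
      exact fun h => ⟨x, (hK x).2 h, rfl⟩
  rw [← himg]
  refine hP.image_convex isFaceMap_face ?_ ?_ ?_
  · have : K = ⋂ j, ((realExt (l j)) ⁻¹' Set.Ioc ((p.1 j : ℝ) - 1) (q.1 j)) := by
      ext x; simp [K]
    rw [this]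
    exact convex_iInter fun j => (convex_Ioc _ _).linear_preimage _
  · obtain ⟨_, x, rfl⟩ := p
    exact ⟨x, (hK x).2 ⟨le_rfl, hpq⟩⟩
  · rw [himg]
    refine Set.Finite.of_finite_image (f := Subtype.val) ?_ Subtype.val_injective.injOn
    refine (Set.Finite.pi' (t := fun j => ((Set.Icc (p.1 j - 1) (q.1 j)).image OrderDual.toDual) ×ˢ
      Set.Icc (p.1 j) (q.1 j)) fun j => ((Set.finite_Icc _ _).image _).prod
        (Set.finite_Icc _ _)).subset ?_
    rintro _ ⟨⟨_, x, rfl⟩, ⟨h1, h2⟩, rfl⟩ j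
    have h1 : p.1 j ≤ ⌈realExt (l j) x⌉ := h1 j
    have h2 : ⌈realExt (l j) x⌉ ≤ q.1 j := h2 j
    have h3 := Int.floor_le_ceil (realExt (l j) x)
    have h4 := Int.ceil_le_floor_add_one (realExt (l j) x)
    exact ⟨⟨_, ⟨by lia, by lia⟩, rfl⟩, h1, h2⟩

variable {k : Type*} [Field k] {Λ : Type u} [Ring Λ] [Algebra k Λ] [Finite J]

open CategoryTheory

theorem hasProjectiveDimensionLT_of_position (S : MonomialSystem k Λ M (Position l))
    (X : ModuleCat.{u} Λ) : HasProjectiveDimensionLT X (Module.finrank ℤ M + 1) :=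
  S.hasProjectiveDimensionLT (c := Face.ceil) Face.ceil_mono Face.ceil_vadd
    (fun m _ _ h => vadd_face_lt m h) (fun _ hs => Face.length_le_of_pairwise hs)
    (fun _ _ hpq => IsGluable.interval (isGluable_acyclic_lt k) hpq) X

theorem hasProjectiveDimensionLT_of_position_dual (S : MonomialSystem k Λ M (Position l)ᵒᵈ)
    (X : ModuleCat.{u} Λ) : HasProjectiveDimensionLT X (Module.finrank ℤ M + 1) := by
  refine S.hasProjectiveDimensionLT (F := (Face l)ᵒᵈ)
    (c := fun F => OrderDual.toDual (Face.ceil (OrderDual.ofDual F)))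
    (fun _ _ h => Face.ceil_mono h) Face.ceil_vadd
    (fun m _ _ h => vadd_face_lt (l := l) m h) (fun s hs => ?_)
    (fun p q hpq => ?_) X
  · have : List.Pairwise (α := Face l) (· < ·) s.reverse := List.pairwise_reverse.2 hs
    rw [← List.length_reverse]
    exact Face.length_le_of_pairwise this
  · have := IsGluable.interval (isGluable_acyclic_gt (α := Face l) k) (p := OrderDual.ofDual q)
      (q := OrderDual.ofDual p) hpq
    have hset : {F : Face l | OrderDual.ofDual q ≤ F.ceil ∧ F.ceil ≤ OrderDual.ofDual p} =
      {F | F.ceil ≤ OrderDual.ofDual p ∧ OrderDual.ofDual q ≤ F.ceil} :=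
        Set.ext fun _ => and_comm
    rw [hset] at this
    exact this

end Toric

end

/-! ### Matrix rings over the Laurent ring and their monomial systems. -/

noncomputable section

namespace OrderChain

/-- A ring of matrices over a Laurent ring in which the entries are spanned by the monomials
allowed by a partial order. -/
structure GradedMatrixRing (k Λ M P ι : Type*) [Field k] [Ring Λ] [Algebra k Λ] [AddCommGroup M]
    [PartialOrder P] [AddAction M P] [Fintype ι] [DecidableEq ι] where
  entry : Λ →ₐ[k] Matrix ι ι (AddMonoidAlgebra k M)
  rep : ι → P
  injective : Function.Injective entry
  mem_range : ∀ A, A ∈ entry.range ↔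
    ∀ i j (m : M), (A i j).coeff m ≠ 0 → m +ᵥ rep j ≤ rep i
  vadd_le : ∀ (m : M) (x y : P), x ≤ y → m +ᵥ x ≤ m +ᵥ y
  /-- the orbit of an element -/
  idx : P → ι
  /-- the translation from the representative to an element -/
  shift : P → M
  shift_vadd_rep : ∀ p, shift p +ᵥ rep (idx p) = p
  idx_vadd_rep : ∀ (m : M) i, idx (m +ᵥ rep i) = i
  shift_rep : ∀ (m : M) i, shift (m +ᵥ rep i) = m

namespace GradedMatrixRing

variable {k Λ M P ι : Type*} [Field k] [Ring Λ] [Algebra k Λ] [AddCommGroup M]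
    [PartialOrder P] [AddAction M P] [Fintype ι] [DecidableEq ι]
    (G : GradedMatrixRing k Λ M P ι)

lemma idx_vadd (m : M) (p : P) : G.idx (m +ᵥ p) = G.idx p := by
  conv_lhs => rw [← G.shift_vadd_rep p, ← add_vadd]
  exact G.idx_vadd_rep _ _

lemma shift_vadd (m : M) (p : P) : G.shift (m +ᵥ p) = m + G.shift p := by
  conv_lhs => rw [← G.shift_vadd_rep p, ← add_vadd]
  exact G.shift_rep _ _

lemma idx_rep (i : ι) : G.idx (G.rep i) = i := by simpa using G.idx_vadd_rep 0 i

lemma shift_rep_zero (i : ι) : G.shift (G.rep i) = 0 := by simpa using G.shift_rep 0 i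

lemma rep_idx (p : P) : G.rep (G.idx p) = -G.shift p +ᵥ p := by
  rw [eq_neg_vadd_iff, G.shift_vadd_rep]

lemma exists_entry_eq {p q : P} (h : p ≤ q) : ∃ x, G.entry x =
    Matrix.single (G.idx q) (G.idx p) (AddMonoidAlgebra.single (G.shift p - G.shift q) 1) := by
  refine (G.mem_range _).2 fun i j m hm => ?_
  rw [Matrix.single_apply] at hm
  split_ifs at hm with hij
  · obtain ⟨rfl, rfl⟩ := hij
    have hm' : G.shift p - G.shift q = m := by
      by_contra hne
      exact hm (by simp [hne])
    rw [← hm', rep_idx, rep_idx, ← add_vadd]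
    have := G.vadd_le (-G.shift q) _ _ h
    convert this using 2
    abel
  · simp at hm

open Classical in
/-- The element of the ring with a single non-zero entry, which is a monomial. -/
def E (p q : P) : Λ := if h : p ≤ q then (G.exists_entry_eq h).choose else 0

lemma entry_E {p q : P} (h : p ≤ q) : G.entry (G.E p q) =
    Matrix.single (G.idx q) (G.idx p) (AddMonoidAlgebra.single (G.shift p - G.shift q) 1) := by
  rw [E, dif_pos h]
  exact (G.exists_entry_eq h).choose_spec

/-- The coefficients of the entries. -/
def entryCoeff (i j : ι) : Λ →ₗ[k] (M →₀ k) where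
  toFun x := (G.entry x i j).coeff
  map_add' x y := by simp
  map_smul' a x := by simp

/-- The coordinates of the column `idx p`. -/
def coord (p : P) : Λ →ₗ[k] (P →₀ k) :=
  -- The monomial `x ^ m` in row `j` and column `idx p` is `E p q` for `q = (shift p - m) +ᵥ rep j`.
  ∑ j, Finsupp.lmapDomain k k (fun m => (G.shift p - m) +ᵥ G.rep j) ∘ₗ G.entryCoeff j (G.idx p)

/-- The monomial system of a graded matrix ring. -/
def toMonomialSystem : MonomialSystem k Λ M P where
  E := G.E
  comp {p q r} hpq hqr := G.injective (by
    rw [map_mul, G.entry_E hpq, G.entry_E hqr, G.entry_E (hpq.trans hqr), Matrix.single_mul_single_same,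
      AddMonoidAlgebra.single_mul_single]
    congr 2
    · abel
    · simp)
  vadd m {p q} h := G.injective (by
    rw [G.entry_E h, G.entry_E (G.vadd_le m _ _ h), idx_vadd, idx_vadd, shift_vadd, shift_vadd]
    congr 2
    abel)
  vadd_le := G.vadd_le
  coord := G.coord
  coord_E {p q} h := by
    rw [coord, LinearMap.sum_apply, Finset.sum_eq_single (G.idx q)]
    · simp only [LinearMap.comp_apply, entryCoeff, LinearMap.coe_mk, AddHom.coe_mk, G.entry_E h,
        Matrix.single_apply_same, AddMonoidAlgebra.coeff_single, Finsupp.lmapDomain_apply,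
        Finsupp.mapDomain_single]
      rw [sub_sub_cancel, G.shift_vadd_rep]
    · intro j _ hj
      simp [entryCoeff, G.entry_E h, hj.symm]
    · simp
  mul_E_mem p a := by
    have hsum : a * G.E p p = ∑ j, ∑ m ∈ (G.entry a j (G.idx p)).coeff.support,
        (G.entry a j (G.idx p)).coeff m • G.E p ((G.shift p - m) +ᵥ G.rep j) := by
      apply G.injective
      simp only [map_mul, map_sum, map_smul]
      rw [G.entry_E le_rfl]
      have : ∀ j, ∀ m ∈ (G.entry a j (G.idx p)).coeff.support,
          (G.entry a j (G.idx p)).coeff m • G.entry (G.E p ((G.shift p - m) +ᵥ G.rep j)) =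
          Matrix.single j (G.idx p) (AddMonoidAlgebra.single m
            ((G.entry a j (G.idx p)).coeff m)) := by
        intro j m hm
        have h1 := (G.mem_range _).1 ⟨a, rfl⟩ j (G.idx p) m (Finsupp.mem_support_iff.1 hm)
        have h2 : p ≤ (G.shift p - m) +ᵥ G.rep j := by
          have := G.vadd_le (G.shift p - m) _ _ h1
          rwa [← add_vadd, sub_add_cancel, G.shift_vadd_rep] at this
        rw [G.entry_E h2, G.idx_vadd_rep, G.shift_rep, sub_sub_cancel, Matrix.smul_single,
          AddMonoidAlgebra.smul_single, smul_eq_mul, mul_one]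
      rw [Finset.sum_congr rfl fun j _ => Finset.sum_congr rfl (this j)]
      ext i j : 1
      simp only [Matrix.sum_apply]
      by_cases hj : j = G.idx p
      · subst hj
        rw [Matrix.mul_single_apply_same, sub_self, Finset.sum_eq_single i]
        · simp only [Matrix.single_apply_same]
          rw [← AddMonoidAlgebra.one_def, mul_one]
          exact (AddMonoidAlgebra.sum_coeff_single (G.entry a i (G.idx p))).symm
        · intro b _ hb
          simp [hb]
        · simp
      · rw [Matrix.mul_single_apply_of_ne _ _ _ _ _ hj]
        simp [Ne.symm hj]
    rw [hsum]
    refine Submodule.sum_mem _ fun j _ => Submodule.sum_mem _ fun m hm => Submodule.smul_mem _ _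
      (Submodule.subset_span ⟨_, ?_, rfl⟩)
    have h1 := (G.mem_range _).1 ⟨a, rfl⟩ j (G.idx p) m (Finsupp.mem_support_iff.1 hm)
    have := G.vadd_le (G.shift p - m) _ _ h1
    rwa [← add_vadd, sub_add_cancel, G.shift_vadd_rep] at this
  shift := G.shift
  shift_vadd := G.shift_vadd
  base := open Classical in Finset.univ.image G.rep
  mem_base p := by
    simp only [Finset.mem_image, Finset.mem_univ, true_and]
    constructor
    · rintro ⟨i, rfl⟩
      exact G.shift_rep_zero i
    · intro h
      exact ⟨G.idx p, by rw [rep_idx, h, neg_zero, zero_vadd]⟩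
  sum_base := G.injective (by
    have hrep : Function.Injective G.rep := fun i j h => by
      rw [← G.idx_rep i, h, G.idx_rep]
    classical
    rw [Finset.sum_image hrep.injOn, map_sum, map_one]
    simp only [G.entry_E le_rfl, idx_rep, sub_self, ← AddMonoidAlgebra.one_def]
    exact Matrix.sum_single_one)
  orth b hb b' hb' hne := G.injective (by
    simp only [Finset.mem_image, Finset.mem_univ, true_and] at hb hb'
    obtain ⟨i, rfl⟩ := hb
    obtain ⟨j, rfl⟩ := hb'
    rw [map_mul, G.entry_E le_rfl, G.entry_E le_rfl, map_zero, idx_rep, idx_rep]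
    exact Matrix.single_mul_single_of_ne _ _ _ _ (fun h => hne (congrArg G.rep h)) _)

/-- The opposite of a graded matrix ring. -/
def op : GradedMatrixRing k Λᵐᵒᵖ M Pᵒᵈ ι where
  -- Transposition reverses products; negating exponents then brings the condition on entries to the
  -- required form for the dual order.
  entry := ((AddMonoidAlgebra.domCongr k k (AddEquiv.neg M)).toAlgHom.mapMatrix).comp
    ((Matrix.transposeAlgEquiv ι k (AddMonoidAlgebra k M)).symm.toAlgHom.comp (AlgHom.op G.entry))
  rep i := OrderDual.toDual (G.rep i)
  injective := by
    rw [AlgHom.coe_comp, AlgHom.coe_comp]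
    refine Function.Injective.comp ?_ (Function.Injective.comp ?_ ?_)
    · intro A B h
      ext i j : 1
      exact (AddMonoidAlgebra.domCongr k k (AddEquiv.neg M)).injective (congrFun (congrFun h i) j)
    · exact AlgEquiv.injective _
    · intro x y h
      exact MulOpposite.unop_injective (G.injective (MulOpposite.op_injective h))
  mem_range A := by
    have key : A ∈ (((AddMonoidAlgebra.domCongr k k (AddEquiv.neg M)).toAlgHom.mapMatrix).comp
        ((Matrix.transposeAlgEquiv ι k (AddMonoidAlgebra k M)).symm.toAlgHom.comp
          (AlgHom.op G.entry))).range ↔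
        (A.transpose.map (AddMonoidAlgebra.domCongr k k (AddEquiv.neg M))) ∈ G.entry.range := by
      constructor
      · rintro ⟨x, rfl⟩
        refine ⟨x.unop, ?_⟩
        ext i j m
        simp
      · rintro ⟨x, hx⟩
        refine ⟨MulOpposite.op x, ?_⟩
        have hx' : G.entry x = _ := hx
        ext i j m
        simp [hx']
    rw [key, G.mem_range]
    simp only [Matrix.map_apply, Matrix.transpose_apply]
    have aux : ∀ (m : M) (p q : P), -m +ᵥ p ≤ q ↔ p ≤ m +ᵥ q := by
      intro m p q
      constructor
      · intro h
        have := G.vadd_le m _ _ h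
        rwa [vadd_neg_vadd] at this
      · intro h
        have := G.vadd_le (-m) _ _ h
        rwa [neg_vadd_vadd] at this
    constructor
    · intro h i j m hm
      exact (aux m _ _).1 (h j i (-m) (by simpa using hm))
    · intro h i j m hm
      have := (aux (-m) _ _).2 (h j i (-m) (by simpa using hm))
      rwa [neg_neg] at this
  vadd_le m x y h := G.vadd_le m _ _ h
  idx p := G.idx (OrderDual.ofDual p)
  shift p := G.shift (OrderDual.ofDual p)
  shift_vadd_rep p := G.shift_vadd_rep (OrderDual.ofDual p)
  idx_vadd_rep := G.idx_vadd_rep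
  shift_rep := G.shift_rep

end GradedMatrixRing

end OrderChain

end

/-! ### Homomorphisms between conic modules. -/

noncomputable section

namespace Toric

open OrderChain

universe u v w

variable {M : Type v} [AddCommGroup M] {J : Type} {l : J → Module.Dual ℤ M}
  {C : PointedCone ℝ (RealSpace M)} (hl : IsFacetSystem C l) {k : Type u} [Field k]

instance (x : RealSpace M) : SMul (toricAlgebra k C) (conicModule k C x) :=
  Submodule.smul _

namespace IsFacetSystem

include hl

lemma sub_mem_iff (m : M) (x : RealSpace M) :
    latticeMap M m - x ∈ C ↔ ∀ j, (pos l x).1 j ≤ l j m := by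
  rw [hl.mem_iff]
  refine forall_congr' fun j => ?_
  rw [map_sub, realExt_latticeMap, sub_nonneg]
  exact Int.ceil_le.symm

lemma latticeMap_mem_iff (m : M) : latticeMap M m ∈ C ↔ ∀ j, 0 ≤ l j m := by
  simp [hl.mem_iff]

lemma mem_conicModule_iff {x : RealSpace M} {f : AddMonoidAlgebra k M} :
    f ∈ conicModule k C x ↔ ∀ m, f.coeff m ≠ 0 → ∀ j, (pos l x).1 j ≤ l j m :=
  forall_congr' fun m => imp_congr Iff.rfl (hl.sub_mem_iff m x)

lemma mem_toricAlgebra_iff {f : AddMonoidAlgebra k M} :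
    f ∈ toricAlgebra k C ↔ ∀ m, f.coeff m ≠ 0 → ∀ j, 0 ≤ l j m :=
  forall_congr' fun m => imp_congr Iff.rfl (hl.latticeMap_mem_iff m)

lemma exists_ge [Finite J] (c : J → ℤ) : ∃ m, (∀ j, c j ≤ l j m) ∧ ∀ j, 0 ≤ l j m := by
  obtain ⟨e, he⟩ := hl.exists_interior
  have : Fintype J := Fintype.ofFinite J
  refine ⟨(∑ j, |c j|) • e, fun j => ?_, fun j => ?_⟩
  · have h1 : |c j| ≤ ∑ j, |c j| :=
      Finset.single_le_sum (fun i _ => abs_nonneg (c i)) (Finset.mem_univ j)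
    have h2 := le_abs_self (c j)
    have h3 := he j
    rw [map_smul, smul_eq_mul]
    nlinarith [abs_nonneg (c j)]
  · rw [map_smul, smul_eq_mul]
    exact mul_nonneg (Finset.sum_nonneg fun i _ => abs_nonneg _) (he j).le

/-- The bound `(pos l x).1 j` is attained by a lattice point of `A_x`: primitivity of `l j` gives a
point with that value, and moving it far along the facet `l j = 0` satisfies the other inequalities.
-/
lemma pos_le_of_forall [Finite J] {x y : RealSpace M} {m : M}
    (h : ∀ s, (∀ j, (pos l x).1 j ≤ l j s) → ∀ j, (pos l y).1 j ≤ l j (m + s)) :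
    pos l y ≤ m +ᵥ pos l x := by
  intro j
  obtain ⟨e, he⟩ := hl.exists_eq_one j
  obtain ⟨g, hg, hg'⟩ := hl.exists_facet j
  have : Fintype J := Fintype.ofFinite J
  obtain ⟨s₀, hs₀⟩ : ∃ s₀, l j s₀ = (pos l x).1 j := ⟨(pos l x).1 j • e, by simp [he]⟩
  let n : ℤ := ∑ i, |(pos l x).1 i - l i s₀|
  have hs : ∀ i, (pos l x).1 i ≤ l i (s₀ + n • g) := by
    intro i
    rw [map_add, map_zsmul, smul_eq_mul]
    by_cases hij : i = j
    · subst hij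
      simp [hg, hs₀]
    · have h1 : |(pos l x).1 i - l i s₀| ≤ n :=
        Finset.single_le_sum (f := fun i => |(pos l x).1 i - l i s₀|) (fun i _ => abs_nonneg _)
          (Finset.mem_univ i)
      have h2 := le_abs_self ((pos l x).1 i - l i s₀)
      have h3 := hg' i hij
      nlinarith [abs_nonneg ((pos l x).1 i - l i s₀)]
  have := h _ hs j
  rw [map_add, map_add, map_zsmul, hg, hs₀, smul_zero, add_zero] at this
  rw [vadd_position_apply]
  linarith

lemma single_mem_conicModule {x : RealSpace M} {m : M} (h : ∀ j, (pos l x).1 j ≤ l j m) :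
    AddMonoidAlgebra.single m (1 : k) ∈ conicModule k C x := by
  classical
  refine hl.mem_conicModule_iff.2 fun m' hm' => ?_
  rw [AddMonoidAlgebra.coeff_single, Finsupp.single_apply] at hm'
  split_ifs at hm' with h'
  · exact h' ▸ h
  · exact absurd rfl hm'

lemma single_mem_toricAlgebra {m : M} (h : ∀ j, 0 ≤ l j m) :
    AddMonoidAlgebra.single m (1 : k) ∈ toricAlgebra k C := by
  classical
  refine hl.mem_toricAlgebra_iff.2 fun m' hm' => ?_
  rw [AddMonoidAlgebra.coeff_single, Finsupp.single_apply] at hm'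
  split_ifs at hm' with h'
  · exact h' ▸ h
  · exact absurd rfl hm'

/-- Finitely many exponents can be pushed into the cone by one interior lattice vector: denominators
in `k[M]` are monomials of `R`. -/
lemma exists_single_mul_mem [Finite J] (f : AddMonoidAlgebra k M) :
    ∃ s : M, (∀ j, 0 ≤ l j s) ∧ AddMonoidAlgebra.single s (1 : k) * f ∈ toricAlgebra k C := by
  obtain ⟨s, hs, hs0⟩ := hl.exists_ge fun j => ∑ m ∈ f.coeff.support, |l j m|
  refine ⟨s, hs0, hl.mem_toricAlgebra_iff.2 fun m hm j => ?_⟩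
  rw [AddMonoidAlgebra.coeff_single_mul_apply, one_mul] at hm
  have h1 : |l j (-s + m)| ≤ ∑ m ∈ f.coeff.support, |l j m| :=
    Finset.single_le_sum (f := fun m => |l j m|) (fun i _ => abs_nonneg _)
      (Finsupp.mem_support_iff.2 hm)
  have h2 := hs j
  have h3 := neg_abs_le (l j (-s + m))
  rw [map_add, map_neg] at h1 h3
  lia

end IsFacetSystem

lemma single_mul_cancel {m : M} {f g : AddMonoidAlgebra k M}
    (h : f * AddMonoidAlgebra.single m 1 = g * AddMonoidAlgebra.single m 1) : f = g := by
  have := congrArg (· * AddMonoidAlgebra.single (-m) (1 : k)) h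
  simpa [mul_assoc, AddMonoidAlgebra.single_mul_single, ← AddMonoidAlgebra.one_def] using this

namespace IsFacetSystem

/-- A monomial in `A_x ∩ R`. -/
def origin [Finite J] (x : RealSpace M) : M := (hl.exists_ge (pos l x).1).choose

lemma origin_spec [Finite J] (x : RealSpace M) :
    (∀ j, (pos l x).1 j ≤ l j (hl.origin x)) ∧ ∀ j, 0 ≤ l j (hl.origin x) :=
  (hl.exists_ge (pos l x).1).choose_spec

/-- The monomial `hl.origin x` as an element of `A_x`. -/
def originElt [Finite J] (k : Type u) [Field k] (x : RealSpace M) : conicModule k C x :=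
  ⟨AddMonoidAlgebra.single (hl.origin x) 1, hl.single_mem_conicModule (hl.origin_spec x).1⟩

/-- The Laurent polynomial by which a homomorphism of conic modules multiplies. -/
def factor [Finite J] {x y : RealSpace M}
    (f : conicModule k C x →ₗ[toricAlgebra k C] conicModule k C y) : AddMonoidAlgebra k M :=
  (f (hl.originElt k x)).1 * AddMonoidAlgebra.single (-hl.origin x) 1

variable [Finite J] {x y : RealSpace M}

include hl

/-- After clearing denominators, `a` and the chosen monomial of `A_x` have a common `R`-multiple;
linearity then determines the value at `a`, since monomials cancel. -/
lemma factor_mul (f : conicModule k C x →ₗ[toricAlgebra k C] conicModule k C y)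
    (a : conicModule k C x) : (f a).1 = hl.factor f * a.1 := by
  obtain ⟨s, hs, ha⟩ := hl.exists_single_mul_mem a.1
  let r : toricAlgebra k C := ⟨_, ha⟩
  let r' : toricAlgebra k C := ⟨AddMonoidAlgebra.single (s + hl.origin x) 1,
    hl.single_mem_toricAlgebra fun j => by
      rw [map_add]; exact add_nonneg (hs j) ((hl.origin_spec x).2 j)⟩
  have h1 : r • hl.originElt k x = r' • a := by
    apply Subtype.ext
    change AddMonoidAlgebra.single s 1 * a.1 * AddMonoidAlgebra.single (hl.origin x) 1 =
      AddMonoidAlgebra.single (s + hl.origin x) 1 * a.1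
    rw [mul_right_comm, AddMonoidAlgebra.single_mul_single, mul_one]
  have h2 := congrArg (fun z => (f z).1) h1
  simp only [map_smul] at h2
  change AddMonoidAlgebra.single s 1 * a.1 * (f (hl.originElt k x)).1 =
    AddMonoidAlgebra.single (s + hl.origin x) 1 * (f a).1 at h2
  apply single_mul_cancel (m := s + hl.origin x)
  have h3 : AddMonoidAlgebra.single (-hl.origin x) (1 : k) *
      AddMonoidAlgebra.single (s + hl.origin x) 1 = AddMonoidAlgebra.single s 1 := by
    rw [AddMonoidAlgebra.single_mul_single, add_comm s, neg_add_cancel_left, mul_one]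
  rw [mul_comm, ← h2, factor]
  linear_combination (-((f (hl.originElt k x)).1 * a.1)) * h3

lemma factor_unique {f : conicModule k C x →ₗ[toricAlgebra k C] conicModule k C y}
    {g : AddMonoidAlgebra k M} (h : ∀ a, (f a).1 = g * a.1) : hl.factor f = g := by
  apply single_mul_cancel (m := hl.origin x)
  exact (hl.factor_mul f (hl.originElt k x)).symm.trans (h _)

lemma pos_le_of_coeff_factor_ne (f : conicModule k C x →ₗ[toricAlgebra k C] conicModule k C y)
    {m : M} (hm : (hl.factor f).coeff m ≠ 0) : pos l y ≤ m +ᵥ pos l x := by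
  refine hl.pos_le_of_forall fun s hs => ?_
  have h1 := hl.mem_conicModule_iff.1 (f ⟨_, hl.single_mem_conicModule (k := k) hs⟩).2 (m + s)
  rw [hl.factor_mul] at h1
  refine h1 ?_
  rw [AddMonoidAlgebra.coeff_mul_single_add]
  simpa using hm

/-- Multiplication by a Laurent polynomial as a homomorphism of conic modules. -/
def mulHom (g : AddMonoidAlgebra k M) (h : ∀ m, g.coeff m ≠ 0 → pos l y ≤ m +ᵥ pos l x) :
    conicModule k C x →ₗ[toricAlgebra k C] conicModule k C y where
  toFun a := ⟨g * a.1, hl.mem_conicModule_iff.2 fun m hm j => by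
    classical
    obtain ⟨s, hs, t, ht, rfl⟩ := Finset.mem_add.1
      (AddMonoidAlgebra.support_coeff_mul_subset _ _ (Finsupp.mem_support_iff.2 hm))
    have h1 := h s (Finsupp.mem_support_iff.1 hs) j
    have h2 := hl.mem_conicModule_iff.1 a.2 t (Finsupp.mem_support_iff.1 ht) j
    rw [vadd_position_apply] at h1
    rw [map_add]
    linarith⟩
  map_add' a b := Subtype.ext (mul_add _ _ _)
  map_smul' r a := Subtype.ext (mul_left_comm _ _ _)

/-- The factors of an isomorphism and its inverse have product `1`, so they contain exponents `t`
and `s` with `s + t = 0`. The two inequalities they impose on positions are opposite. -/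
lemma nonempty_equiv_iff :
    Nonempty (conicModule k C x ≃ₗ[toricAlgebra k C] conicModule k C y) ↔
      ∃ m : M, pos l y = m +ᵥ pos l x := by
  classical
  constructor
  · rintro ⟨f⟩
    have h1 : hl.factor f.symm.toLinearMap * hl.factor f.toLinearMap = 1 := by
      apply single_mul_cancel (m := hl.origin x)
      have h2 := hl.factor_mul f.toLinearMap (hl.originElt k x)
      have h3 := hl.factor_mul f.symm.toLinearMap (f (hl.originElt k x))
      simp only [LinearEquiv.coe_coe, LinearEquiv.symm_apply_apply] at h2 h3
      rw [h2] at h3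
      rw [one_mul, mul_assoc]
      exact h3.symm
    have h2 : (0 : M) ∈ (hl.factor f.symm.toLinearMap *
        hl.factor f.toLinearMap).coeff.support := by
      rw [h1]
      simp [AddMonoidAlgebra.one_def]
    obtain ⟨s, hs, t, ht, hst⟩ := Finset.mem_add.1
      (AddMonoidAlgebra.support_coeff_mul_subset _ _ h2)
    have h3 := hl.pos_le_of_coeff_factor_ne _ (Finsupp.mem_support_iff.1 hs)
    have h4 := hl.pos_le_of_coeff_factor_ne _ (Finsupp.mem_support_iff.1 ht)
    refine ⟨t, le_antisymm h4 ?_⟩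
    have h5 := (vadd_position_le_iff t _ _).2 h3
    rwa [← add_vadd, add_comm t, hst, zero_vadd] at h5
  · rintro ⟨m, hm⟩
    have key : ∀ {x y : RealSpace M} {m : M}, pos l y = m +ᵥ pos l x → ∀ m',
        (AddMonoidAlgebra.single m (1 : k)).coeff m' ≠ 0 → pos l y ≤ m' +ᵥ pos l x := by
      intro x y m h m' hm'
      rw [AddMonoidAlgebra.coeff_single, Finsupp.single_apply] at hm'
      split_ifs at hm' with h'
      · rw [h, h']
      · exact absurd rfl hm'
    have hm' : pos l x = -m +ᵥ pos l y := by rw [hm, neg_vadd_vadd]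
    refine ⟨LinearEquiv.ofLinearMap (hl.mulHom _ (key hm)) (hl.mulHom _ (key hm')) ?_ ?_⟩ <;>
    · ext a : 2
      change AddMonoidAlgebra.single _ 1 * (AddMonoidAlgebra.single _ 1 * a.1) = a.1
      rw [← mul_assoc, AddMonoidAlgebra.single_mul_single]
      simp [← AddMonoidAlgebra.one_def]

end IsFacetSystem

end Toric

end

/-! ### The endomorphism ring as a graded matrix ring; finiteness of the classes. -/

noncomputable section

namespace Toric

open OrderChain

universe u v w

variable {M : Type v} [AddCommGroup M] {J : Type} {l : J → Module.Dual ℤ M}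
  {k : Type u} [Field k] {C : PointedCone ℝ (RealSpace M)} (hl : IsFacetSystem C l)
  {ι : Type w} {v : ι → RealSpace M}

section ConicSum

variable [DecidableEq ι] (k C v)

/-- The inclusion of a summand. -/
def incl (i : ι) : conicModule k C (v i) →ₗ[toricAlgebra k C] ConicSum k C v :=
  DirectSum.lof (toricAlgebra k C) ι (fun i => conicModule k C (v i)) i

/-- The projection to a summand. -/
def comp (i : ι) : ConicSum k C v →ₗ[toricAlgebra k C] conicModule k C (v i) :=
  DirectSum.component (toricAlgebra k C) ι (fun i => conicModule k C (v i)) i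

variable {k C v}

@[simp] lemma comp_incl_same (i : ι) (a : conicModule k C (v i)) :
    comp k C v i (incl k C v i a) = a :=
  DirectSum.component.lof_self _ _ _

lemma comp_incl_of_ne {i j : ι} (h : j ≠ i) (a : conicModule k C (v j)) :
    comp k C v i (incl k C v j a) = 0 :=
  (DirectSum.component.of _ _ _ _).trans (dif_neg h)

lemma conicSum_linearMap_ext {N : Type*} [AddCommMonoid N] [Module (toricAlgebra k C) N]
    {φ ψ : ConicSum k C v →ₗ[toricAlgebra k C] N}
    (h : ∀ i a, φ (incl k C v i a) = ψ (incl k C v i a)) : φ = ψ :=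
  DirectSum.linearMap_ext _ fun i => LinearMap.ext (h i)

lemma conicSum_ext {x y : ConicSum k C v} (h : ∀ i, comp k C v i x = comp k C v i y) : x = y :=
  DFinsupp.ext h

lemma sum_incl_comp [Fintype ι] (x : ConicSum k C v) :
    ∑ i, incl k C v i (comp k C v i x) = x := by
  refine conicSum_ext fun i => ?_
  rw [map_sum, Finset.sum_eq_single i]
  · simp
  · intro j _ hj
    exact comp_incl_of_ne hj _
  · simp

end ConicSum

instance : Algebra k (Module.End (toricAlgebra k C) (ConicSum k C v)) :=
  Algebra.compHom _ (algebraMap k (toricAlgebra k C))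

lemma algebraMap_end_apply (a : k) (x : ConicSum k C v) :
    algebraMap k (Module.End (toricAlgebra k C) (ConicSum k C v)) a x =
      algebraMap k (toricAlgebra k C) a • x := rfl

namespace IsFacetSystem

variable [Finite J] [DecidableEq ι]

/-- The matrix entries of an endomorphism. -/
def entryFun (φ : Module.End (toricAlgebra k C) (ConicSum k C v)) :
    Matrix ι ι (AddMonoidAlgebra k M) :=
  fun i j => hl.factor (comp k C v i ∘ₗ φ ∘ₗ incl k C v j)

lemma entryFun_mul (φ : Module.End (toricAlgebra k C) (ConicSum k C v)) (i j : ι)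
    (a : conicModule k C (v j)) :
    (comp k C v i (φ (incl k C v j a))).1 = hl.entryFun φ i j * a.1 :=
  hl.factor_mul (comp k C v i ∘ₗ φ ∘ₗ incl k C v j) a

lemma entryFun_unique {φ : Module.End (toricAlgebra k C) (ConicSum k C v)}
    {A : Matrix ι ι (AddMonoidAlgebra k M)}
    (h : ∀ i j (a : conicModule k C (v j)), (comp k C v i (φ (incl k C v j a))).1 = A i j * a.1) :
    hl.entryFun φ = A := by
  ext i j : 1
  exact hl.factor_unique (h i j)

variable [Fintype ι]

/-- The embedding of the endomorphism ring into a matrix ring. -/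
def entry : Module.End (toricAlgebra k C) (ConicSum k C v) →ₐ[k]
    Matrix ι ι (AddMonoidAlgebra k M) where
  toFun := hl.entryFun
  map_one' := hl.entryFun_unique fun i j a => by
    rw [Matrix.one_apply, Module.End.one_apply]
    split_ifs with h
    · subst h
      rw [comp_incl_same, one_mul]
    · rw [comp_incl_of_ne (Ne.symm h), zero_mul]
      rfl
  map_mul' φ ψ := hl.entryFun_unique fun i j a => by
    rw [Module.End.mul_apply, ← sum_incl_comp (ψ _), map_sum, map_sum, Matrix.mul_apply,
      Finset.sum_mul, AddSubmonoidClass.coe_finsetSum]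
    refine Finset.sum_congr rfl fun b _ => ?_
    rw [hl.entryFun_mul, hl.entryFun_mul, mul_assoc]
  map_zero' := hl.entryFun_unique fun i j a => by
    rw [LinearMap.zero_apply, map_zero, Matrix.zero_apply, zero_mul]
    rfl
  map_add' φ ψ := hl.entryFun_unique fun i j a => by
    rw [LinearMap.add_apply, map_add, Matrix.add_apply, add_mul, ← hl.entryFun_mul,
      ← hl.entryFun_mul]
    rfl
  commutes' r := hl.entryFun_unique fun i j a => by
    rw [algebraMap_end_apply, map_smul, Matrix.algebraMap_matrix_apply]
    split_ifs with h
    · subst h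
      rw [comp_incl_same]
      rfl
    · rw [comp_incl_of_ne (Ne.symm h), zero_mul, smul_zero]
      rfl

lemma entry_mul (φ : Module.End (toricAlgebra k C) (ConicSum k C v)) (i j : ι)
    (a : conicModule k C (v j)) :
    (comp k C v i (φ (incl k C v j a))).1 = hl.entry φ i j * a.1 :=
  hl.entryFun_mul φ i j a

lemma entry_injective : Function.Injective
    (hl.entry : Module.End (toricAlgebra k C) (ConicSum k C v) → _) := by
  intro φ ψ h
  refine conicSum_linearMap_ext fun j a => conicSum_ext fun i => Subtype.ext ?_
  rw [hl.entry_mul, hl.entry_mul, h]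

lemma mem_range_entry (A : Matrix ι ι (AddMonoidAlgebra k M)) :
    A ∈ (hl.entry : Module.End (toricAlgebra k C) (ConicSum k C v) →ₐ[k] _).range ↔
      ∀ i j (m : M), (A i j).coeff m ≠ 0 → pos l (v i) ≤ m +ᵥ pos l (v j) := by
  constructor
  · rintro ⟨φ, rfl⟩ i j m hm
    exact hl.pos_le_of_coeff_factor_ne _ hm
  · intro h
    refine ⟨∑ i, ∑ j, incl k C v i ∘ₗ hl.mulHom (A i j) (h i j) ∘ₗ comp k C v j,
      hl.entryFun_unique fun i j a => ?_⟩
    simp only [LinearMap.sum_apply, LinearMap.comp_apply]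
    rw [map_sum, Finset.sum_eq_single i, map_sum, Finset.sum_eq_single j]
    · rw [comp_incl_same, comp_incl_same]
      rfl
    · intro b _ hb
      rw [comp_incl_of_ne hb.symm, map_zero, map_zero, map_zero]
    · simp
    · intro b _ hb
      rw [map_sum]
      refine Finset.sum_eq_zero fun c _ => ?_
      rw [comp_incl_of_ne hb]
    · simp

end IsFacetSystem

section Representatives

variable [Module.Free ℤ M] [Module.Finite ℤ M]

lemma latticeMap_injective : Function.Injective (latticeMap M) := by
  refine (injective_iff_map_eq_zero _).2 fun m hm => ?_
  let b := Module.Free.chooseBasis ℤ M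
  refine b.ext_elem fun i => ?_
  have := realExt_latticeMap (b.coord i) m
  rw [hm, map_zero] at this
  simpa using (Int.cast_eq_zero.1 this.symm)

variable [Finite J]
include hl

/-- The action on positions is free because the cone is pointed: only zero is killed by all facet
forms. -/
lemma IsFacetSystem.eq_of_vadd_eq {m m' : M} {p : Position l} (h : m +ᵥ p = m' +ᵥ p) :
    m = m' := by
  rw [← sub_eq_zero]
  apply latticeMap_injective
  rw [map_zero]
  refine hl.eq_zero _ fun j => ?_
  have := congrFun (congrArg Subtype.val h) j
  simp only [vadd_position_apply, add_right_inj] at this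
  rw [realExt_latticeMap, map_sub, this, sub_self, Int.cast_zero]

variable (hv : ∀ w : RealSpace M, ∃! i : ι,
  Nonempty (conicModule k C w ≃ₗ[toricAlgebra k C] conicModule k C (v i)))

include hv

lemma IsFacetSystem.existsUnique_position (p : Position l) :
    ∃! i : ι, ∃ m : M, pos l (v i) = m +ᵥ p := by
  obtain ⟨_, x, rfl⟩ := p
  have := hv x
  simp only [hl.nonempty_equiv_iff] at this
  exact this

/-- A lattice translation brings each `v i` to a point where every `l j` is bounded independently of
`i`, so finitely many positions remain. Equal positions after translation mean isomorphic modules,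
hence equal indices. -/
theorem IsFacetSystem.finite_index : Finite ι := by
  obtain ⟨B, hB⟩ := exists_lattice_approx M
  choose m hm using fun i => hB (v i) 1
  let f : ι → J → ℤ := fun i => (pos l (v i - latticeMap M (m i))).1
  have hpos : ∀ i, pos l (v i) = m i +ᵥ pos l (v i - latticeMap M (m i)) := by
    intro i
    rw [← pos_add, sub_add_cancel]
  have hf : Function.Injective f := by
    intro i j hij
    obtain ⟨a, _, ha⟩ := hl.existsUnique_position hv (pos l (v i))
    have h1 := ha i ⟨0, (zero_vadd _ _).symm⟩
    have h2 := ha j ⟨m j - m i, ?_⟩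
    · rw [h1, h2]
    · rw [hpos i, hpos j, ← add_vadd, sub_add_cancel]
      congr 1
      exact Subtype.ext hij.symm
  have hfin : (Set.range f).Finite := by
    refine (Set.Finite.pi' fun j => Set.finite_Icc ⌈-B (l j)⌉ ⌈B (l j)⌉).subset ?_
    rintro _ ⟨i, rfl⟩ j
    have h1 := abs_le.1 (hm i (l j))
    have h2 : realExt (l j) (v i - latticeMap M (m i)) = realExt (l j) (v i) - l j (m i) := by
      rw [map_sub, realExt_latticeMap]
    rw [Nat.cast_one, one_mul] at h1
    constructor
    · exact Int.ceil_mono (by rw [h2]; linarith)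
    · exact Int.ceil_mono (by rw [h2]; linarith)
  have : Finite (Set.range f) := hfin
  exact Finite.of_injective_finite_range hf

/-- The endomorphism ring of a complete sum of conic modules is a graded matrix ring. -/
theorem IsFacetSystem.nonempty_gradedMatrixRing [Fintype ι] [DecidableEq ι] :
    Nonempty (GradedMatrixRing k (Module.End (toricAlgebra k C) (ConicSum k C v)) M
      (Position l)ᵒᵈ ι) := by
  choose idx hex huniq using hl.existsUnique_position hv
  choose sh hsh using hex
  have hidx : ∀ (m : M) (i : ι), idx (m +ᵥ pos l (v i)) = i := fun m i =>
    (huniq _ i ⟨-m, by rw [neg_vadd_vadd]⟩).symm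
  have hshift : ∀ p, -sh p +ᵥ pos l (v (idx p)) = p := fun p => by
    rw [hsh, neg_vadd_vadd]
  exact ⟨{
    entry := hl.entry
    rep := fun i => OrderDual.toDual (pos l (v i))
    injective := hl.entry_injective
    mem_range := hl.mem_range_entry
    vadd_le := fun m p q hpq => (vadd_position_le_iff (l := l) m q p).2 hpq
    idx := fun p => idx (OrderDual.ofDual p)
    shift := fun p => -sh (OrderDual.ofDual p)
    shift_vadd_rep := fun p => hshift (OrderDual.ofDual p)
    idx_vadd_rep := fun m i => hidx m i
    shift_rep := fun m i => by
      have h1 := hshift (m +ᵥ pos l (v i))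
      rw [hidx m i] at h1
      exact hl.eq_of_vadd_eq h1 }⟩

open CategoryTheory

theorem IsFacetSystem.hasProjectiveDimensionLT
    (X : ModuleCat.{max u v w} (Module.End (toricAlgebra k C) (ConicSum k C v))) :
    HasProjectiveDimensionLT X (Module.finrank ℤ M + 1) := by
  classical
  have := hl.finite_index hv
  have := Fintype.ofFinite ι
  obtain ⟨G⟩ := hl.nonempty_gradedMatrixRing hv
  exact hasProjectiveDimensionLT_of_position_dual G.toMonomialSystem X

theorem IsFacetSystem.hasProjectiveDimensionLT_op
    (X : ModuleCat.{max u v w} (Module.End (toricAlgebra k C) (ConicSum k C v))ᵐᵒᵖ) :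
    HasProjectiveDimensionLT X (Module.finrank ℤ M + 1) := by
  classical
  have := hl.finite_index hv
  have := Fintype.ofFinite ι
  obtain ⟨G⟩ := hl.nonempty_gradedMatrixRing hv
  exact hasProjectiveDimensionLT_of_position (l := l) G.op.toMonomialSystem X

end Representatives

end Toric

end

/-! ### Lower bound: `Ext` and regular central elements. -/

noncomputable section

open CategoryTheory Abelian

section ExtRegular

universe u v

open scoped ModuleCat.Algebra

/-- If a central element `r` is regular on `X` and kills `Z`, then passing from `X` to `X / r X`
raises the degree of non-vanishing of `Ext`. -/
lemma nontrivial_ext_succ_of_regular {R : Type v} {Λ : Type u} [CommRing R] [Ring Λ] [Algebra R Λ]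
    {X X' Z : ModuleCat.{u} Λ} (r : R) (p : X →ₗ[Λ] X') (hp : Function.Surjective p)
    (hinj : ∀ x : X, algebraMap R Λ r • x = 0 → x = 0)
    (hker : ∀ x : X, p x = 0 ↔ ∃ y : X, algebraMap R Λ r • y = x)
    (hZ : ∀ z : Z, algebraMap R Λ r • z = 0) {i : ℕ} (h : Nontrivial (Ext.{u} X Z i)) :
    Nontrivial (Ext.{u} X' Z (i + 1)) := by
  have happ : ∀ (Y : ModuleCat.{u} Λ) (y : Y), (r • 𝟙 Y : Y ⟶ Y).hom y = algebraMap R Λ r • y :=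
    fun Y y => rfl
  have hw : (r • 𝟙 X : X ⟶ X) ≫ ModuleCat.ofHom p = 0 := by
    ext x
    exact (hker _).2 ⟨x, rfl⟩
  have hS : (ShortComplex.mk _ _ hw).ShortExact := by
    refine ModuleCat.shortComplex_shortExact _ ?_ ?_ ?_
    · intro x
      exact hker x
    · refine (injective_iff_map_eq_zero (r • 𝟙 X : X ⟶ X).hom).2 fun x hx => hinj x hx
    · exact hp
  have hrZ : (r • 𝟙 Z : Z ⟶ Z) = 0 := by
    ext z
    exact hZ z
  obtain ⟨x, hx⟩ := exists_ne (0 : Ext.{u} X Z i)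
  by_contra hcon
  rw [not_nontrivial_iff_subsingleton] at hcon
  -- If the next `Ext` vanished, `x` would be `r` times some class; but `r` annihilates every class
  -- with values in `Z`.
  obtain ⟨y, hy⟩ := Ext.contravariant_sequence_exact₁ hS Z x (add_comm 1 i)
    (Subsingleton.elim (α := Ext.{u} X' Z (i + 1)) _ _)
  apply hx
  rw [← hy]
  change (Ext.mk₀ (r • 𝟙 X : X ⟶ X)).comp y (zero_add i) = 0
  rw [Ext.mk₀_smul, Ext.smul_comp, Ext.mk₀_id_comp, Ext.smul_eq_comp_mk₀, hrZ, Ext.mk₀_zero,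
    Ext.comp_zero]

end ExtRegular

/-! ### Modules of column vectors over quotients of the Laurent ring. -/

section Columns

open Matrix.Module

universe a b

variable {R Λ A ι : Type*} [CommRing R] [Ring Λ] [Algebra R Λ] [CommRing A] [Fintype ι]
  [DecidableEq ι] (e : Λ →+* Matrix ι ι A)

/-- The module of column vectors over an `A`-module, for a ring mapping to `ι × ι` matrices
over `A`. -/
def Columns (_ : Λ →+* Matrix ι ι A) (N : Type*) : Type _ := ι → N

instance (N : Type*) [AddCommGroup N] : AddCommGroup (Columns e N) :=
  inferInstanceAs (AddCommGroup (ι → N))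

instance (N : Type*) [AddCommGroup N] [Module A N] : Module Λ (Columns e N) :=
  Module.compHom (ι → N) e

lemma Columns.smul_eq {N : Type*} [AddCommGroup N] [Module A N] (a : Λ) (x : Columns e N) :
    a • x = (e a • (show ι → N from x) : ι → N) := rfl

lemma Columns.algebraMap_smul {N : Type*} [AddCommGroup N] [Module A N] {ρ : R →+* A}
    (he : ∀ r, e (algebraMap R Λ r) = Matrix.scalar ι (ρ r)) (r : R) (x : Columns e N) (i : ι) :
    (algebraMap R Λ r • x) i = ρ r • x i := by
  rw [smul_eq, he]
  exact congrFun (Matrix.Module.scalar_smul (ρ r) (show ι → N from x)) i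

/-- The map of column vectors induced by a linear map. -/
def Columns.map {N N' : Type*} [AddCommGroup N] [Module A N] [AddCommGroup N'] [Module A N']
    (f : N →ₗ[A] N') : Columns e N →ₗ[Λ] Columns e N' where
  toFun x i := f (x i)
  map_add' _ _ := funext fun _ => f.map_add _ _
  map_smul' a x := (f.mapMatrixModule ι).map_smul (e a) (show ι → N from x)

/-- The projective dimension of the columns over a quotient by a regular sequence is at least the
length of the sequence. -/
theorem not_hasProjectiveDimensionLT_columns {R : Type*} {Λ : Type (max a b)}
    {A : Type a} {ι : Type b}
    [CommRing R] [Ring Λ] [Algebra R Λ] [CommRing A] [Fintype ι] [DecidableEq ι] [Nonempty ι]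
    (e : Λ →+* Matrix ι ι A) {ρ : R →+* A}
    (he : ∀ r, e (algebraMap R Λ r) = Matrix.scalar ι (ρ r)) (I : ℕ → Ideal A) (r : ℕ → R) {n : ℕ}
    (hI : ∀ j < n, I (j + 1) = I j ⊔ Ideal.span {ρ (r j)})
    (hr : ∀ j < n, ∀ a, ρ (r j) * a ∈ I j → a ∈ I j) (hn : I n ≠ ⊤) :
    ¬ HasProjectiveDimensionLT (ModuleCat.of Λ (Columns e (A ⧸ I n))) n := by
  let Y : ℕ → ModuleCat.{max a b} Λ := fun j => ModuleCat.of Λ (Columns e (A ⧸ I j))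
  have hmono : ∀ i j, i ≤ j → j ≤ n → I i ≤ I j := by
    intro i j hij
    induction j, hij using Nat.le_induction with
    | base => exact fun _ => le_rfl
    | succ j _ ih => exact fun hj => (ih (by lia)).trans (by rw [hI j (by lia)]; exact le_sup_left)
  have hrI : ∀ j < n, ρ (r j) ∈ I (j + 1) := fun j hj => by
    rw [hI j hj]; exact Ideal.mem_sup_right (Ideal.mem_span_singleton_self _)
  -- In degree zero the quotient map is non-zero as `I n` is proper. Each later step divides by `ρ
  -- (r j)`, which is regular modulo `I j` and zero modulo `I n`.
  have key : ∀ j ≤ n, Nontrivial (Ext.{max a b} (Y j) (Y n) j) := by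
    intro j
    induction j with
    | zero =>
      intro _
      let f : Y 0 ⟶ Y n := ModuleCat.ofHom
        (Columns.map e (Submodule.factor (hmono 0 n (by lia) le_rfl)))
      refine ⟨Ext.mk₀ f, 0, fun h0 => hn ?_⟩
      rw [Ext.mk₀_eq_zero_iff] at h0
      rw [Ideal.eq_top_iff_one, ← Ideal.Quotient.eq_zero_iff_mem]
      have h1 := congrArg (fun g : Y 0 ⟶ Y n => g.hom (fun _ => (Ideal.Quotient.mk (I 0) 1))) h0
      exact congrFun h1 (Classical.arbitrary ι)
    | succ j ih =>
      intro hj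
      have hj' : j < n := hj
      refine nontrivial_ext_succ_of_regular (X := Y j) (X' := Y (j + 1)) (Z := Y n) (r j)
        (Columns.map e (Submodule.factor (hmono j (j + 1) (by lia) hj)))
        ?_ ?_ ?_ ?_ (ih (by lia))
      · intro y
        choose x hx using fun i => Submodule.factor_surjective (hmono j (j + 1) (by lia) hj) (y i)
        exact ⟨x, funext hx⟩
      · intro x hx
        refine funext fun i => ?_
        have h1 := congrFun hx i
        rw [Columns.algebraMap_smul e he] at h1
        obtain ⟨a, ha⟩ := Ideal.Quotient.mk_surjective (x i)
        rw [← ha] at h1 ⊢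
        exact Ideal.Quotient.eq_zero_iff_mem.2 (hr j hj' a (Ideal.Quotient.eq_zero_iff_mem.1 h1))
      · intro x
        constructor
        · intro hx
          have : ∀ i, ∃ y : A ⧸ I j, ρ (r j) • y = x i := by
            intro i
            have h1 := congrFun hx i
            obtain ⟨a, ha⟩ := Ideal.Quotient.mk_surjective (x i)
            change Submodule.factor (hmono j (j + 1) (by lia) hj) (x i) = 0 at h1
            rw [← ha] at h1 ⊢
            have h2 : a ∈ I (j + 1) := Ideal.Quotient.eq_zero_iff_mem.1 h1
            rw [hI j hj', Submodule.mem_sup] at h2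
            obtain ⟨b, hb, c, hc, rfl⟩ := h2
            obtain ⟨d, rfl⟩ := Ideal.mem_span_singleton'.1 hc
            refine ⟨Ideal.Quotient.mk (I j) d, ?_⟩
            rw [map_add, Ideal.Quotient.eq_zero_iff_mem.2 hb, zero_add, mul_comm]
            rfl
          choose y hy using this
          exact ⟨y, funext fun i => (Columns.algebraMap_smul e he (r j) y i).trans (hy i)⟩
        · rintro ⟨y, rfl⟩
          refine funext fun i => ?_
          change Submodule.factor (hmono j (j + 1) (by lia) hj)
            ((algebraMap R Λ (r j) • (show Columns e (A ⧸ I j) from y)) i) = 0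
          rw [Columns.algebraMap_smul e he, map_smul]
          obtain ⟨a, ha⟩ := Ideal.Quotient.mk_surjective (y i)
          rw [← ha]
          exact Ideal.Quotient.eq_zero_iff_mem.2 (Ideal.mul_mem_right _ _ (hrI j hj'))
      · intro z
        refine funext fun i => ?_
        change (algebraMap R Λ (r j) • (show Columns e (A ⧸ I n) from z)) i = 0
        rw [Columns.algebraMap_smul e he]
        obtain ⟨a, ha⟩ := Ideal.Quotient.mk_surjective (z i)
        rw [← ha]
        exact Ideal.Quotient.eq_zero_iff_mem.2
          (Ideal.mul_mem_right _ _ (hmono (j + 1) n hj le_rfl (hrI j hj')))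
  intro hlt
  obtain ⟨x, hx⟩ := @exists_ne _ (key n le_rfl) 0
  exact hx (x.eq_zero_of_hasProjectiveDimensionLT n le_rfl)

end Columns

end

/-! ### Krull dimension is bounded by transcendence degree. -/

noncomputable section

section TranscendenceDegree

open Polynomial in
/-- A non-zero element of the kernel of `f` is independent of any family with independent image. -/
lemma AlgebraicIndependent.option_elim_of_map_eq_zero {k S T ι : Type*} [Field k] [CommRing S]
    [IsDomain S] [CommRing T] [Algebra k S] [Algebra k T] (f : S →ₐ[k] T) {x : ι → S}
    (hx : AlgebraicIndependent k (f ∘ x)) {y : S} (hy : y ≠ 0) (hfy : f y = 0) :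
    AlgebraicIndependent k (fun o : Option ι => o.elim y x) := by
  have hx' : AlgebraicIndependent k x := AlgebraicIndependent.of_comp f hx
  have hf : ∀ b : Algebra.adjoin k (Set.range x), f b = 0 → b = 0 := by
    rintro ⟨b, hb⟩ h0
    rw [Algebra.adjoin_range_eq_range_aeval] at hb
    obtain ⟨p, rfl⟩ := hb
    have h1 : MvPolynomial.aeval (f ∘ x) p = 0 := by
      rw [← h0]
      exact (MvPolynomial.comp_aeval_apply x f p).symm
    have h2 : p = 0 := hx (by rw [h1, map_zero])
    exact Subtype.ext (by simp [h2])
  refine (hx'.option_iff_transcendental y).2 ?_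
  rw [transcendental_iff]
  intro p
  induction hn : p.natDegree using Nat.strong_induction_on generalizing p with
  | _ n ih =>
  intro hp
  have h1 : aeval y p.divX * y + (p.coeff 0 : S) = 0 := by
    conv_rhs => rw [← hp, ← p.divX_mul_X_add]
    simp
  -- Applying `f` to the relation leaves its constant term, as `f y = 0`, and `f` is injective on
  -- the subalgebra generated by `x`. Cancelling `y` then lowers the degree.
  have h2 : p.coeff 0 = 0 := by
    refine hf _ ?_
    have := congrArg f h1
    simpa [hfy] using this
  rw [h2, ZeroMemClass.coe_zero, add_zero] at h1
  have h3 : aeval y p.divX = 0 := (mul_eq_zero.1 h1).resolve_right hy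
  have h4 : p.divX = 0 := by
    by_cases hd : p.natDegree = 0
    · rw [Polynomial.divX_eq_zero_iff, Polynomial.eq_C_of_natDegree_eq_zero hd]
      simp
    · refine ih p.divX.natDegree ?_ _ rfl h3
      rw [Polynomial.natDegree_divX_eq_natDegree_tsub_one]
      lia
  rw [← p.divX_mul_X_add, h4, h2]
  simp

/-- A chain of primes of length `d` yields `d` algebraically independent elements. -/
lemma exists_algebraicIndependent_of_chain (k : Type*) {S : Type*} [Field k] [CommRing S]
    [Algebra k S] (d : ℕ) (P : ℕ → Ideal S) (hP : ∀ i ≤ d, (P i).IsPrime)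
    (hlt : ∀ i < d, P i < P (i + 1)) :
    ∃ (ι : Type) (_ : Fintype ι) (x : ι → S), Fintype.card ι = d ∧
      AlgebraicIndependent k (Ideal.Quotient.mkₐ k (P 0) ∘ x) := by
  induction d generalizing P with
  | zero =>
    have := hP 0 le_rfl
    refine ⟨Empty, inferInstance, Empty.elim, rfl, ?_⟩
    exact algebraicIndependent_empty_type_iff.2 (algebraMap k (S ⧸ P 0)).injective
  | succ d ih =>
    obtain ⟨ι, _, x, hι, hx⟩ := ih (fun i => P (i + 1)) (fun i hi => hP _ (by lia))
      (fun i hi => hlt _ (by lia))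
    obtain ⟨y, hy, hy0⟩ := SetLike.exists_of_lt (hlt 0 (by lia))
    have := hP 0 (by lia)
    refine ⟨Option ι, inferInstance, fun o => o.elim y x, by simp [hι], ?_⟩
    have h1 := AlgebraicIndependent.option_elim_of_map_eq_zero
      (Ideal.Quotient.factorₐ k (hlt 0 (by lia)).le) (x := Ideal.Quotient.mkₐ k (P 0) ∘ x) hx
      (y := Ideal.Quotient.mkₐ k (P 0) y)
      (fun h => hy0 (Ideal.Quotient.eq_zero_iff_mem.1 h)) (Ideal.Quotient.eq_zero_iff_mem.2 hy)
    convert! h1 using 1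
    funext o
    cases o <;> rfl

theorem ringKrullDim_le_of_trdeg {k S T : Type*} [Field k] [CommRing S] [CommRing T] [Algebra k S]
    [Algebra k T] [Nontrivial T] (f : S →ₐ[k] T) (hf : Function.Injective f) {n : ℕ}
    (hn : Algebra.trdeg k T ≤ n) : ringKrullDim S ≤ n := by
  refine iSup_le fun s => ?_
  obtain ⟨ι, _, x, hι, hx⟩ := exists_algebraicIndependent_of_chain k s.length
    (fun i => (s ⟨min i s.length, by lia⟩).asIdeal) (fun i _ => (s _).isPrime) (fun i hi => by
      refine s.strictMono (a := ⟨min i s.length, by lia⟩) (b := ⟨min (i + 1) s.length, by lia⟩) ?_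
      rw [Fin.mk_lt_mk]
      lia)
  have h1 := (AlgebraicIndependent.of_comp _ hx).map' hf
  have h2 := h1.lift_cardinalMk_le_trdeg
  have h3 := h2.trans (Cardinal.lift_le.2 hn)
  rw [Cardinal.mk_fintype, Cardinal.lift_natCast, Cardinal.lift_natCast, Nat.cast_le, hι] at h3
  exact_mod_cast h3

end TranscendenceDegree

/-! ### The Laurent ring and a chain of primes in it. -/

section Laurent

variable {k M : Type*} [Field k] [AddCommGroup M]

lemma isDomain_laurent [Module.Free ℤ M] : IsDomain (AddMonoidAlgebra k M) := by
  have : UniqueSums M := UniqueSums.of_injective_addHom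
    (Module.Free.chooseBasis ℤ M).repr.toAddEquiv.toAddHom
    (Module.Free.chooseBasis ℤ M).repr.injective inferInstance
  infer_instance

variable {n : ℕ}

/-- The exponents whose monomials are algebraic over the subalgebra generated by the `x ^ b i` form
a submonoid. It contains `-b i`, as `x ^ (-b i)` is a root of `x ^ b i * X - 1`. -/
lemma trdeg_laurent_le (b : Module.Basis (Fin n) ℤ M) : Algebra.trdeg k (AddMonoidAlgebra k M) ≤ n := by
  have : Module.Free ℤ M := Module.Free.of_basis b
  have := isDomain_laurent (k := k) (M := M)
  let s : Set (AddMonoidAlgebra k M) := Set.range fun i => AddMonoidAlgebra.single (b i) 1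
  have hs : Cardinal.mk s ≤ n := by
    have := Cardinal.mk_range_le_lift (f := fun i => AddMonoidAlgebra.single (b i) (1 : k))
    simpa using this
  have halg : Algebra.IsAlgebraic (Algebra.adjoin k s) (AddMonoidAlgebra k M) := by
    let N : AddSubmonoid M :=
      { carrier := {m | IsAlgebraic (Algebra.adjoin k s) (AddMonoidAlgebra.single m (1 : k))}
        zero_mem' := by
          rw [Set.mem_ofPred_eq, ← AddMonoidAlgebra.one_def]
          exact isAlgebraic_one
        add_mem' := fun {m m'} hm hm' => by
          rw [Set.mem_ofPred_eq] at *
          have := hm.mul hm'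
          rwa [AddMonoidAlgebra.single_mul_single, mul_one] at this }
    have hb : ∀ i, b i ∈ N := fun i => isAlgebraic_algebraMap
      (⟨_, Algebra.subset_adjoin ⟨i, rfl⟩⟩ : Algebra.adjoin k s)
    have hb' : ∀ i, -b i ∈ N := by
      intro i
      refine ⟨Polynomial.C (⟨_, Algebra.subset_adjoin ⟨i, rfl⟩⟩ : Algebra.adjoin k s) *
        Polynomial.X - 1, fun h => ?_, ?_⟩
      · have := congrArg (Polynomial.coeff · 0) h
        simp at this
      · simp only [map_sub, map_mul, Polynomial.aeval_C, Polynomial.aeval_X, map_one]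
        change AddMonoidAlgebra.single (b i) 1 * AddMonoidAlgebra.single (-b i) 1 - 1 = 0
        rw [AddMonoidAlgebra.single_mul_single, add_neg_cancel, mul_one,
          ← AddMonoidAlgebra.one_def, sub_self]
    have hN : ∀ m, m ∈ N := by
      intro m
      rw [← b.sum_repr m]
      refine AddSubmonoid.sum_mem _ fun i _ => ?_
      rcases Int.eq_nat_or_neg (b.repr m i) with ⟨t, h | h⟩
      · rw [h, natCast_zsmul]
        exact AddSubmonoid.nsmul_mem _ (hb i) t
      · rw [h, neg_smul, ← smul_neg, natCast_zsmul]
        exact AddSubmonoid.nsmul_mem _ (hb' i) t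
    refine ⟨fun f => ?_⟩
    induction f using AddMonoidAlgebra.induction_linear with
    | zero => exact isAlgebraic_zero
    | add f g hf hg => exact hf.add hg
    | single m a =>
      have h1 : AddMonoidAlgebra.single m a = a • AddMonoidAlgebra.single m (1 : k) := by simp
      rw [h1, ← algebraMap_smul (Algebra.adjoin k s) a]
      exact (hN m).smul _
  exact (Algebra.IsAlgebraic.trdeg_le_cardinalMk k s).trans hs

variable (b : Module.Basis (Fin n) ℤ M)

/-- The projection of a lattice that kills the first `j` basis vectors. -/
def dropProj (j : ℕ) : M →ₗ[ℤ] M := b.constr ℤ fun i => if (i : ℕ) < j then 0 else b i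

@[simp] lemma dropProj_basis (j : ℕ) (i : Fin n) :
    dropProj b j (b i) = if (i : ℕ) < j then 0 else b i := by
  rw [dropProj, Module.Basis.constr_basis]

lemma dropProj_dropProj {i j : ℕ} (h : i ≤ j) (m : M) :
    dropProj b j (dropProj b i m) = dropProj b j m := by
  rw [← LinearMap.comp_apply]
  congr 1
  refine b.ext fun a => ?_
  rw [LinearMap.comp_apply, dropProj_basis, dropProj_basis]
  by_cases h1 : (a : ℕ) < i
  · rw [if_pos h1, map_zero, if_pos (by lia)]
  · rw [if_neg h1, dropProj_basis]

lemma dropProj_sub_dropProj (j : Fin n) (m : M) :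
    dropProj b j m - dropProj b (j + 1) m = b.repr m j • b j := by
  have : dropProj b j - dropProj b (j + 1) =
      (LinearMap.toSpanSingleton ℤ M (b j)) ∘ₗ b.coord j := by
    refine b.ext fun a => ?_
    rw [LinearMap.sub_apply, dropProj_basis, dropProj_basis, LinearMap.comp_apply]
    rcases lt_trichotomy (a : ℕ) j with h | h | h
    · have : a ≠ j := by rintro rfl; lia
      simp [h, this, show (a : ℕ) < j + 1 by lia]
    · have : a = j := Fin.ext h
      subst this
      simp
    · have : a ≠ j := by rintro rfl; lia
      simp [this, show ¬ (a : ℕ) < j by lia, show ¬ (a : ℕ) < j + 1 by lia]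
  exact LinearMap.congr_fun this m

/-- The endomorphism of the Laurent ring induced by `dropProj`. -/
def dropHom (k : Type*) [Field k] (j : ℕ) : AddMonoidAlgebra k M →ₐ[k] AddMonoidAlgebra k M :=
  AddMonoidAlgebra.mapDomainAlgHom k k (dropProj b j).toAddMonoidHom

@[simp] lemma dropHom_single (j : ℕ) (m : M) (a : k) :
    dropHom b k j (AddMonoidAlgebra.single m a) = AddMonoidAlgebra.single (dropProj b j m) a := by
  simp [dropHom]

/-- The ideal generated by the `x ^ b i - 1` with `i < j`. -/
def dropIdeal (k : Type*) [Field k] (j : ℕ) : Ideal (AddMonoidAlgebra k M) :=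
  RingHom.ker (dropHom b k j)

lemma mem_dropIdeal {j : ℕ} {f : AddMonoidAlgebra k M} :
    f ∈ dropIdeal b k j ↔ dropHom b k j f = 0 := Iff.rfl

lemma dropIdeal_ne_top (j : ℕ) : dropIdeal b k j ≠ ⊤ := RingHom.ker_ne_top _

lemma dropIdeal_mono : Monotone (dropIdeal b k) := by
  intro i j h f hf
  have : dropHom b k j = (dropHom b k j).comp (dropHom b k i) := by
    refine AddMonoidAlgebra.algHom_ext (fun m => ?_) (Subsingleton.elim _ _)
    rw [AlgHom.comp_apply, dropHom_single, dropHom_single, dropHom_single, dropProj_dropProj b h]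
  rw [mem_dropIdeal] at hf ⊢
  rw [this, AlgHom.comp_apply, hf, map_zero]

/-- A monomial multiple of `x ^ b j - 1`. -/
def shiftedSub (k : Type*) [Field k] (c : M) (j : Fin n) : AddMonoidAlgebra k M :=
  AddMonoidAlgebra.single c 1 * (AddMonoidAlgebra.single (b j) 1 - 1)

lemma shiftedSub_mem (c : M) (j : Fin n) : shiftedSub b k c j ∈ dropIdeal b k (j + 1) := by
  rw [mem_dropIdeal, shiftedSub, map_mul, map_sub, dropHom_single, dropHom_single, map_one,
    dropProj_basis, if_pos (by lia), ← AddMonoidAlgebra.one_def, sub_self, mul_zero]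

/-- The map with kernel `dropIdeal b k j` fixes `x ^ b j`, so it sends the multiplier to a non-zero
element of a domain. -/
lemma mem_dropIdeal_of_shiftedSub_mul_mem (c : M) (j : Fin n) {f : AddMonoidAlgebra k M}
    (hf : shiftedSub b k c j * f ∈ dropIdeal b k j) : f ∈ dropIdeal b k j := by
  have : Module.Free ℤ M := Module.Free.of_basis b
  have := isDomain_laurent (k := k) (M := M)
  rw [mem_dropIdeal, map_mul] at hf
  refine (mul_eq_zero.1 hf).resolve_left ?_
  rw [shiftedSub, map_mul, map_sub, dropHom_single, dropHom_single, map_one, dropProj_basis,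
    if_neg (by lia)]
  refine mul_ne_zero (by simp) (sub_ne_zero.2 fun h => b.ne_zero j ?_)
  rw [AddMonoidAlgebra.one_def, ← AddMonoidAlgebra.coeff_inj, AddMonoidAlgebra.coeff_single,
    AddMonoidAlgebra.coeff_single] at h
  exact Finsupp.single_left_injective one_ne_zero h

lemma shiftedSub_notMem (c : M) (j : Fin n) : shiftedSub b k c j ∉ dropIdeal b k j := fun h =>
  dropIdeal_ne_top b (k := k) j ((Ideal.eq_top_iff_one _).2
    (mem_dropIdeal_of_shiftedSub_mul_mem b c j (by rwa [mul_one])))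

/-- The exponents whose monomials become `1` modulo the right-hand ideal form a subgroup containing
`b j` and every `m - dropProj b j m`, hence every `m - dropProj b (j + 1) m`. So the quotient map
factors through `dropHom b k (j + 1)`. -/
lemma dropIdeal_succ (c : M) (j : Fin n) : dropIdeal b k (j + 1) =
    dropIdeal b k j ⊔ Ideal.span {shiftedSub b k c j} := by
  apply le_antisymm
  · set I := dropIdeal b k j ⊔ Ideal.span {shiftedSub b k c j} with hI
    let F : Multiplicative M →* AddMonoidAlgebra k M ⧸ I :=
      (Ideal.Quotient.mk I : AddMonoidAlgebra k M →* _).comp (AddMonoidAlgebra.of k M)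
    have hF : ∀ m : M, Multiplicative.ofAdd m ∈ F.ker ↔ AddMonoidAlgebra.single m 1 - 1 ∈ I := by
      intro m
      rw [MonoidHom.mem_ker, ← Ideal.Quotient.mk_eq_mk_iff_sub_mem, map_one]
      rfl
    have h1 : Multiplicative.ofAdd (b j) ∈ F.ker := by
      rw [hF]
      have : AddMonoidAlgebra.single (b j) (1 : k) - 1 =
          AddMonoidAlgebra.single (-c) 1 * shiftedSub b k c j := by
        rw [shiftedSub, ← mul_assoc, AddMonoidAlgebra.single_mul_single, neg_add_cancel, mul_one,
          ← AddMonoidAlgebra.one_def, one_mul]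
      rw [this]
      exact Ideal.mul_mem_left _ _ (Ideal.mem_sup_right (Ideal.mem_span_singleton_self _))
    have h2 : ∀ m, Multiplicative.ofAdd (m - dropProj b (j + 1) m) ∈ F.ker := by
      intro m
      have e1 : m - dropProj b (j + 1) m = (m - dropProj b j m) + b.repr m j • b j := by
        rw [← dropProj_sub_dropProj]; abel
      rw [e1, ofAdd_add]
      refine Subgroup.mul_mem _ ?_ ?_
      · rw [hF]
        refine Ideal.mem_sup_left ?_
        rw [mem_dropIdeal, map_sub, dropHom_single, map_one, map_sub, dropProj_dropProj b le_rfl,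
          sub_self, ← AddMonoidAlgebra.one_def, sub_self]
      · rw [ofAdd_zsmul]
        exact Subgroup.zpow_mem _ h1 _
    have h3 : Ideal.Quotient.mkₐ k I = (Ideal.Quotient.mkₐ k I).comp (dropHom b k (j + 1)) := by
      refine AddMonoidAlgebra.algHom_ext (fun m => ?_) (Subsingleton.elim _ _)
      rw [AlgHom.comp_apply, dropHom_single]
      have := h2 m
      rw [ofAdd_sub, div_eq_mul_inv, mul_comm] at this
      exact F.eq_iff.2 this
    intro f hf
    rw [mem_dropIdeal] at hf
    have := DFunLike.congr_fun h3 f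
    rw [AlgHom.comp_apply, hf, map_zero] at this
    exact Ideal.Quotient.eq_zero_iff_mem.1 this
  · refine sup_le (dropIdeal_mono b (by lia)) ?_
    rw [Ideal.span_singleton_le_iff_mem]
    exact shiftedSub_mem b c j

lemma dropIdeal_isPrime (j : ℕ) : (dropIdeal b k j).IsPrime := by
  have : Module.Free ℤ M := Module.Free.of_basis b
  have := isDomain_laurent (k := k) (M := M)
  exact RingHom.ker_isPrime _

end Laurent

end

/-! ### Krull dimension of the toric algebra and the lower bound. -/

noncomputable section

namespace Toric

open CategoryTheory

universe u v w

variable {M : Type v} [AddCommGroup M] [Module.Free ℤ M] [Module.Finite ℤ M]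
  {J : Type} [Finite J] {l : J → Module.Dual ℤ M}
  {k : Type u} [Field k] {C : PointedCone ℝ (RealSpace M)}

lemma IsFacetSystem.exists_shiftedSub_mem (hl : IsFacetSystem C l) {n : ℕ}
    (b : Module.Basis (Fin n) ℤ M) (j : Fin n) : ∃ c, shiftedSub b k c j ∈ toricAlgebra k C := by
  obtain ⟨c, -, hc⟩ := hl.exists_single_mul_mem (AddMonoidAlgebra.single (b j) (1 : k) - 1)
  exact ⟨c, hc⟩

/-- The upper bound uses the embedding in the Laurent ring. For the lower bound, the primes
`dropIdeal b k j` stay distinct after contraction, since a suitable monomial multiple of `x ^ b j -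
1` lies in `R`. -/
theorem IsFacetSystem.ringKrullDim_toricAlgebra (hl : IsFacetSystem C l) :
    ringKrullDim (toricAlgebra k C) = Module.finrank ℤ M := by
  let b := Module.finBasis ℤ M
  have := isDomain_laurent (k := k) (M := M)
  apply le_antisymm
  · exact ringKrullDim_le_of_trdeg (toricAlgebra k C).val Subtype.val_injective
      (trdeg_laurent_le b)
  · let s : LTSeries (PrimeSpectrum (toricAlgebra k C)) :=
      { length := Module.finrank ℤ M
        toFun := fun j => ⟨(dropIdeal b k j).comap (toricAlgebra k C).val,
          have := dropIdeal_isPrime (k := k) b j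
          Ideal.comap_isPrime _ _⟩
        step := fun j => by
          obtain ⟨c, hc⟩ := hl.exists_shiftedSub_mem (k := k) b j
          change (dropIdeal b k j).comap (toricAlgebra k C).val <
            (dropIdeal b k (j + 1)).comap (toricAlgebra k C).val
          refine lt_of_le_not_ge (Ideal.comap_mono (dropIdeal_mono b (Nat.le_succ _))) fun h => ?_
          have hmem : (⟨_, hc⟩ : toricAlgebra k C) ∈
              (dropIdeal b k (j + 1)).comap (toricAlgebra k C).val := shiftedSub_mem b c j
          exact shiftedSub_notMem b c j (h hmem) }
    exact le_iSup (fun s : LTSeries (PrimeSpectrum (toricAlgebra k C)) =>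
      ((s.length : ℕ) : WithBot ℕ∞)) s

variable {ι : Type w} {v : ι → RealSpace M}

lemma IsFacetSystem.entry_algebraMap (hl : IsFacetSystem C l) [Fintype ι] [DecidableEq ι]
    (r : toricAlgebra k C) :
    hl.entry (algebraMap (toricAlgebra k C) (Module.End (toricAlgebra k C) (ConicSum k C v)) r) =
      Matrix.scalar ι (r : AddMonoidAlgebra k M) := by
  refine hl.entryFun_unique fun i j a => ?_
  rw [Module.algebraMap_end_apply, map_smul, Matrix.scalar_apply, Matrix.diagonal_apply]
  split_ifs with h
  · subst h
    rw [comp_incl_same]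
    rfl
  · rw [comp_incl_of_ne (Ne.symm h), zero_mul, smul_zero]
    rfl

theorem IsFacetSystem.exists_not_hasProjectiveDimensionLT (hl : IsFacetSystem C l) [Finite ι]
    [Nonempty ι] :
    ∃ X : ModuleCat.{max u v w} (Module.End (toricAlgebra k C) (ConicSum k C v)),
      ¬ HasProjectiveDimensionLT X (Module.finrank ℤ M) := by
  classical
  have := Fintype.ofFinite ι
  let b := Module.finBasis ℤ M
  choose c hc using hl.exists_shiftedSub_mem (k := k) b
  let r : ℕ → toricAlgebra k C := fun j => if h : j < Module.finrank ℤ M then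
    ⟨_, hc ⟨j, h⟩⟩ else 0
  have hr : ∀ j (h : j < Module.finrank ℤ M),
      (toricAlgebra k C).val.toRingHom (r j) = shiftedSub b k (c ⟨j, h⟩) ⟨j, h⟩ := by
    intro j h
    simp only [r, dif_pos h]
    rfl
  refine ⟨_, not_hasProjectiveDimensionLT_columns
    (hl.entry (k := k) (v := v)).toRingHom (ρ := (toricAlgebra k C).val.toRingHom)
    hl.entry_algebraMap (dropIdeal b k) r ?_ ?_ (dropIdeal_ne_top b _)⟩
  · intro j hj
    rw [hr j hj]
    exact dropIdeal_succ b _ ⟨j, hj⟩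
  · intro j hj a ha
    rw [hr j hj] at ha
    exact mem_dropIdeal_of_shiftedSub_mul_mem b _ ⟨j, hj⟩ ha

end Toric

end

theorem theorem6p1 {k : Type*} [Field k] {M : Type*} [AddCommGroup M] [Module.Free ℤ M]
    [Module.Finite ℤ M] (C : PointedCone ℝ (Toric.RealSpace M))
    (hrat : Toric.IsRationalPolyhedral C) (hfull : Toric.IsFullDimensional C)
    (hpointed : Toric.IsStronglyConvex C)
    {ι : Type*} (v : ι → Toric.RealSpace M)
    (hv : ∀ w : Toric.RealSpace M, ∃! i : ι,
      Nonempty (Toric.conicModule k C w ≃ₗ[Toric.toricAlgebra k C] Toric.conicModule k C (v i))) :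
    Finite ι ∧
      Toric.globalDimension
          (Module.End (Toric.toricAlgebra k C) (Toric.ConicSum k C v)) =
        ringKrullDim (Toric.toricAlgebra k C) := by
  obtain ⟨N, l, hl⟩ := Toric.exists_isFacetSystem hrat hfull hpointed
  have hfin := hl.finite_index hv
  -- A summand exists, so the column modules of the lower bound are non-zero.
  obtain ⟨i, -⟩ := (hv 0).exists
  have : Nonempty ι := ⟨i⟩
  refine ⟨hfin, ?_⟩
  rw [hl.ringKrullDim_toricAlgebra, Toric.globalDimension]
  apply le_antisymm
  · refine max_le (iSup_le fun X => ?_) (iSup_le fun X => ?_)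
    · exact (CategoryTheory.projectiveDimension_le_iff _ _).2 (hl.hasProjectiveDimensionLT hv X)
    · exact (CategoryTheory.projectiveDimension_le_iff _ _).2 (hl.hasProjectiveDimensionLT_op hv X)
  · obtain ⟨X, hX⟩ := hl.exists_not_hasProjectiveDimensionLT (k := k) (v := v)
    exact ((CategoryTheory.projectiveDimension_ge_iff _ _).2 hX).trans
      ((le_iSup (fun X => CategoryTheory.projectiveDimension X) X).trans (le_max_left _ _))
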